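/- Let $\alpha>0$, and for $0\le a<1$ let $w(x,a)=(1-x^2)^{\alpha}\bigl(1-\chi_{(-a,a)}(x)\bigr)$ on $[-1,1]$, where $\chi_{(-a,a)}$ is the indicator function of $(-a,a)$. For $n\ge 1$ and $0<a<1$ put $$\mathbb P(a,n)=\frac{\det\bigl(\int_{-1}^1x^{i+j}w(x,a)\,dx\bigr)_{i,j=0}^{n-1}}{\det\bigl(\int_{-1}^1x^{i+j}(1-x^2)^{\alpha}\,dx\bigr)_{i,j=0}^{n-1}},\qquad H_n(a)=a(a^2-1)\frac{d}{da}\ln\mathbb P(a,n)$$ (the probability that $(-a,a)$ is free of eigenvalues in the symmetric Jacobi unitary ensemble, and its logarithmic derivative up to a factor). (i) For every $n\ge1$ the function $\mathbb P(\cdot,n)$ is positive and smooth on $(0,1)$, and there $H=H_n(a)$ satisfies $\mathcal E_n(a,H,H',H'')=0$, where $\mathcal E_n(a,H,H',H'')$ denotes $$\begin{aligned} &\Big\{a^2(a^2-1)^4H''^2-4a^2(a^2-1)^2\big[(a^3-a)H'-(a^2-1)H-2a^2(\alpha+n)^2\big]H''+4a(a^2-1)^3H'^3\\ &-4(a^2-1)^2\big[a^4(\alpha+n-1)(\alpha+n+1)-4a^2n(2\alpha+n)+(5a^2-1)H\big]H'^2\\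 &+8a(a^2-1)\big[4(a^2-1)H^2+\big(a^4(2\alpha^2+2n^2+4\alpha n-1)+a^2(4\alpha^2+1)+4n(2\alpha+n)\big)H\\ &\qquad-2a^2(\alpha+n)^2(3a^2n^2+6\alpha a^2n+a^2+1)\big]H'-16(a^2-1)^2H^3\\ &-4(a^2-1)\big[a^4(4\alpha^2+4n^2+8\alpha n-1)+a^2(8\alpha^2+4n^2+8\alpha n+1)+4n(2\alpha+n)\big]H^2\\ &-16a^2(\alpha+n)^2\big[a^4(2\alpha^2-n^2-2\alpha n-1)+3a^2n(2\alpha+n)+1\big]H+32a^6(\alpha+n)^4(a^2n^2+2\alpha a^2n+1)\Big\}^2\\ &-64(\alpha+n)^2\big[a^4(\alpha+n)^2+(a^2-1)(H-aH')\big]\Big\{a^2(a^2-1)^2H''-2a(a^2-1)\big[a^2(2n^2+4\alpha n+1)-2H\big]H'\\ &\qquad-4(a^2-1)H^2-2a^2\big[(2\alpha^2-1)a^2+2n(2\alpha+n)+1\big]H+4a^4(\alpha+n)^2(a^2n^2+2\alpha a^2n+1)\Big\}^2 . \end{aligned}$$ (ii) Let $c=4i$. Under the substitution $t=cna$, $\sigma(t)=-H(t/(cn))$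 this equation reduces, as $n\to\infty$, to the $\sigma$-form of Painlevé V in (iii): for all complex numbers $t,y_0,y_1,y_2$, $$n^{-4}\,\mathcal E_n\Bigl(\tfrac{t}{cn},\,-y_0,\,-cn\,y_1,\,-(cn)^2y_2\Bigr)=\Bigl(16\bigl[(ty_2)^2+4ty_1^3-(4y_0+t^2)y_1^2+2ty_0y_1-y_0^2\bigr]\Bigr)^2+O\bigl(\tfrac1n\bigr)\qquad(n\to\infty).$$ (iii) For $t\in 4i(0,\infty)$ let $\sigma_n(t)=-H_n\bigl(t/(cn)\bigr)$, which is defined as soon as $n>t/(4i)$. There is a function $\sigma$, holomorphic in a neighbourhood of the half-line $4i(0,\infty)$, such that $\sigma_n\to\sigma$, $\sigma_n'\to\sigma'$ and $\sigma_n''\to\sigma''$ as $n\to\infty$, locally uniformly on this half-line (derivatives of $\sigma_n$ with respect to $t$ along the half-line). On the half-line $\sigma$ satisfies the Jimbo–Miwa–Okamoto $\sigma$-form of Painlevé V, $$(t\sigma'')^2=\bigl[\sigma-t\sigma'+2(\sigma')^2+(\nu_0+\nu_1+\nu_2+\nu_3)\sigma'\bigr]^2-4(\nu_0+\sigma')(\nu_1+\sigma')(\nu_2+\sigma')(\nu_3+\sigma'),$$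 with $\nu_0=\nu_1=\nu_2=\nu_3=0$, that is, $$(t\sigma'')^2=-4t(\sigma')^3+(4\sigma+t^2)(\sigma')^2-2t\sigma\sigma'+\sigma^2 .$$ -/

import Mathlib

open Set Filter Topology Asymptotics
open scoped ContDiff

noncomputable section

/-- The weight `w(x, a) = (1 - x^2)^α (1 - χ_{(-a,a)}(x))` on `[-1, 1]`. -/
def jacobiGapWeight (α a x : ℝ) : ℝ :=
  (1 - x ^ 2) ^ α * (1 - (Ioo (-a) a).indicator (fun _ => (1 : ℝ)) x)

/-- The `n × n` Hankel determinant of the moments of the weight `w(x, a)` on `[-1, 1]`. -/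
def hankelDet (α : ℝ) (n : ℕ) (a : ℝ) : ℝ :=
  (Matrix.of fun i j : Fin n =>
    ∫ x in (-1 : ℝ)..1, x ^ ((i : ℕ) + (j : ℕ)) * jacobiGapWeight α a x).det

/-- The gap probability `P(a, n)`: a ratio of Hankel determinants. At `a = 0` the interval
`(-a, a)` is empty, so that the denominator belongs to the weight `(1 - x^2)^α`. -/
def gapProb (α : ℝ) (n : ℕ) (a : ℝ) : ℝ :=
  hankelDet α n a / hankelDet α n 0

/-- `H_n(a) = a (a^2 - 1) d/da log P(a, n)`. -/
def gapH (α : ℝ) (n : ℕ) (a : ℝ) : ℝ :=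
  a * (a ^ 2 - 1) * deriv (fun b => Real.log (gapProb α n b)) a

/-- The function `s ↦ σ_n(4 i s)`, where `σ_n(t) = - H_n(t / (4 i n))`. -/
def scaledSigma (α : ℝ) (n : ℕ) (s : ℝ) : ℝ :=
  - gapH α n (s / n)

/-- The second order differential equation of `H_n`, as a polynomial in `a`, `H = H_n(a)`,
`H₁ = H_n'(a)`, `H₂ = H_n''(a)`: left hand side minus right hand side. -/
def hnaDefect {K : Type*} [CommRing K] (α n a H H₁ H₂ : K) : K :=
  (a ^ 2 * (a ^ 2 - 1) ^ 4 * H₂ ^ 2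
    - 4 * a ^ 2 * (a ^ 2 - 1) ^ 2
        * ((a ^ 3 - a) * H₁ - (a ^ 2 - 1) * H - 2 * a ^ 2 * (α + n) ^ 2) * H₂
    + 4 * a * (a ^ 2 - 1) ^ 3 * H₁ ^ 3
    - 4 * (a ^ 2 - 1) ^ 2
        * (a ^ 4 * (α + n - 1) * (α + n + 1) - 4 * a ^ 2 * n * (2 * α + n)
            + (5 * a ^ 2 - 1) * H) * H₁ ^ 2
    + 8 * a * (a ^ 2 - 1)
        * (4 * (a ^ 2 - 1) * H ^ 2
            + (a ^ 4 * (2 * α ^ 2 + 2 * n ^ 2 + 4 * α * n - 1) + a ^ 2 * (4 * α ^ 2 + 1)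
                + 4 * n * (2 * α + n)) * H
            - 2 * a ^ 2 * (α + n) ^ 2
                * (3 * a ^ 2 * n ^ 2 + 6 * α * a ^ 2 * n + a ^ 2 + 1)) * H₁
    - 16 * (a ^ 2 - 1) ^ 2 * H ^ 3
    - 4 * (a ^ 2 - 1)
        * (a ^ 4 * (4 * α ^ 2 + 4 * n ^ 2 + 8 * α * n - 1)
            + a ^ 2 * (8 * α ^ 2 + 4 * n ^ 2 + 8 * α * n + 1) + 4 * n * (2 * α + n)) * H ^ 2
    - 16 * a ^ 2 * (α + n) ^ 2
        * (a ^ 4 * (2 * α ^ 2 - n ^ 2 - 2 * α * n - 1) + 3 * a ^ 2 * n * (2 * α + n) + 1) * H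
    + 32 * a ^ 6 * (α + n) ^ 4 * (a ^ 2 * n ^ 2 + 2 * α * a ^ 2 * n + 1)) ^ 2
  - 64 * (α + n) ^ 2 * (a ^ 4 * (α + n) ^ 2 + (a ^ 2 - 1) * (H - a * H₁))
      * (a ^ 2 * (a ^ 2 - 1) ^ 2 * H₂
          - 2 * a * (a ^ 2 - 1) * (a ^ 2 * (2 * n ^ 2 + 4 * α * n + 1) - 2 * H) * H₁
          - 4 * (a ^ 2 - 1) * H ^ 2
          - 2 * a ^ 2 * ((2 * α ^ 2 - 1) * a ^ 2 + 2 * n * (2 * α + n) + 1) * H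
          + 4 * a ^ 4 * (α + n) ^ 2 * (a ^ 2 * n ^ 2 + 2 * α * a ^ 2 * n + 1)) ^ 2

/-- The Jimbo–Miwa–Okamoto σ-form of Painlevé V with parameters `ν₀, ν₁, ν₂, ν₃`, as a relation
between `t`, `y₀ = σ(t)`, `y₁ = σ'(t)`, `y₂ = σ''(t)`. -/
def SigmaPV (ν : Fin 4 → ℂ) (t y₀ y₁ y₂ : ℂ) : Prop :=
  (t * y₂) ^ 2 =
    (y₀ - t * y₁ + 2 * y₁ ^ 2 + (∑ i, ν i) * y₁) ^ 2 - 4 * ∏ i, (ν i + y₁)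

/-- Left hand side minus right hand side of
`(t σ'')² = -4 t σ'³ + (4 σ + t²) σ'² - 2 t σ σ' + σ²`, in `t, σ, σ', σ''`. -/
def jmmsDefect (t y₀ y₁ y₂ : ℂ) : ℂ :=
  (t * y₂) ^ 2 -
    (-4 * t * y₁ ^ 3 + (4 * y₀ + t ^ 2) * y₁ ^ 2 - 2 * t * y₀ * y₁ + y₀ ^ 2)

end

/-! ### Monic orthogonal polynomials of a symmetric positive functional -/

noncomputable section OrthogonalPolynomials

open Polynomial

/-! The Hankel determinant is the product of the squared norms h_k of the monic orthogonal
polynomials P_k of the cut weight. Moving the endpoint a changes h_k only through boundary terms, so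
H_n(a) = 2a(1-a²)w K_n(a,a) with w = (1-a²)^α and K_n the Christoffel–Darboux kernel.

Equation in a. Put n = m+1, N = n+α, let β be the recurrence coefficient h_n/h_(n-1), and let Z, U,
V be the endpoint quantities `gapZ`, `gapU`, `gapV`, so that UV = βZ². Integration by parts gives
ladder relations. At x = 1 these yield an algebraic constraint between Z, U, V and β
(`IsPearson.gap_constraint`); at x = a they express H through Z and β (`IsPearson.orthoKernel_eq`).
With the variation of P_k in a they give Z' and β' in terms of U and V. Hence the first integral aH'
- H = (1-a²)Z² - 2Na²Z (`gapH_first_integral`). Its derivative contains (2N+1)V - (2N-1)U, while H'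
contains (2N+1)V + (2N-1)U; the squares of these differ by a multiple of UV = βZ², so U, V and β all
drop out. Eliminating Z, a root of a quadratic, costs one more squaring and produces `hnaDefect`
(`hnaDefect_eq_zero`).

Formal limit. With ε = 1/n the rescaled equation is polynomial in ε, and its value at ε = 0 is the
square of 16 times the σ-form (`scaledDefect_zero`).

Genuine limit. P(s/n, n) is the determinant of 1 minus the kernel coefficients of the uncut weight
times the moments over the gap (`gapProb_eq_det`). After rescaling, the entries converge, with
factorial bounds, even for complex s. The determinants therefore converge locally uniformly to an
entire function F (`exists_tendsto_cornerDet`, `exists_tendsto_scaledGapProb`). Only the existence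
of limits is used; the limiting kernel is never identified. F has no positive zero
(`limitGapProb_ne_zero`), so σ_n and its derivatives converge near the half-line to zF'/F and its
derivatives, and the finite-n equation passes to the limit. -/

/-- The monic orthogonal polynomials of a symmetric positive moment functional. -/
def orthoPoly (L : ℝ[X] →ₗ[ℝ] ℝ) : ℕ → ℝ[X]
  | 0 => 1
  | 1 => X
  | n + 2 => X * orthoPoly L (n + 1)
      - C (L (orthoPoly L (n + 1) ^ 2) / L (orthoPoly L n ^ 2)) * orthoPoly L n

/-- The squared norm of the `n`-th orthogonal polynomial. -/
def orthoNorm (L : ℝ[X] →ₗ[ℝ] ℝ) (n : ℕ) : ℝ := L (orthoPoly L n ^ 2)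

/-- The coefficient of the three term recurrence. -/
def recCoeff (L : ℝ[X] →ₗ[ℝ] ℝ) : ℕ → ℝ
  | 0 => 0
  | n + 1 => orthoNorm L (n + 1) / orthoNorm L n

/-- A moment functional that is invariant under `x ↦ -x` and positive. -/
structure IsSymmPos (L : ℝ[X] →ₗ[ℝ] ℝ) : Prop where
  symm : ∀ p : ℝ[X], L (p.comp (-X)) = L p
  pos : ∀ p : ℝ[X], p ≠ 0 → 0 < L (p ^ 2)

theorem orthoPoly_add_two (L : ℝ[X] →ₗ[ℝ] ℝ) (n : ℕ) :
    orthoPoly L (n + 2) = X * orthoPoly L (n + 1) - C (recCoeff L (n + 1)) * orthoPoly L n := by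
  rw [orthoPoly, recCoeff, orthoNorm, orthoNorm]

theorem X_mul_orthoPoly (L : ℝ[X] →ₗ[ℝ] ℝ) (n : ℕ) :
    X * orthoPoly L n = orthoPoly L (n + 1) + C (recCoeff L n) * orthoPoly L (n - 1) := by
  cases n with
  | zero => simp [orthoPoly, recCoeff]
  | succ n => rw [orthoPoly_add_two]; simp

/-- Positivity is not needed: a vanishing norm only affects the lower order term. The degree bound
is thus available for every endpoint b, as `HasCoeffDeriv` demands. -/
theorem orthoPoly_monic_natDegree (L : ℝ[X] →ₗ[ℝ] ℝ) (n : ℕ) :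
    (orthoPoly L n).Monic ∧ (orthoPoly L n).natDegree = n := by
  induction n using Nat.strong_induction_on with
  | _ n ih =>
    match n with
    | 0 => simp [orthoPoly]
    | 1 => simp [orthoPoly, monic_X]
    | n + 2 =>
      obtain ⟨hm, hd⟩ := ih (n + 1) (by omega)
      obtain ⟨hm', hd'⟩ := ih n (by omega)
      have h1 : (X * orthoPoly L (n + 1)).Monic := monic_X.mul hm
      have h2 : (X * orthoPoly L (n + 1)).natDegree = n + 2 := by
        rw [monic_X.natDegree_mul hm, hd, natDegree_X]; omega
      have h3 : (C (recCoeff L (n + 1)) * orthoPoly L n).degree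
          < (X * orthoPoly L (n + 1)).degree := by
        rw [degree_eq_natDegree h1.ne_zero, h2]
        refine (degree_le_natDegree).trans_lt ?_
        have : (C (recCoeff L (n + 1)) * orthoPoly L n).natDegree ≤ n :=
          (natDegree_C_mul_le _ _).trans hd'.le
        exact_mod_cast (by omega)
      rw [orthoPoly_add_two]
      exact ⟨h1.sub_of_left h3, (natDegree_eq_of_degree_eq
        (degree_sub_eq_left_of_degree_lt h3)).trans h2⟩

theorem orthoPoly_monic (L : ℝ[X] →ₗ[ℝ] ℝ) (n : ℕ) : (orthoPoly L n).Monic :=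
  (orthoPoly_monic_natDegree L n).1

theorem natDegree_orthoPoly (L : ℝ[X] →ₗ[ℝ] ℝ) (n : ℕ) : (orthoPoly L n).natDegree = n :=
  (orthoPoly_monic_natDegree L n).2

theorem degree_orthoPoly (L : ℝ[X] →ₗ[ℝ] ℝ) (n : ℕ) : (orthoPoly L n).degree = n := by
  rw [degree_eq_natDegree (orthoPoly_monic L n).ne_zero, natDegree_orthoPoly]

theorem orthoPoly_comp_neg (L : ℝ[X] →ₗ[ℝ] ℝ) (n : ℕ) :
    (orthoPoly L n).comp (-X) = (-1) ^ n * orthoPoly L n := by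
  induction n using Nat.strong_induction_on with
  | _ n ih =>
    match n with
    | 0 => simp [orthoPoly]
    | 1 => simp [orthoPoly]
    | n + 2 =>
      rw [orthoPoly_add_two]
      simp only [sub_comp, mul_comp, X_comp, C_comp, ih (n + 1) (by omega), ih n (by omega)]
      ring

theorem eval_neg_orthoPoly (L : ℝ[X] →ₗ[ℝ] ℝ) (n : ℕ) (x : ℝ) :
    (orthoPoly L n).eval (-x) = (-1) ^ n * (orthoPoly L n).eval x := by
  have := congrArg (eval x) (orthoPoly_comp_neg L n)
  simpa [eval_comp] using this

/-- A linear functional that vanishes on the first `n` orthogonal polynomials vanishes on all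
polynomials of degree less than `n`. -/
theorem map_eq_zero_of_map_orthoPoly (L ℓ : ℝ[X] →ₗ[ℝ] ℝ) {n : ℕ}
    (h : ∀ k < n, ℓ (orthoPoly L k) = 0) {q : ℝ[X]} (hq : q.degree < n) : ℓ q = 0 := by
  induction n generalizing q with
  | zero =>
    have : q = 0 := by
      rw [← degree_eq_bot]
      simpa using hq
    simp [this]
  | succ n ih =>
    have hd : (q - C (q.coeff n) * orthoPoly L n).degree < n := by
      rw [degree_lt_iff_coeff_zero]
      intro m hm
      rcases hm.eq_or_lt with rfl | hm
      · have := orthoPoly_monic L n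
        rw [Monic, leadingCoeff, natDegree_orthoPoly] at this
        simp [this]
      · rw [coeff_sub, coeff_C_mul, (degree_lt_iff_coeff_zero _ _).1 hq m (by omega),
          (coeff_eq_zero_of_natDegree_lt (by rwa [natDegree_orthoPoly]) :
            (orthoPoly L n).coeff m = 0)]
        simp
    have := ih (fun k hk => h k (by omega)) hd
    rw [map_sub, C_mul', map_smul, h n (by omega)] at this
    simpa using this

namespace IsSymmPos

theorem map_eq_zero_of_odd {L : ℝ[X] →ₗ[ℝ] ℝ} (hL : IsSymmPos L) {p : ℝ[X]}
    (hp : p.comp (-X) = -p) : L p = 0 := by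
  have := hL.symm p
  rw [hp, map_neg] at this
  linarith

theorem orthoNorm_pos {L : ℝ[X] →ₗ[ℝ] ℝ} (hL : IsSymmPos L) (n : ℕ) : 0 < orthoNorm L n :=
  hL.pos _ (orthoPoly_monic L n).ne_zero

theorem recCoeff_pos {L : ℝ[X] →ₗ[ℝ] ℝ} (hL : IsSymmPos L) (n : ℕ) : 0 < recCoeff L (n + 1) :=
  div_pos (hL.orthoNorm_pos _) (hL.orthoNorm_pos _)

theorem recCoeff_mul_orthoNorm {L : ℝ[X] →ₗ[ℝ] ℝ} (hL : IsSymmPos L) (n : ℕ) :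
    recCoeff L (n + 1) * orthoNorm L n = orthoNorm L (n + 1) := by
  rw [recCoeff, div_mul_cancel₀ _ (hL.orthoNorm_pos n).ne']

/-- In the recurrence for degree n + 2, orthogonality to degree n + 1 is parity, to degree n it is
the choice of the coefficient, and below that it is the induction hypothesis, multiplication by X
being moved to the other factor. -/
theorem map_orthoPoly_mul_orthoPoly {L : ℝ[X] →ₗ[ℝ] ℝ} (hL : IsSymmPos L) (n : ℕ) :
    ∀ k < n, L (orthoPoly L n * orthoPoly L k) = 0 := by
  induction n using Nat.strong_induction_on with
  | _ n ih =>
    match n with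
    | 0 => simp
    | 1 =>
      intro k hk
      obtain rfl : k = 0 := by omega
      exact hL.map_eq_zero_of_odd (by simp [orthoPoly])
    | n + 2 =>
      intro k hk
      have e : orthoPoly L (n + 2) * orthoPoly L k
          = orthoPoly L (n + 1) * (X * orthoPoly L k)
            - recCoeff L (n + 1) • (orthoPoly L n * orthoPoly L k) := by
        rw [orthoPoly_add_two, smul_eq_C_mul]; ring
      rw [e, map_sub, map_smul]
      rcases (show k = n + 1 ∨ k = n ∨ k < n by omega) with rfl | rfl | hk
      · rw [mul_comm (orthoPoly L n), ih (n + 1) (by omega) n (by omega),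
          hL.map_eq_zero_of_odd]
        · simp
        · simp only [mul_comp, orthoPoly_comp_neg, X_comp]
          have : ((-1 : ℝ[X]) ^ (n + 1)) * (-1) ^ (n + 1) = 1 := by
            rw [← mul_pow]; simp
          linear_combination (-X * orthoPoly L (n + 1) ^ 2) * this
      · rw [X_mul_orthoPoly, mul_add, map_add, mul_left_comm, C_mul', map_smul]
        have h2 : L (orthoPoly L (k + 1) * orthoPoly L (k - 1)) = 0 :=
          ih (k + 1) (by omega) _ (by omega)
        have h3 := hL.recCoeff_mul_orthoNorm k
        rw [h2, ← sq, ← sq]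
        simp only [orthoNorm] at h3
        simp [h3]
      · rw [X_mul_orthoPoly, mul_add, map_add, mul_left_comm, C_mul', map_smul,
          ih (n + 1) (by omega) _ (by omega), ih (n + 1) (by omega) _ (by omega),
          ih n (by omega) k hk]
        simp

theorem map_orthoPoly_mul {L : ℝ[X] →ₗ[ℝ] ℝ} (hL : IsSymmPos L) {n : ℕ} {q : ℝ[X]}
    (hq : q.degree < n) : L (orthoPoly L n * q) = 0 :=
  map_eq_zero_of_map_orthoPoly L (L ∘ₗ LinearMap.mulLeft ℝ (orthoPoly L n))
    (fun k hk => hL.map_orthoPoly_mul_orthoPoly n k hk) hq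

theorem map_orthoPoly_mul_ite {L : ℝ[X] →ₗ[ℝ] ℝ} (hL : IsSymmPos L) (n k : ℕ) :
    L (orthoPoly L n * orthoPoly L k) = if n = k then orthoNorm L n else 0 := by
  rcases lt_trichotomy n k with h | rfl | h
  · rw [mul_comm, hL.map_orthoPoly_mul_orthoPoly k n h, if_neg h.ne]
  · rw [if_pos rfl, ← sq, orthoNorm]
  · rw [hL.map_orthoPoly_mul_orthoPoly n k h, if_neg h.ne']

/-- The difference of the two sides is orthogonal to every polynomial of degree below n, hence to
itself, and positivity kills it. -/
theorem eq_sum_orthoPoly {L : ℝ[X] →ₗ[ℝ] ℝ} (hL : IsSymmPos L) {n : ℕ} {q : ℝ[X]}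
    (hq : q.degree < n) :
    q = ∑ k ∈ Finset.range n, (L (q * orthoPoly L k) / orthoNorm L k) • orthoPoly L k := by
  set r := ∑ k ∈ Finset.range n, (L (q * orthoPoly L k) / orthoNorm L k) • orthoPoly L k with hr
  have hrd : r.degree < n := by
    rw [← mem_degreeLT]
    refine Submodule.sum_mem _ fun k hk => Submodule.smul_mem _ _ ?_
    rw [mem_degreeLT, degree_orthoPoly]
    exact_mod_cast Finset.mem_range.1 hk
  have hd : (q - r).degree < n := (degree_sub_le _ _).trans_lt (max_lt hq hrd)
  by_contra hne
  have hpos := hL.pos (q - r) (sub_ne_zero.2 hne)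
  have h0 : L ((q - r) * (q - r)) = 0 := by
    refine map_eq_zero_of_map_orthoPoly L (L ∘ₗ LinearMap.mulLeft ℝ (q - r)) (fun k hk => ?_) hd
    have : L (r * orthoPoly L k) = L (q * orthoPoly L k) := by
      rw [hr, Finset.sum_mul, map_sum]
      simp only [smul_mul_assoc, map_smul, hL.map_orthoPoly_mul_ite, smul_eq_mul, mul_ite, mul_zero]
      rw [Finset.sum_ite_eq' _ k, if_pos (Finset.mem_range.2 hk),
        div_mul_cancel₀ _ (hL.orthoNorm_pos k).ne']
    simp [sub_mul, this]
  rw [sq, h0] at hpos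
  exact lt_irrefl _ hpos

/-- The Christoffel–Darboux identity, for a pair of linear functionals. -/
theorem christoffelDarboux {L : ℝ[X] →ₗ[ℝ] ℝ} (hL : IsSymmPos L) (e f : ℝ[X] →ₗ[ℝ] ℝ) (n : ℕ) :
    ∑ k ∈ Finset.range (n + 1), (e (X * orthoPoly L k) * f (orthoPoly L k)
        - e (orthoPoly L k) * f (X * orthoPoly L k)) / orthoNorm L k
      = (e (orthoPoly L (n + 1)) * f (orthoPoly L n)
        - e (orthoPoly L n) * f (orthoPoly L (n + 1))) / orthoNorm L n := by
  induction n with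
  | zero => simp [orthoPoly]
  | succ n ih =>
    rw [Finset.sum_range_succ, ih, X_mul_orthoPoly]
    simp only [C_mul', map_add, map_smul, smul_eq_mul, Nat.add_sub_cancel]
    have h1 := (hL.orthoNorm_pos n).ne'
    have h2 := (hL.orthoNorm_pos (n + 1)).ne'
    rw [recCoeff]
    field_simp
    ring

end IsSymmPos

end OrthogonalPolynomials

/-! ### Ladder relations and the algebraic constraint at the endpoint -/

noncomputable section Ladder

open Polynomial

/-- The Christoffel–Darboux kernel. -/
def orthoKernel (L : ℝ[X] →ₗ[ℝ] ℝ) (n : ℕ) (x y : ℝ) : ℝ :=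
  ∑ k ∈ Finset.range n, (orthoPoly L k).eval x * (orthoPoly L k).eval y / orthoNorm L k

theorem IsSymmPos.sub_mul_orthoKernel {L : ℝ[X] →ₗ[ℝ] ℝ} (hL : IsSymmPos L) (n : ℕ) (x y : ℝ) :
    (x - y) * orthoKernel L (n + 1) x y
      = ((orthoPoly L (n + 1)).eval x * (orthoPoly L n).eval y
        - (orthoPoly L n).eval x * (orthoPoly L (n + 1)).eval y) / orthoNorm L n := by
  have := hL.christoffelDarboux (leval x) (leval y) n
  simp only [leval_apply] at this
  rw [← this, orthoKernel, Finset.mul_sum]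
  refine Finset.sum_congr rfl fun k _ => ?_
  simp only [eval_mul, eval_X]
  ring

/-- No confluent limit is required: with one of the two functionals equal to evaluation of the
derivative, the product rule for X P_k leaves exactly P_k(x)². -/
theorem IsSymmPos.orthoKernel_self {L : ℝ[X] →ₗ[ℝ] ℝ} (hL : IsSymmPos L) (n : ℕ) (x : ℝ) :
    orthoKernel L (n + 1) x x
      = ((derivative (orthoPoly L (n + 1))).eval x * (orthoPoly L n).eval x
        - (derivative (orthoPoly L n)).eval x * (orthoPoly L (n + 1)).eval x)
          / orthoNorm L n := by
  have := hL.christoffelDarboux ((leval x).comp derivative) (leval x) n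
  simp only [leval_apply, LinearMap.comp_apply] at this
  rw [← this, orthoKernel]
  refine Finset.sum_congr rfl fun k _ => ?_
  simp only [eval_mul, eval_X, derivative_mul, derivative_X, eval_add, one_mul]
  ring

/-- The Pearson relation for the weight `(1 - x ^ 2) ^ α` cut at `a` and `-a`; `κ` is the boundary
value of `(1 - x ^ 2) ^ (α + 1)`. -/
def IsPearson (L : ℝ[X] →ₗ[ℝ] ℝ) (α a κ : ℝ) : Prop :=
  ∀ p : ℝ[X], L ((1 - X ^ 2) * derivative p)
    = (2 + 2 * α) * L (X * p) - κ * (p.eval a - p.eval (-a))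

theorem degree_one_sub_sq_mul_derivative_add {p : ℝ[X]} {n : ℕ} (hp : p.natDegree = n) :
    ((1 - X ^ 2) * derivative p + (n : ℝ) • (X * p)).degree < ((n + 1 : ℕ) : WithBot ℕ) := by
  rw [degree_lt_iff_coeff_zero]
  intro m hm
  obtain ⟨m, rfl⟩ : ∃ j, m = j + 1 := ⟨m - 1, by omega⟩
  have h1 : p.coeff (m + 1 + 1) = 0 := coeff_eq_zero_of_natDegree_lt (by omega)
  have h2 : ((1 - X ^ 2) * derivative p).coeff (m + 1) = -(p.coeff m * m) := by
    rw [sub_mul, one_mul, coeff_sub, coeff_derivative, h1, sq, mul_assoc, coeff_X_mul]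
    cases m with
    | zero => simp
    | succ m => rw [coeff_X_mul, coeff_derivative]; push_cast; ring
  rw [coeff_add, h2, coeff_smul, coeff_X_mul, smul_eq_mul]
  rcases (show n ≤ m by omega).eq_or_lt with rfl | h
  · ring
  · rw [coeff_eq_zero_of_natDegree_lt (by omega : p.natDegree < m)]; ring

/-- Expand the left side in the P_k. The coefficient k = n vanishes by parity. For k < n the Pearson
relation, applied to P_n P_k, moves the derivative onto P_k; what survives is the pairing of P_n
with X P_k, nonzero only for k = n - 1, and the boundary terms. -/
theorem IsPearson.ladder {L : ℝ[X] →ₗ[ℝ] ℝ} (hL : IsSymmPos L) {α a κ : ℝ}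
    (hP : IsPearson L α a κ) (n : ℕ) :
    (1 - X ^ 2) * derivative (orthoPoly L n) + (n : ℝ) • (X * orthoPoly L n)
      = ((2 * n + 1 + 2 * α) * recCoeff L n) • orthoPoly L (n - 1)
        - κ • ∑ k ∈ Finset.range n,
          (((orthoPoly L n).eval a * (orthoPoly L k).eval a
            - (orthoPoly L n).eval (-a) * (orthoPoly L k).eval (-a)) / orthoNorm L k)
            • orthoPoly L k := by
  set q := (1 - X ^ 2) * derivative (orthoPoly L n) + (n : ℝ) • (X * orthoPoly L n) with hq
  have hdq : q.degree < ((n + 1 : ℕ) : WithBot ℕ) :=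
    degree_one_sub_sq_mul_derivative_add (natDegree_orthoPoly L n)
  have hqc : q.comp (-X) = -((-1) ^ n * q) := by
    have h1 := congrArg derivative (orthoPoly_comp_neg L n)
    rw [derivative_comp] at h1
    have h2 : derivative ((-1 : ℝ[X]) ^ n * orthoPoly L n)
        = (-1) ^ n * derivative (orthoPoly L n) := by
      rw [show ((-1 : ℝ[X]) ^ n) = C ((-1) ^ n) by simp, derivative_C_mul]
    rw [h2] at h1
    simp only [derivative_neg, derivative_X] at h1
    simp only [hq, add_comp, mul_comp, sub_comp, one_comp, pow_comp, X_comp, C_comp,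
      orthoPoly_comp_neg, smul_eq_C_mul]
    linear_combination (-(1 - X ^ 2)) * h1
  have hn : L (q * orthoPoly L n) = 0 := by
    refine hL.map_eq_zero_of_odd ?_
    rw [mul_comp, hqc, orthoPoly_comp_neg]
    have : ((-1 : ℝ[X]) ^ n) * (-1) ^ n = 1 := by
      rw [← mul_pow]; simp
    linear_combination (-q * orthoPoly L n) * this
  have hk : ∀ k < n, L (q * orthoPoly L k)
      = (2 * n + 1 + 2 * α) * (if k + 1 = n then orthoNorm L n else 0)
        - κ * ((orthoPoly L n).eval a * (orthoPoly L k).eval a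
            - (orthoPoly L n).eval (-a) * (orthoPoly L k).eval (-a)) := by
    intro k hk
    have h1 := hP (orthoPoly L n * orthoPoly L k)
    have h2 : L (orthoPoly L n * ((1 - X ^ 2) * derivative (orthoPoly L k)
        + (k : ℝ) • (X * orthoPoly L k))) = 0 := by
      refine hL.map_orthoPoly_mul ((degree_one_sub_sq_mul_derivative_add
        (natDegree_orthoPoly L k)).trans_le ?_)
      exact_mod_cast hk
    have h3 : L (orthoPoly L n * (X * orthoPoly L k))
        = if k + 1 = n then orthoNorm L n else 0 := by
      rw [X_mul_orthoPoly, mul_add, map_add, mul_left_comm, C_mul', map_smul,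
        hL.map_orthoPoly_mul_ite, hL.map_orthoPoly_mul_ite, if_neg (by omega : n ≠ k - 1)]
      simp [eq_comm]
    have e1 : q * orthoPoly L k = (1 - X ^ 2) * derivative (orthoPoly L n * orthoPoly L k)
        - orthoPoly L n * ((1 - X ^ 2) * derivative (orthoPoly L k)
          + (k : ℝ) • (X * orthoPoly L k))
        + ((n : ℝ) + k) • (orthoPoly L n * (X * orthoPoly L k)) := by
      rw [hq, derivative_mul]
      simp only [smul_eq_C_mul, C_add]
      ring
    rw [e1, map_add, map_sub, h1, h2, map_smul, mul_left_comm X, h3]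
    simp only [eval_mul, smul_eq_mul]
    split_ifs with h
    · have : (n : ℝ) = k + 1 := by exact_mod_cast h.symm
      rw [this]; ring
    · ring
  rw [hL.eq_sum_orthoPoly hdq, Finset.sum_range_succ, hn, zero_div, zero_smul, add_zero]
  cases n with
  | zero => simp [recCoeff]
  | succ m =>
    have h5 : ((2 * ((m + 1 : ℕ) : ℝ) + 1 + 2 * α) * recCoeff L (m + 1)) • orthoPoly L (m + 1 - 1)
        = ∑ k ∈ Finset.range (m + 1), (((2 * ((m + 1 : ℕ) : ℝ) + 1 + 2 * α)
            * (if k + 1 = m + 1 then orthoNorm L (m + 1) else 0)) / orthoNorm L k)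
              • orthoPoly L k := by
      rw [Finset.sum_eq_single m]
      · simp [recCoeff, mul_div_assoc]
      · intro k _ hkm
        simp [hkm]
      · simp
    rw [h5, Finset.smul_sum, ← Finset.sum_sub_distrib]
    refine Finset.sum_congr rfl fun k hk' => ?_
    rw [hk k (Finset.mem_range.1 hk'), smul_smul, ← sub_smul]
    congr 1
    ring

theorem IsPearson.ladder_eval {L : ℝ[X] →ₗ[ℝ] ℝ} (hL : IsSymmPos L) {α a κ : ℝ}
    (hP : IsPearson L α a κ) (n : ℕ) (x : ℝ) :
    (1 - x ^ 2) * (derivative (orthoPoly L n)).eval x + n * (x * (orthoPoly L n).eval x)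
      = (2 * n + 1 + 2 * α) * recCoeff L n * (orthoPoly L (n - 1)).eval x
        - κ * ((orthoPoly L n).eval a * orthoKernel L n x a
          - (orthoPoly L n).eval (-a) * orthoKernel L n x (-a)) := by
  have := congrArg (eval x) (hP.ladder hL n)
  simp only [eval_add, eval_sub, eval_mul, eval_smul, eval_pow, eval_X, eval_one, eval_finsetSum,
    smul_eq_mul] at this
  rw [this, orthoKernel, orthoKernel, Finset.mul_sum (a := (orthoPoly L n).eval a),
    Finset.mul_sum (a := (orthoPoly L n).eval (-a)), ← Finset.sum_sub_distrib]
  congr 2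
  refine Finset.sum_congr rfl fun k _ => ?_
  ring

/-- The three term recurrence trades P_(m-1) for P_(m+1). Enlarging both kernels by the term k = m
changes nothing, because P_m(a)² = P_m(-a)². Both ladder relations then involve the same pair of
polynomials and the same kernels. -/
theorem IsPearson.ladder_eval' {L : ℝ[X] →ₗ[ℝ] ℝ} (hL : IsSymmPos L) {α a κ : ℝ}
    (hP : IsPearson L α a κ) (m : ℕ) (x : ℝ) :
    (1 - x ^ 2) * (derivative (orthoPoly L m)).eval x
      = (m + 1 + 2 * α) * (x * (orthoPoly L m).eval x)
        - (2 * m + 1 + 2 * α) * (orthoPoly L (m + 1)).eval x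
        - κ * ((orthoPoly L m).eval a * orthoKernel L (m + 1) x a
          - (orthoPoly L m).eval (-a) * orthoKernel L (m + 1) x (-a)) := by
  have h1 := hP.ladder_eval hL m x
  have h2 := congrArg (eval x) (X_mul_orthoPoly L m)
  simp only [eval_add, eval_mul, eval_X, eval_C] at h2
  have h3 : ((-1 : ℝ) ^ m) * (-1) ^ m = 1 := by
    rw [← mul_pow]; simp
  rw [orthoKernel, orthoKernel, Finset.sum_range_succ, Finset.sum_range_succ, ← orthoKernel,
    ← orthoKernel]
  rw [eval_neg_orthoPoly] at h1 ⊢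
  linear_combination h1 - (2 * m + 1 + 2 * α) * h2 - (κ * (orthoPoly L m).eval a ^ 2
    * (orthoPoly L m).eval x / orthoNorm L m) * h3

/-- The quantities attached to the endpoint of the gap: `2 w P_{m+1}(a) P_m(a) / h_m`. -/
def gapZ (L : ℝ[X] →ₗ[ℝ] ℝ) (a w : ℝ) (m : ℕ) : ℝ :=
  2 * w * (orthoPoly L (m + 1)).eval a * (orthoPoly L m).eval a / orthoNorm L m

/-- `2 w P_{m+1}(a)² / h_m` -/
def gapU (L : ℝ[X] →ₗ[ℝ] ℝ) (a w : ℝ) (m : ℕ) : ℝ :=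
  2 * w * (orthoPoly L (m + 1)).eval a ^ 2 / orthoNorm L m

/-- `2 w P_m(a)² h_{m+1} / h_m²` -/
def gapV (L : ℝ[X] →ₗ[ℝ] ℝ) (a w : ℝ) (m : ℕ) : ℝ :=
  recCoeff L (m + 1) * (2 * w * (orthoPoly L m).eval a ^ 2 / orthoNorm L m)

theorem gapU_mul_gapV (L : ℝ[X] →ₗ[ℝ] ℝ) (a w : ℝ) (m : ℕ) :
    gapU L a w m * gapV L a w m = recCoeff L (m + 1) * gapZ L a w m ^ 2 := by
  rw [gapU, gapV, gapZ]; ring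

/-- At x = 1 the derivative disappears, and the factor 1 - a² of the boundary value cancels the
Christoffel–Darboux denominators 1 - a and 1 + a. -/
theorem IsPearson.eval_one_relations {L : ℝ[X] →ₗ[ℝ] ℝ} (hL : IsSymmPos L) {α a w : ℝ}
    (hP : IsPearson L α a ((1 - a ^ 2) * w)) (m : ℕ) :
    (m + 1 + gapZ L a w m) * (orthoPoly L (m + 1)).eval 1
      = ((2 * m + 3 + 2 * α) * recCoeff L (m + 1) + a * gapU L a w m) * (orthoPoly L m).eval 1 ∧
    (m + 1 + 2 * α + gapZ L a w m) * (orthoPoly L m).eval 1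
      = (2 * m + 1 + 2 * α + a * (2 * w * (orthoPoly L m).eval a ^ 2 / orthoNorm L m))
        * (orthoPoly L (m + 1)).eval 1 := by
  have h1 := hP.ladder_eval hL (m + 1) 1
  have h2 := hP.ladder_eval' hL m 1
  have k1 := hL.sub_mul_orthoKernel m 1 a
  have k2 := hL.sub_mul_orthoKernel m 1 (-a)
  have hs : ((-1 : ℝ) ^ m) * (-1) ^ m = 1 := by
    rw [← mul_pow]; simp
  rw [eval_neg_orthoPoly L (m + 1), pow_succ (-1 : ℝ) m] at h1 k2
  rw [eval_neg_orthoPoly L m] at h2 k2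
  simp only [Nat.add_sub_cancel] at h1
  push_cast at h1
  rw [gapZ, gapU]
  generalize (orthoPoly L (m + 1)).eval 1 = P1 at *
  generalize (orthoPoly L m).eval 1 = Q1 at *
  generalize (orthoPoly L (m + 1)).eval a = p at *
  generalize (orthoPoly L m).eval a = q at *
  generalize (-1 : ℝ) ^ m = s at *
  generalize orthoNorm L m = h at *
  constructor
  · linear_combination h1 - w * (1 + a) * p * k1 - w * (1 - a) * s * p * k2
      - w * (1 - a) * p * (P1 * q + Q1 * p) / h * hs
  · linear_combination -h2 + w * (1 + a) * q * k1 - w * (1 - a) * s * q * k2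
      - w * (1 - a) * q * (P1 * q + Q1 * p) / h * hs

theorem gapZ_sq_eq (L : ℝ[X] →ₗ[ℝ] ℝ) (a w : ℝ) (m : ℕ) :
    gapZ L a w m ^ 2 = gapU L a w m * (2 * w * (orthoPoly L m).eval a ^ 2 / orthoNorm L m) := by
  rw [gapU, gapZ]; ring

theorem IsPearson.eval_one_ne_zero {L : ℝ[X] →ₗ[ℝ] ℝ} (hL : IsSymmPos L) {α a w : ℝ}
    (hα : 0 < α) (hw : 0 ≤ w) (ha : a ∈ Ioo (0 : ℝ) 1)
    (hP : IsPearson L α a ((1 - a ^ 2) * w)) (m : ℕ) : (orthoPoly L m).eval 1 ≠ 0 := by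
  induction m with
  | zero => simp [orthoPoly]
  | succ m ih =>
    intro h0
    have h1 := (hP.eval_one_relations hL m).1
    rw [h0, mul_zero, eq_comm, mul_eq_zero, or_iff_left ih] at h1
    have h2 := hL.recCoeff_pos m
    have h3 : 0 ≤ gapU L a w m := by
      have := (hL.orthoNorm_pos m).le
      rw [gapU]; positivity
    have := ha.1
    have : 0 < (2 * m + 3 + 2 * α) * recCoeff L (m + 1) + a * gapU L a w m := by positivity
    exact this.ne' h1

/-- The two relations at x = 1 form a linear system for P_(m+1)(1) and P_m(1), both nonzero;
multiplying them and cancelling these values leaves the compatibility condition. -/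
theorem IsPearson.gap_constraint {L : ℝ[X] →ₗ[ℝ] ℝ} (hL : IsSymmPos L) {α a w N : ℝ}
    (hα : 0 < α) (hw : 0 ≤ w) (ha : a ∈ Ioo (0 : ℝ) 1)
    (hP : IsPearson L α a ((1 - a ^ 2) * w)) (m : ℕ) (hN : N = m + 1 + α) :
    N ^ 2 - α ^ 2 + 2 * N * gapZ L a w m + (1 - a ^ 2) * gapZ L a w m ^ 2
      = (4 * N ^ 2 - 1) * recCoeff L (m + 1) + a * (2 * N + 1) * gapV L a w m
        + a * (2 * N - 1) * gapU L a w m := by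
  obtain ⟨h1, h2⟩ := hP.eval_one_relations hL m
  have hZ := gapZ_sq_eq L a w m
  have n1 := hP.eval_one_ne_zero hL hα hw ha (m + 1)
  have n2 := hP.eval_one_ne_zero hL hα hw ha m
  rw [gapV]
  refine mul_right_cancel₀ (mul_ne_zero n1 n2) ?_
  rw [hN]
  generalize (orthoPoly L (m + 1)).eval 1 = P1 at *
  generalize (orthoPoly L m).eval 1 = Q1 at *
  generalize (2 * w * (orthoPoly L m).eval a ^ 2 / orthoNorm L m) = Y at *
  generalize gapZ L a w m = Z at *
  generalize gapU L a w m = U at *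
  generalize recCoeff L (m + 1) = b at *
  linear_combination (m + 1 + 2 * α + Z) * Q1 * h1
    + ((2 * m + 3 + 2 * α) * b + a * U) * Q1 * h2 - a ^ 2 * P1 * Q1 * hZ

theorem IsSymmPos.mul_orthoKernel_neg {L : ℝ[X] →ₗ[ℝ] ℝ} (hL : IsSymmPos L) (m : ℕ) (a : ℝ) :
    a * orthoKernel L (m + 1) a (-a)
      = (-1) ^ m * (orthoPoly L (m + 1)).eval a * (orthoPoly L m).eval a / orthoNorm L m := by
  have k2 := hL.sub_mul_orthoKernel m a (-a)
  rw [eval_neg_orthoPoly L (m + 1), eval_neg_orthoPoly L m, pow_succ] at k2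
  linear_combination k2 / 2

/-- In the confluent Christoffel–Darboux formula at x = a, the derivatives are replaced by means of
the two ladder relations, and the constraint removes U and V. -/
theorem IsPearson.orthoKernel_eq {L : ℝ[X] →ₗ[ℝ] ℝ} (hL : IsSymmPos L) {α a w N : ℝ}
    (hα : 0 < α) (hw : 0 ≤ w) (ha : a ∈ Ioo (0 : ℝ) 1)
    (hP : IsPearson L α a ((1 - a ^ 2) * w)) (m : ℕ) (hN : N = m + 1 + α) :
    2 * a * (1 - a ^ 2) * w * orthoKernel L (m + 1) a a
      = N ^ 2 - α ^ 2 + 2 * N * (1 - a ^ 2) * gapZ L a w m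
        - (4 * N ^ 2 - 1) * recCoeff L (m + 1) := by
  have hc := hP.gap_constraint hL hα hw ha m hN
  have h1 := hP.ladder_eval hL (m + 1) a
  have h2 := hP.ladder_eval' hL m a
  have k1 := hL.orthoKernel_self m a
  have k2 := hL.mul_orthoKernel_neg m a
  have hs : ((-1 : ℝ) ^ m) * (-1) ^ m = 1 := by
    rw [← mul_pow]; simp
  rw [eval_neg_orthoPoly L (m + 1), pow_succ (-1 : ℝ) m] at h1
  rw [eval_neg_orthoPoly L m] at h2
  simp only [Nat.add_sub_cancel] at h1
  push_cast at h1
  rw [gapZ, gapU, gapV] at hc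
  rw [gapZ]
  subst hN
  generalize (derivative (orthoPoly L (m + 1))).eval a = p' at *
  generalize (derivative (orthoPoly L m)).eval a = q' at *
  generalize (orthoPoly L (m + 1)).eval a = p at *
  generalize (orthoPoly L m).eval a = q at *
  generalize (-1 : ℝ) ^ m = s at *
  generalize orthoNorm L m = h at *
  generalize orthoKernel L (m + 1) a a = K at *
  generalize orthoKernel L (m + 1) a (-a) = K2 at *
  linear_combination 2 * a * (1 - a ^ 2) * w * k1 + 2 * a * w / h * (q * h1 - p * h2) - hc
    - 4 * (1 - a ^ 2) * w ^ 2 * s * p * q / h * k2 - 4 * (1 - a ^ 2) * w ^ 2 * p ^ 2 * q ^ 2 / h ^ 2 * hs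

end Ladder

/-! ### The cut Jacobi functional and its dependence on the endpoint -/

noncomputable section GapFunctional

open Polynomial MeasureTheory intervalIntegral

theorem continuous_eval_mul_jacobi {α : ℝ} (hα : 0 < α) (p : ℝ[X]) :
    Continuous fun x : ℝ => p.eval x * (1 - x ^ 2) ^ α :=
  p.continuous.mul ((continuous_const.sub (continuous_id.pow 2)).rpow_const
    fun _ => Or.inr hα.le)

/-- Integration of polynomials against `(1 - x ^ 2) ^ α` over `[-1, 1]` without `(-a, a)`. -/
def gapFunctional {α : ℝ} (hα : 0 < α) (a : ℝ) : ℝ[X] →ₗ[ℝ] ℝ where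
  toFun p := (∫ x in (-1 : ℝ)..1, p.eval x * (1 - x ^ 2) ^ α)
    - ∫ x in (-a)..a, p.eval x * (1 - x ^ 2) ^ α
  map_add' p q := by
    simp only [eval_add, add_mul]
    rw [intervalIntegral.integral_add, intervalIntegral.integral_add]
    · ring
    all_goals exact (continuous_eval_mul_jacobi hα _).intervalIntegrable _ _
  map_smul' c p := by
    simp only [eval_smul, smul_eq_mul, mul_assoc, intervalIntegral.integral_const_mul, RingHom.id_apply]
    ring

theorem gapFunctional_apply {α : ℝ} (hα : 0 < α) (a : ℝ) (p : ℝ[X]) :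
    gapFunctional hα a p = (∫ x in (-1 : ℝ)..1, p.eval x * (1 - x ^ 2) ^ α)
      - ∫ x in (-a)..a, p.eval x * (1 - x ^ 2) ^ α := rfl

theorem gapFunctional_apply' {α : ℝ} (hα : 0 < α) (a : ℝ) (p : ℝ[X]) :
    gapFunctional hα a p = (∫ x in (-1 : ℝ)..(-a), p.eval x * (1 - x ^ 2) ^ α)
      + ∫ x in a..1, p.eval x * (1 - x ^ 2) ^ α := by
  have hi := fun u v => (continuous_eval_mul_jacobi hα p).intervalIntegrable (μ := volume) u v
  rw [gapFunctional_apply, ← integral_add_adjacent_intervals (hi (-1) (-a)) (hi (-a) 1),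
    ← integral_add_adjacent_intervals (hi (-a) a) (hi a 1)]
  ring

theorem integral_pow_mul_jacobiGapWeight {α : ℝ} (hα : 0 < α) {a : ℝ} (ha : a ∈ Ico (0 : ℝ) 1)
    (k : ℕ) : ∫ x in (-1 : ℝ)..1, x ^ k * jacobiGapWeight α a x = gapFunctional hα a (X ^ k) := by
  have hc := continuous_eval_mul_jacobi hα (X ^ k)
  have e : ∀ x : ℝ, x ^ k * jacobiGapWeight α a x = (X ^ k : ℝ[X]).eval x * (1 - x ^ 2) ^ α
      - (Ioo (-a) a).indicator (fun x => (X ^ k : ℝ[X]).eval x * (1 - x ^ 2) ^ α) x := by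
    intro x
    rw [jacobiGapWeight]
    by_cases hx : x ∈ Ioo (-a) a <;> simp [hx]
  have hint : IntegrableOn (fun x : ℝ => (X ^ k : ℝ[X]).eval x * (1 - x ^ 2) ^ α)
      (Ioc (-1) 1) volume :=
    (hc.integrableOn_Icc (a := -1) (b := 1)).mono_set Ioc_subset_Icc_self
  simp only [e]
  rw [integral_sub (hc.intervalIntegrable _ _), gapFunctional_apply]
  · congr 1
    rw [integral_of_le (by norm_num), integral_of_le (by linarith [ha.1]),
      setIntegral_indicator measurableSet_Ioo, integral_Ioc_eq_integral_Ioo (x := -a)]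
    congr 2
    refine inter_eq_right.2 fun x hx => ⟨by linarith [hx.1, ha.2], by linarith [hx.2, ha.2]⟩
  · rw [intervalIntegrable_iff_integrableOn_Ioc_of_le (by norm_num)]
    exact hint.indicator measurableSet_Ioo

theorem gapFunctional_isSymmPos {α : ℝ} (hα : 0 < α) {a : ℝ} (ha : a ∈ Ico (0 : ℝ) 1) :
    IsSymmPos (gapFunctional hα a) where
  symm p := by
    rw [gapFunctional_apply, gapFunctional_apply]
    have : ∀ u : ℝ, ∫ x in (-u)..u, (p.comp (-X)).eval x * (1 - x ^ 2) ^ α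
        = ∫ x in (-u)..u, p.eval x * (1 - x ^ 2) ^ α := by
      intro u
      have := integral_comp_neg (a := -u) (b := u) (fun x : ℝ => p.eval x * (1 - x ^ 2) ^ α)
      rw [neg_neg] at this
      rw [← this]
      simp [eval_comp]
    rw [this, this]
  pos p hp := by
    have hnn : ∀ x ∈ Icc (-1 : ℝ) 1, 0 ≤ (p ^ 2).eval x * (1 - x ^ 2) ^ α := fun x hx => by
      rw [eval_pow]
      exact mul_nonneg (sq_nonneg _) (Real.rpow_nonneg (by nlinarith [hx.1, hx.2]) _)
    rw [gapFunctional_apply']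
    refine add_pos_of_nonneg_of_pos ?_ ?_
    · exact integral_nonneg (by linarith [ha.2]) fun x hx =>
        hnn x ⟨hx.1, by linarith [hx.2, ha.1]⟩
    · refine integral_pos ha.2 (continuous_eval_mul_jacobi hα _).continuousOn
        (fun x hx => hnn x ⟨by linarith [hx.1, ha.1], hx.2⟩) ?_
      obtain ⟨c, hc, hroot⟩ : ∃ c ∈ Ioo a 1, ¬ p.IsRoot c := by
        by_contra! h
        exact (Ioo_infinite ha.2) ((finite_setOfPred_isRoot hp).subset fun c hc => h c hc)
      refine ⟨c, Ioo_subset_Icc_self hc, ?_⟩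
      rw [eval_pow]
      exact mul_pos (by have : p.eval c ≠ 0 := hroot
                        positivity)
        (Real.rpow_pos_of_pos (by nlinarith [hc.1, hc.2, ha.1]) _)

/-- Integrate the derivative of p(x)(1-x²)^(α+1): it vanishes at ±1, so only the ends of the gap
contribute. -/
theorem gapFunctional_isPearson {α : ℝ} (hα : 0 < α) {a : ℝ} (ha : a ∈ Ico (0 : ℝ) 1) :
    IsPearson (gapFunctional hα a) α a ((1 - a ^ 2) * (1 - a ^ 2) ^ α) := by
  intro p
  have hsplit : ∀ x : ℝ, x ∈ Icc (-1 : ℝ) 1 →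
      (1 - x ^ 2) ^ (α + 1) = (1 - x ^ 2) * (1 - x ^ 2) ^ α := fun x hx => by
    rw [Real.rpow_add' (by nlinarith [hx.1, hx.2]) (by positivity), Real.rpow_one, mul_comm]
  have hd : ∀ x ∈ Icc (-1 : ℝ) 1, HasDerivAt (fun x : ℝ => p.eval x * (1 - x ^ 2) ^ (α + 1))
      (((1 - X ^ 2) * derivative p - (2 + 2 * α) • (X * p)).eval x * (1 - x ^ 2) ^ α) x := by
    intro x hx
    have h1 : HasDerivAt (fun x : ℝ => 1 - x ^ 2) (-(2 * x)) x := by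
      simpa using ((hasDerivAt_pow 2 x).const_sub 1)
    have h2 := (p.hasDerivAt x).mul (h1.rpow_const (p := α + 1) (Or.inr (by linarith)))
    refine h2.congr_deriv ?_
    rw [hsplit x hx]
    simp
    ring
  have hF : ∀ u v : ℝ, u ∈ Icc (-1 : ℝ) 1 → v ∈ Icc (-1 : ℝ) 1 →
      ∫ x in u..v, ((1 - X ^ 2) * derivative p - (2 + 2 * α) • (X * p)).eval x * (1 - x ^ 2) ^ α
        = p.eval v * (1 - v ^ 2) ^ (α + 1) - p.eval u * (1 - u ^ 2) ^ (α + 1) := by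
    intro u v hu hv
    refine integral_eq_sub_of_hasDerivAt (fun x hx => hd x ?_)
      ((continuous_eval_mul_jacobi hα _).intervalIntegrable _ _)
    exact uIcc_subset_Icc hu hv hx
  have hin : a ∈ Icc (-1 : ℝ) 1 := ⟨by linarith [ha.1], ha.2.le⟩
  have hin' : -a ∈ Icc (-1 : ℝ) 1 := ⟨by linarith [ha.2], by linarith [ha.1]⟩
  have hz : (0 : ℝ) ^ (α + 1) = 0 := Real.zero_rpow (by linarith)
  have key : gapFunctional hα a ((1 - X ^ 2) * derivative p - (2 + 2 * α) • (X * p))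
      = -((1 - a ^ 2) * (1 - a ^ 2) ^ α) * (p.eval a - p.eval (-a)) := by
    rw [gapFunctional_apply, hF _ _ (by norm_num) (by norm_num), hF _ _ hin' hin, neg_sq a,
      hsplit a hin]
    norm_num [hz]
    ring
  rw [map_sub, map_smul, smul_eq_mul] at key
  linear_combination key

theorem hasDerivAt_gapFunctional_X_pow {α : ℝ} (hα : 0 < α) (a : ℝ) (k : ℕ) :
    HasDerivAt (fun b => gapFunctional hα b (X ^ k))
      (-((1 - a ^ 2) ^ α * (a ^ k + (-a) ^ k))) a := by
  have hc := continuous_eval_mul_jacobi hα (X ^ k)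
  have h1 : ∀ u, HasDerivAt (fun b : ℝ => ∫ x in (0 : ℝ)..b, (X ^ k : ℝ[X]).eval x * (1 - x ^ 2) ^ α)
      ((X ^ k : ℝ[X]).eval u * (1 - u ^ 2) ^ α) u := fun u =>
    integral_hasDerivAt_right (hc.intervalIntegrable _ _)
      (hc.stronglyMeasurableAtFilter _ _) hc.continuousAt
  have h2 := (h1 a).sub ((h1 (-a)).comp a (hasDerivAt_neg a))
  have h3 := h2.const_sub (∫ x in (-1 : ℝ)..1, (X ^ k : ℝ[X]).eval x * (1 - x ^ 2) ^ α)
  refine (h3.congr_deriv ?_).congr_of_eventuallyEq (Eventually.of_forall fun b => ?_)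
  · simp
    ring
  · simp only [gapFunctional_apply, Pi.sub_apply, Function.comp]
    rw [integral_interval_sub_left (hc.intervalIntegrable _ _) (hc.intervalIntegrable _ _)]

/-- Coefficientwise differentiability of a family of polynomials of bounded degree. -/
def HasCoeffDeriv (p : ℝ → ℝ[X]) (p' : ℝ[X]) (a : ℝ) : Prop :=
  (∃ N, ∀ b, (p b).natDegree < N) ∧
    ∀ k, HasDerivAt (fun b => (p b).coeff k) (p'.coeff k) a

namespace HasCoeffDeriv

variable {p q : ℝ → ℝ[X]} {p' q' : ℝ[X]} {a : ℝ}

theorem coeff_eq_zero (h : HasCoeffDeriv p p' a) {k : ℕ} {c : ℝ}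
    (hk : ∀ b, (p b).coeff k = c) : p'.coeff k = 0 := by
  have h1 := h.2 k
  simp only [hk] at h1
  exact h1.unique (hasDerivAt_const a c)

theorem const (r : ℝ[X]) (a : ℝ) : HasCoeffDeriv (fun _ => r) 0 a :=
  ⟨⟨_, fun _ => Nat.lt_succ_self _⟩, fun k => by simpa using hasDerivAt_const a _⟩

theorem mul (hp : HasCoeffDeriv p p' a) (hq : HasCoeffDeriv q q' a) :
    HasCoeffDeriv (fun b => p b * q b) (p' * q a + p a * q') a := by
  obtain ⟨⟨N, hN⟩, hp⟩ := hp
  obtain ⟨⟨M, hM⟩, hq⟩ := hq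
  refine ⟨⟨N + M, fun b => natDegree_mul_le.trans_lt (add_lt_add (hN b) (hM b))⟩, fun k => ?_⟩
  simp only [coeff_mul, coeff_add]
  rw [← Finset.sum_add_distrib]
  exact HasDerivAt.fun_sum fun i _ => (hp i.1).mul (hq i.2)

theorem sub (hp : HasCoeffDeriv p p' a) (hq : HasCoeffDeriv q q' a) :
    HasCoeffDeriv (fun b => p b - q b) (p' - q') a := by
  obtain ⟨⟨N, hN⟩, hp⟩ := hp
  obtain ⟨⟨M, hM⟩, hq⟩ := hq
  refine ⟨⟨max N M, fun b => (natDegree_sub_le _ _).trans_lt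
    (max_lt_max (hN b) (hM b))⟩, fun k => ?_⟩
  simp only [coeff_sub]
  exact (hp k).sub (hq k)

theorem ofC {f : ℝ → ℝ} {f' : ℝ} (hf : HasDerivAt f f' a) :
    HasCoeffDeriv (fun b => C (f b)) (C f') a := by
  refine ⟨⟨1, fun b => by simp⟩, fun k => ?_⟩
  cases k with
  | zero => simpa using hf
  | succ k => simpa [coeff_C] using hasDerivAt_const a (0 : ℝ)

/-- Differentiation of a moving functional at a moving polynomial. -/
theorem hasDerivAt_map (hp : HasCoeffDeriv p p' a) {ℓ : ℝ → ℝ[X] →ₗ[ℝ] ℝ} {D : ℝ[X] →ₗ[ℝ] ℝ}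
    (hℓ : ∀ k, HasDerivAt (fun b => ℓ b (X ^ k)) (D (X ^ k)) a) :
    HasDerivAt (fun b => ℓ b (p b)) (ℓ a p' + D (p a)) a := by
  obtain ⟨N, hN⟩ := hp.1
  have hexp : ∀ (r : ℝ[X]) (φ : ℝ[X] →ₗ[ℝ] ℝ), (∀ k, N ≤ k → r.coeff k = 0) →
      φ r = ∑ k ∈ Finset.range N, r.coeff k * φ (X ^ k) := by
    intro r φ hr
    have h1 : r.natDegree < N ∨ r = 0 := by
      by_contra! h
      exact (leadingCoeff_ne_zero.2 h.2) (hr _ h.1)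
    rcases h1 with h1 | rfl
    · conv_lhs => rw [as_sum_range' r N h1]
      simp [← smul_X_eq_monomial]
    · simp
  have h0 : ∀ b k, N ≤ k → (p b).coeff k = 0 := fun b k hk =>
    coeff_eq_zero_of_natDegree_lt ((hN b).trans_le hk)
  have e1 : (fun b => ℓ b (p b)) = fun b => ∑ k ∈ Finset.range N, (p b).coeff k * ℓ b (X ^ k) :=
    funext fun b => hexp _ _ (h0 b)
  rw [e1, hexp (p a) D (h0 a), hexp p' (ℓ a) fun k hk => hp.coeff_eq_zero fun b => h0 b k hk,
    ← Finset.sum_add_distrib]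
  exact HasDerivAt.fun_sum fun k _ => (hp.2 k).mul (hℓ k)

/-- Evaluation at b is itself a moving functional, with derivative p ↦ p'(a). -/
theorem eval_self (hp : HasCoeffDeriv p p' a) :
    HasDerivAt (fun b => (p b).eval b) (p'.eval a + (derivative (p a)).eval a) a :=
  hp.hasDerivAt_map (ℓ := fun b => leval b) (D := (leval a).comp derivative) fun k => by
    simpa [derivative_X_pow] using hasDerivAt_pow k a

end HasCoeffDeriv

variable {α : ℝ} (hα : 0 < α)

theorem HasCoeffDeriv.hasDerivAt_gapFunctional {p : ℝ → ℝ[X]} {p' : ℝ[X]} {a : ℝ}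
    (hp : HasCoeffDeriv p p' a) :
    HasDerivAt (fun b => gapFunctional hα b (p b))
      (gapFunctional hα a p' - (1 - a ^ 2) ^ α * ((p a).eval a + (p a).eval (-a))) a := by
  have := hp.hasDerivAt_map (ℓ := fun b => gapFunctional hα b)
    (D := -(1 - a ^ 2) ^ α • (leval a + leval (-a))) fun k => by
      refine (hasDerivAt_gapFunctional_X_pow hα a k).congr_deriv ?_
      simp
      ring
  refine this.congr_deriv ?_
  simp
  ring

/-- Differentiability propagates through the three term recurrence, whose coefficient is a quotient
of differentiable norms. The derivative loses a degree because the leading coefficient is constantly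
1. -/
theorem exists_hasCoeffDeriv_orthoPoly {a : ℝ} (ha : a ∈ Ioo (0 : ℝ) 1) (n : ℕ) :
    ∃ p' : ℝ[X], HasCoeffDeriv (fun b => orthoPoly (gapFunctional hα b) n) p' a ∧
      p'.degree < n := by
  have hL := gapFunctional_isSymmPos hα (Ioo_subset_Ico_self ha)
  suffices h : ∃ p' : ℝ[X], HasCoeffDeriv (fun b => orthoPoly (gapFunctional hα b) n) p' a by
    obtain ⟨p', hp'⟩ := h
    refine ⟨p', hp', (degree_lt_iff_coeff_zero _ _).2 fun m hm => ?_⟩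
    rcases hm.eq_or_lt with rfl | hm
    · refine hp'.coeff_eq_zero (c := 1) fun b => ?_
      have := orthoPoly_monic (gapFunctional hα b) n
      rwa [Monic, leadingCoeff, natDegree_orthoPoly] at this
    · exact hp'.coeff_eq_zero (c := 0) fun b =>
        coeff_eq_zero_of_natDegree_lt (by rwa [natDegree_orthoPoly])
  induction n using Nat.strong_induction_on with
  | _ n ih =>
    match n with
    | 0 => exact ⟨0, HasCoeffDeriv.const _ _⟩
    | 1 => exact ⟨0, HasCoeffDeriv.const _ _⟩
    | n + 2 =>
      obtain ⟨p', hp⟩ := ih (n + 1) (by omega)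
      obtain ⟨q', hq⟩ := ih n (by omega)
      have h1 := (hp.mul hp).hasDerivAt_gapFunctional hα
      have h2 := (hq.mul hq).hasDerivAt_gapFunctional hα
      have h3 : gapFunctional hα a (orthoPoly (gapFunctional hα a) n
          * orthoPoly (gapFunctional hα a) n) ≠ 0 := by
        rw [← sq]; exact (hL.orthoNorm_pos n).ne'
      have h4 := HasCoeffDeriv.ofC (h1.div h2 h3)
      have h5 := ((HasCoeffDeriv.const X a).mul hp).sub (h4.mul hq)
      simp only [orthoPoly, sq]
      exact ⟨_, h5⟩

/-- The Hadamard variation of the orthogonal polynomials with respect to the endpoint. -/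
theorem exists_hasCoeffDeriv_orthoPoly_eq {a : ℝ} (ha : a ∈ Ioo (0 : ℝ) 1) (n : ℕ) :
    ∃ p' : ℝ[X], HasCoeffDeriv (fun b => orthoPoly (gapFunctional hα b) n) p' a ∧
      p'.degree < n ∧ ∀ x, p'.eval x = (1 - a ^ 2) ^ α *
        ((orthoPoly (gapFunctional hα a) n).eval a * orthoKernel (gapFunctional hα a) n x a
        + (orthoPoly (gapFunctional hα a) n).eval (-a)
          * orthoKernel (gapFunctional hα a) n x (-a)) := by
  have hL := gapFunctional_isSymmPos hα (Ioo_subset_Ico_self ha)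
  obtain ⟨p', hp, hdeg⟩ := exists_hasCoeffDeriv_orthoPoly hα ha n
  refine ⟨p', hp, hdeg, fun x => ?_⟩
  set L := gapFunctional hα a with hLdef
  have hk : ∀ k < n, L (p' * orthoPoly L k) = (1 - a ^ 2) ^ α *
      ((orthoPoly L n).eval a * (orthoPoly L k).eval a
        + (orthoPoly L n).eval (-a) * (orthoPoly L k).eval (-a)) := by
    intro k hk
    obtain ⟨q', hq, hdq⟩ := exists_hasCoeffDeriv_orthoPoly hα ha k
    -- Differentiating the relation L_b(P_n P_k) = 0 determines the expansion of p': the term with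
    -- the derivative of P_k vanishes by degree, and the moving endpoint supplies the rest.
    have h1 := (hp.mul hq).hasDerivAt_gapFunctional hα
    have h2 : ∀ᶠ b in 𝓝 a, gapFunctional hα b (orthoPoly (gapFunctional hα b) n
        * orthoPoly (gapFunctional hα b) k) = 0 := by
      filter_upwards [Ioo_mem_nhds ha.1 ha.2] with b hb
      exact (gapFunctional_isSymmPos hα (Ioo_subset_Ico_self hb)).map_orthoPoly_mul_orthoPoly
        n k hk
    have h3 := h1.unique ((hasDerivAt_const a (0 : ℝ)).congr_of_eventuallyEq h2)
    rw [map_add, ← hLdef, hL.map_orthoPoly_mul (hdq.trans (by exact_mod_cast hk))] at h3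
    simp only [eval_mul] at h3
    linear_combination h3
  have h4 := congrArg (eval x) (hL.eq_sum_orthoPoly hdeg)
  rw [h4, eval_finsetSum, orthoKernel, orthoKernel, Finset.mul_sum, Finset.mul_sum,
    ← Finset.sum_add_distrib, Finset.mul_sum]
  refine Finset.sum_congr rfl fun k hk' => ?_
  rw [hk k (Finset.mem_range.1 hk'), eval_smul, smul_eq_mul]
  ring

/-- The variation of P_n has lower degree, hence is orthogonal to P_n; only the two equal boundary
terms at ±a remain. -/
theorem hasDerivAt_orthoNorm {a : ℝ} (ha : a ∈ Ioo (0 : ℝ) 1) (n : ℕ) :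
    HasDerivAt (fun b => orthoNorm (gapFunctional hα b) n)
      (-(2 * (1 - a ^ 2) ^ α * (orthoPoly (gapFunctional hα a) n).eval a ^ 2)) a := by
  have hL := gapFunctional_isSymmPos hα (Ioo_subset_Ico_self ha)
  obtain ⟨p', hp, hdeg⟩ := exists_hasCoeffDeriv_orthoPoly hα ha n
  have h1 := (hp.mul hp).hasDerivAt_gapFunctional hα
  simp only [← sq] at h1
  refine h1.congr_deriv ?_
  have hs : ((-1 : ℝ) ^ n) * (-1) ^ n = 1 := by
    rw [← mul_pow]; simp
  rw [mul_comm p', map_add, hL.map_orthoPoly_mul hdeg]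
  simp only [eval_pow, eval_neg_orthoPoly]
  linear_combination -(1 - a ^ 2) ^ α * (orthoPoly (gapFunctional hα a) n).eval a ^ 2 * hs

end GapFunctional

/-! ### Hankel determinants as products of norms; derivatives of the endpoint quantities -/

noncomputable section GapProbability

open Polynomial

/-- The Hankel matrix of the moments of `L`. -/
def momentMatrix (L : ℝ[X] →ₗ[ℝ] ℝ) (n : ℕ) : Matrix (Fin n) (Fin n) ℝ :=
  Matrix.of fun i j => L (X ^ ((i : ℕ) + j))

/-- The matrix of the coefficients of the orthogonal polynomials. -/
def orthoCoeffMatrix (L : ℝ[X] →ₗ[ℝ] ℝ) (n : ℕ) : Matrix (Fin n) (Fin n) ℝ :=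
  Matrix.of fun i j => (orthoPoly L i).coeff j

theorem det_orthoCoeffMatrix (L : ℝ[X] →ₗ[ℝ] ℝ) (n : ℕ) : (orthoCoeffMatrix L n).det = 1 := by
  rw [Matrix.det_of_isLowerTriangular]
  · refine Finset.prod_eq_one fun i _ => ?_
    have := orthoPoly_monic L i
    rwa [Monic, leadingCoeff, natDegree_orthoPoly] at this
  · intro i j hij
    have hij : i < j := by simpa using hij
    exact coeff_eq_zero_of_natDegree_lt (by rw [natDegree_orthoPoly]; exact hij)

/-- Orthogonality read as a diagonalization of the Hankel form by a unitriangular matrix. -/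
theorem IsSymmPos.orthoCoeffMatrix_mul {L : ℝ[X] →ₗ[ℝ] ℝ} (hL : IsSymmPos L) (n : ℕ) :
    orthoCoeffMatrix L n * momentMatrix L n * (orthoCoeffMatrix L n).transpose
      = Matrix.diagonal fun i : Fin n => orthoNorm L i := by
  have hexp : ∀ i : Fin n, orthoPoly L i
      = ∑ k : Fin n, (orthoPoly L i).coeff k • (X ^ (k : ℕ) : ℝ[X]) := by
    intro i
    conv_lhs => rw [as_sum_range' (orthoPoly L i) n (by rw [natDegree_orthoPoly]; exact i.2)]
    rw [Finset.sum_range]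
    simp [smul_X_eq_monomial]
  ext i j
  have h1 : L (orthoPoly L i * orthoPoly L j)
      = ∑ l : Fin n, (∑ k : Fin n, (orthoPoly L i).coeff k * L (X ^ ((k : ℕ) + l)))
        * (orthoPoly L j).coeff l := by
    conv_lhs => rw [hexp i, hexp j]
    simp only [Finset.sum_mul, Finset.mul_sum, map_sum, smul_mul_smul_comm, map_smul, smul_eq_mul,
      ← pow_add]
    refine Finset.sum_congr rfl fun l _ => Finset.sum_congr rfl fun k _ => ?_
    ring
  rw [Matrix.mul_apply, Matrix.diagonal_apply]
  simp only [Matrix.mul_apply, orthoCoeffMatrix, momentMatrix, Matrix.transpose_apply,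
    Matrix.of_apply]
  rw [← h1, hL.map_orthoPoly_mul_ite]
  simp [Fin.ext_iff]

theorem IsSymmPos.det_momentMatrix {L : ℝ[X] →ₗ[ℝ] ℝ} (hL : IsSymmPos L) (n : ℕ) :
    (momentMatrix L n).det = ∏ k ∈ Finset.range n, orthoNorm L k := by
  have := congrArg Matrix.det (hL.orthoCoeffMatrix_mul n)
  rw [Matrix.det_mul, Matrix.det_mul, Matrix.det_transpose, det_orthoCoeffMatrix, one_mul, mul_one,
    Matrix.det_diagonal] at this
  rw [this, Finset.prod_range]

variable {α : ℝ} (hα : 0 < α)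

theorem hankelDet_eq_det_momentMatrix {a : ℝ} (ha : a ∈ Ico (0 : ℝ) 1) (n : ℕ) :
    hankelDet α n a = (momentMatrix (gapFunctional hα a) n).det := by
  rw [hankelDet, momentMatrix]
  congr 1
  ext i j
  simp only [Matrix.of_apply]
  rw [integral_pow_mul_jacobiGapWeight hα ha]

theorem hankelDet_eq_prod {a : ℝ} (ha : a ∈ Ico (0 : ℝ) 1) (n : ℕ) :
    hankelDet α n a = ∏ k ∈ Finset.range n, orthoNorm (gapFunctional hα a) k := by
  rw [hankelDet_eq_det_momentMatrix hα ha, (gapFunctional_isSymmPos hα ha).det_momentMatrix]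

include hα in
theorem hankelDet_pos {a : ℝ} (ha : a ∈ Ico (0 : ℝ) 1) (n : ℕ) : 0 < hankelDet α n a := by
  rw [hankelDet_eq_prod hα ha]
  exact Finset.prod_pos fun k _ => (gapFunctional_isSymmPos hα ha).orthoNorm_pos k

include hα in
theorem gapProb_pos {a : ℝ} (ha : a ∈ Ico (0 : ℝ) 1) (n : ℕ) : 0 < gapProb α n a :=
  div_pos (hankelDet_pos hα ha n) (hankelDet_pos hα (by norm_num) n)

theorem hasDerivAt_log_gapProb {a : ℝ} (ha : a ∈ Ioo (0 : ℝ) 1) (n : ℕ) :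
    HasDerivAt (fun b => Real.log (gapProb α n b))
      (-(2 * (1 - a ^ 2) ^ α * orthoKernel (gapFunctional hα a) n a a)) a := by
  have hL := gapFunctional_isSymmPos hα (Ioo_subset_Ico_self ha)
  have h1 : HasDerivAt (fun b => ∑ k ∈ Finset.range n,
      Real.log (orthoNorm (gapFunctional hα b) k) - Real.log (hankelDet α n 0))
      (∑ k ∈ Finset.range n, -(2 * (1 - a ^ 2) ^ α
        * (orthoPoly (gapFunctional hα a) k).eval a ^ 2) / orthoNorm (gapFunctional hα a) k) a :=
    (HasDerivAt.fun_sum fun k _ =>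
      (hasDerivAt_orthoNorm hα ha k).log (hL.orthoNorm_pos k).ne').sub_const _
  refine (h1.congr_deriv ?_).congr_of_eventuallyEq ?_
  · rw [orthoKernel, Finset.mul_sum, ← Finset.sum_neg_distrib]
    exact Finset.sum_congr rfl fun k _ => by ring
  · filter_upwards [Ioo_mem_nhds ha.1 ha.2] with b hb
    have hb' := Ioo_subset_Ico_self hb
    rw [gapProb, Real.log_div (hankelDet_pos hα hb' n).ne' (hankelDet_pos hα (by norm_num) n).ne',
      hankelDet_eq_prod hα hb', Real.log_prod]
    exact fun k _ => ((gapFunctional_isSymmPos hα hb').orthoNorm_pos k).ne'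

theorem gapH_eq {a : ℝ} (ha : a ∈ Ioo (0 : ℝ) 1) (n : ℕ) :
    gapH α n a = 2 * a * (1 - a ^ 2) * (1 - a ^ 2) ^ α
      * orthoKernel (gapFunctional hα a) n a a := by
  rw [gapH, (hasDerivAt_log_gapProb hα ha n).deriv]
  ring

theorem hasDerivAt_recCoeff {a : ℝ} (ha : a ∈ Ioo (0 : ℝ) 1) (m : ℕ) :
    HasDerivAt (fun b => recCoeff (gapFunctional hα b) (m + 1))
      (gapV (gapFunctional hα a) a ((1 - a ^ 2) ^ α) m
        - gapU (gapFunctional hα a) a ((1 - a ^ 2) ^ α) m) a := by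
  have hL := gapFunctional_isSymmPos hα (Ioo_subset_Ico_self ha)
  have h0 := (hL.orthoNorm_pos m).ne'
  refine ((hasDerivAt_orthoNorm hα ha (m + 1)).div (hasDerivAt_orthoNorm hα ha m)
    h0).congr_deriv ?_
  rw [gapV, gapU, recCoeff]
  field_simp
  ring

theorem orthoKernel_succ (L : ℝ[X] →ₗ[ℝ] ℝ) (n : ℕ) (x y : ℝ) :
    orthoKernel L (n + 1) x y = orthoKernel L n x y
      + (orthoPoly L n).eval x * (orthoPoly L n).eval y / orthoNorm L n := by
  rw [orthoKernel, Finset.sum_range_succ, ← orthoKernel]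

/-- The total derivative combines the ladder relation with the Hadamard variation. Their K(a,a)
terms cancel; the K(a,-a) terms add up to the one with Z. -/
theorem hasDerivAt_eval_orthoPoly_succ {a : ℝ} (ha : a ∈ Ioo (0 : ℝ) 1) (m : ℕ) :
    HasDerivAt (fun b => (orthoPoly (gapFunctional hα b) (m + 1)).eval b)
      (((2 * m + 3 + 2 * α) * recCoeff (gapFunctional hα a) (m + 1)
          * (orthoPoly (gapFunctional hα a) m).eval a
        - (m + 1) * a * (orthoPoly (gapFunctional hα a) (m + 1)).eval a) / (1 - a ^ 2)
        - gapZ (gapFunctional hα a) a ((1 - a ^ 2) ^ α) m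
          * (orthoPoly (gapFunctional hα a) (m + 1)).eval a / a) a := by
  have hL := gapFunctional_isSymmPos hα (Ioo_subset_Ico_self ha)
  have hP := gapFunctional_isPearson hα (Ioo_subset_Ico_self ha)
  have ha2 : (1 - a ^ 2) ≠ 0 := by nlinarith [ha.1, ha.2]
  obtain ⟨p', hp, -, hpe⟩ := exists_hasCoeffDeriv_orthoPoly_eq hα ha (m + 1)
  refine hp.eval_self.congr_deriv ?_
  rw [hpe, gapZ]
  have e1 := hP.ladder_eval hL (m + 1) a
  have k2 := hL.mul_orthoKernel_neg m a
  have hs : ((-1 : ℝ) ^ m) * (-1) ^ m = 1 := by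
    rw [← mul_pow]; simp
  rw [eval_neg_orthoPoly _ (m + 1), pow_succ (-1 : ℝ) m] at e1 ⊢
  simp only [Nat.add_sub_cancel] at e1
  push_cast at e1
  have ha1 := ha.1.ne'
  replace k2 := (eq_div_iff ha1).2 ((mul_comm _ _).trans k2)
  rw [← eq_sub_iff_add_eq] at e1
  replace e1 := (eq_div_iff ha2).2 ((mul_comm _ _).trans e1)
  rw [e1, k2, eq_sub_iff_add_eq]
  generalize (orthoPoly (gapFunctional hα a) (m + 1)).eval a = p at *
  generalize (orthoPoly (gapFunctional hα a) m).eval a = q at *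
  generalize (-1 : ℝ) ^ m = s at *
  generalize orthoKernel (gapFunctional hα a) (m + 1) a a = K at *
  have hg := mul_inv_cancel₀ ha2
  generalize (1 - a ^ 2) ^ α = w at *
  simp only [div_eq_mul_inv]
  generalize (orthoNorm (gapFunctional hα a) m)⁻¹ = hi at *
  linear_combination (-w * (p * K + s * p * (s * p * q * hi * a⁻¹))) * hg
    - 2 * w * p ^ 2 * q * hi * a⁻¹ * hs

theorem hasDerivAt_eval_orthoPoly {a : ℝ} (ha : a ∈ Ioo (0 : ℝ) 1) (m : ℕ) :
    HasDerivAt (fun b => (orthoPoly (gapFunctional hα b) m).eval b)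
      (((m + 1 + 2 * α) * a * (orthoPoly (gapFunctional hα a) m).eval a
        - (2 * m + 1 + 2 * α) * (orthoPoly (gapFunctional hα a) (m + 1)).eval a) / (1 - a ^ 2)
        + gapZ (gapFunctional hα a) a ((1 - a ^ 2) ^ α) m
          * (orthoPoly (gapFunctional hα a) m).eval a / a
        - 2 * (1 - a ^ 2) ^ α * (orthoPoly (gapFunctional hα a) m).eval a ^ 3
          / orthoNorm (gapFunctional hα a) m) a := by
  have hL := gapFunctional_isSymmPos hα (Ioo_subset_Ico_self ha)
  have hP := gapFunctional_isPearson hα (Ioo_subset_Ico_self ha)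
  have ha2 : (1 - a ^ 2) ≠ 0 := by nlinarith [ha.1, ha.2]
  obtain ⟨p', hp, -, hpe⟩ := exists_hasCoeffDeriv_orthoPoly_eq hα ha m
  refine hp.eval_self.congr_deriv ?_
  rw [hpe, gapZ, ← sub_eq_iff_eq_add.2 (orthoKernel_succ (gapFunctional hα a) m a a),
    ← sub_eq_iff_eq_add.2 (orthoKernel_succ (gapFunctional hα a) m a (-a))]
  have e1 := hP.ladder_eval' hL m a
  have k2 := hL.mul_orthoKernel_neg m a
  have hs : ((-1 : ℝ) ^ m) * (-1) ^ m = 1 := by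
    rw [← mul_pow]; simp
  rw [eval_neg_orthoPoly _ m] at e1 ⊢
  have ha1 := ha.1.ne'
  replace k2 := (eq_div_iff ha1).2 ((mul_comm _ _).trans k2)
  replace e1 := (eq_div_iff ha2).2 ((mul_comm _ _).trans e1)
  rw [e1, k2]
  generalize (orthoPoly (gapFunctional hα a) (m + 1)).eval a = p at *
  generalize (orthoPoly (gapFunctional hα a) m).eval a = q at *
  generalize (-1 : ℝ) ^ m = s at *
  generalize orthoKernel (gapFunctional hα a) (m + 1) a a = K at *
  have hg := mul_inv_cancel₀ ha2
  generalize (1 - a ^ 2) ^ α = w at *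
  simp only [div_eq_mul_inv]
  generalize (orthoNorm (gapFunctional hα a) m)⁻¹ = hi at *
  linear_combination (-w * (q * K - s * q * (s * p * q * hi * a⁻¹))) * hg
    + (2 * w * p * q ^ 2 * hi * a⁻¹ - w * q ^ 3 * hi) * hs

/-- In the logarithmic derivative of w P_(m+1)(a) P_m(a) / h_m, the term from the weight, the two
terms Z/a and the derivative of the norm all cancel, leaving a combination of U and V alone. -/
theorem hasDerivAt_gapZ {a N : ℝ} (ha : a ∈ Ioo (0 : ℝ) 1) (m : ℕ) (hN : N = m + 1 + α) :
    HasDerivAt (fun b => gapZ (gapFunctional hα b) b ((1 - b ^ 2) ^ α) m)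
      (((2 * N + 1) * gapV (gapFunctional hα a) a ((1 - a ^ 2) ^ α) m
        - (2 * N - 1) * gapU (gapFunctional hα a) a ((1 - a ^ 2) ^ α) m) / (1 - a ^ 2)) a := by
  have hL := gapFunctional_isSymmPos hα (Ioo_subset_Ico_self ha)
  have ha2 : 0 < 1 - a ^ 2 := by nlinarith [ha.1, ha.2]
  have h0 := (hL.orthoNorm_pos m).ne'
  have hw : HasDerivAt (fun b : ℝ => (1 - b ^ 2) ^ α)
      (-(2 * α * a) * (1 - a ^ 2) ^ α / (1 - a ^ 2)) a := by
    have h1 : HasDerivAt (fun x : ℝ => 1 - x ^ 2) (-(2 * a)) a := by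
      simpa using ((hasDerivAt_pow 2 a).const_sub 1)
    refine (h1.rpow_const (Or.inl ha2.ne')).congr_deriv ?_
    rw [Real.rpow_sub ha2, Real.rpow_one]
    ring
  have h1 := (((hw.const_mul 2).mul (hasDerivAt_eval_orthoPoly_succ hα ha m)).mul
    (hasDerivAt_eval_orthoPoly hα ha m)).div (hasDerivAt_orthoNorm hα ha m) h0
  refine h1.congr_deriv ?_
  simp only [Pi.mul_apply]
  rw [gapU, gapV, gapZ]
  subst hN
  have ha1 := ha.1.ne'
  generalize (orthoPoly (gapFunctional hα a) (m + 1)).eval a = p at *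
  generalize (orthoPoly (gapFunctional hα a) m).eval a = q at *
  generalize orthoNorm (gapFunctional hα a) m = h at *
  generalize recCoeff (gapFunctional hα a) (m + 1) = b at *
  generalize (1 - a ^ 2) ^ α = w at *
  have hg : (1 - a ^ 2) ≠ 0 := ha2.ne'
  generalize (1 - a ^ 2) = g at *
  field_simp
  ring

end GapProbability

/-! ### Elimination, the second order equation and its formal scaling limit -/

noncomputable section SecondOrderEquation

section Algebra

variable {K : Type*} [Field K]

/-- The expression whose square is the first summand of `hnaDefect`. -/
def hnaSqTerm (α n a H H₁ H₂ : K) : K :=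
  a ^ 2 * (a ^ 2 - 1) ^ 4 * H₂ ^ 2
    - 4 * a ^ 2 * (a ^ 2 - 1) ^ 2
        * ((a ^ 3 - a) * H₁ - (a ^ 2 - 1) * H - 2 * a ^ 2 * (α + n) ^ 2) * H₂
    + 4 * a * (a ^ 2 - 1) ^ 3 * H₁ ^ 3
    - 4 * (a ^ 2 - 1) ^ 2
        * (a ^ 4 * (α + n - 1) * (α + n + 1) - 4 * a ^ 2 * n * (2 * α + n)
            + (5 * a ^ 2 - 1) * H) * H₁ ^ 2
    + 8 * a * (a ^ 2 - 1)
        * (4 * (a ^ 2 - 1) * H ^ 2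
            + (a ^ 4 * (2 * α ^ 2 + 2 * n ^ 2 + 4 * α * n - 1) + a ^ 2 * (4 * α ^ 2 + 1)
                + 4 * n * (2 * α + n)) * H
            - 2 * a ^ 2 * (α + n) ^ 2
                * (3 * a ^ 2 * n ^ 2 + 6 * α * a ^ 2 * n + a ^ 2 + 1)) * H₁
    - 16 * (a ^ 2 - 1) ^ 2 * H ^ 3
    - 4 * (a ^ 2 - 1)
        * (a ^ 4 * (4 * α ^ 2 + 4 * n ^ 2 + 8 * α * n - 1)
            + a ^ 2 * (8 * α ^ 2 + 4 * n ^ 2 + 8 * α * n + 1) + 4 * n * (2 * α + n)) * H ^ 2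
    - 16 * a ^ 2 * (α + n) ^ 2
        * (a ^ 4 * (2 * α ^ 2 - n ^ 2 - 2 * α * n - 1) + 3 * a ^ 2 * n * (2 * α + n) + 1) * H
    + 32 * a ^ 6 * (α + n) ^ 4 * (a ^ 2 * n ^ 2 + 2 * α * a ^ 2 * n + 1)

/-- The expression whose square enters the second summand of `hnaDefect`. -/
def hnaSqFactor (α n a H H₁ H₂ : K) : K :=
  a ^ 2 * (a ^ 2 - 1) ^ 2 * H₂
    - 2 * a * (a ^ 2 - 1) * (a ^ 2 * (2 * n ^ 2 + 4 * α * n + 1) - 2 * H) * H₁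
    - 4 * (a ^ 2 - 1) * H ^ 2
    - 2 * a ^ 2 * ((2 * α ^ 2 - 1) * a ^ 2 + 2 * n * (2 * α + n) + 1) * H
    + 4 * a ^ 4 * (α + n) ^ 2 * (a ^ 2 * n ^ 2 + 2 * α * a ^ 2 * n + 1)

theorem hnaDefect_eq (α n a H H₁ H₂ : K) :
    hnaDefect α n a H H₁ H₂ = hnaSqTerm α n a H H₁ H₂ ^ 2
      - 64 * (α + n) ^ 2 * (a ^ 4 * (α + n) ^ 2 + (a ^ 2 - 1) * (H - a * H₁))
        * hnaSqFactor α n a H H₁ H₂ ^ 2 := rfl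

/-- Elimination of the auxiliary variable `Z` from a first integral and a second order relation. -/
theorem hnaDefect_eq_zero {α n a H H₁ H₂ Z : K}
    (hH : a * H₁ - H = (1 - a ^ 2) * Z ^ 2 - 2 * (α + n) * a ^ 2 * Z)
    (hZ : ((a * H₂ + 2 * a * Z ^ 2 + 4 * (α + n) * a * Z) * (1 - a ^ 2)) ^ 2
      = 4 * ((1 - a ^ 2) * Z - (α + n) * a ^ 2) ^ 2 * ((H₁ + 4 * (α + n) * a * Z) ^ 2
        - 4 * Z ^ 2 * ((α + n) ^ 2 - α ^ 2 + 2 * (α + n) * (1 - a ^ 2) * Z - H))) :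
    hnaDefect α n a H H₁ H₂ = 0 := by
  -- The first integral is linear in H, so H rather than Z is substituted away.
  obtain rfl : H = a * H₁ - ((1 - a ^ 2) * Z ^ 2 - 2 * (α + n) * a ^ 2 * Z) := by
    linear_combination -hH
  -- The second order relation is linear in the shift (1-a²)Z - (α+n)a², modulo the first integral.
  -- That shift is a square root of a⁴(α+n)² + (a²-1)(H - aH₁), so squaring `key` removes Z.
  have key : hnaSqTerm α n a (a * H₁ - ((1 - a ^ 2) * Z ^ 2 - 2 * (α + n) * a ^ 2 * Z)) H₁ H₂
      = -(8 * (α + n) * ((1 - a ^ 2) * Z - (α + n) * a ^ 2)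
        * hnaSqFactor α n a (a * H₁ - ((1 - a ^ 2) * Z ^ 2 - 2 * (α + n) * a ^ 2 * Z)) H₁ H₂) := by
    rw [hnaSqTerm, hnaSqFactor]
    linear_combination (1 - a ^ 2) ^ 2 * hZ
  rw [hnaDefect_eq, key]
  ring

/-- `hnaDefect` in the variables of the bulk scaling, with `ε = 1 / n`. -/
def scaledDefect (α c ε b y₀ y₁ y₂ : K) : K :=
  (b ^ 2 * c ^ 4 * (b ^ 2 * ε ^ 2 - 1) ^ 4 * y₂ ^ 2
    + 4 * b ^ 2 * c ^ 2 * ε ^ 2 * (b ^ 2 * ε ^ 2 - 1) ^ 2 * y₂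
        * ((b ^ 2 * ε ^ 2 - 1) * (y₀ - b * c * y₁) - 2 * b ^ 2 * (1 + α * ε) ^ 2)
    - 4 * (b ^ 2 * ε ^ 2 - 1) ^ 3 * b * c ^ 3 * y₁ ^ 3
    - 4 * (b ^ 2 * ε ^ 2 - 1) ^ 2 * c ^ 2 * y₁ ^ 2
        * (b ^ 4 * ε ^ 2 * ((1 + α * ε) ^ 2 - ε ^ 2) - 4 * b ^ 2 * (1 + 2 * α * ε)
            - (5 * b ^ 2 * ε ^ 2 - 1) * y₀)
    - 8 * b * c * y₁ * (b ^ 2 * ε ^ 2 - 1)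
        * (4 * (b ^ 2 * ε ^ 2 - 1) * y₀ ^ 2 * ε ^ 2
            - (b ^ 4 * ε ^ 4 * ((2 * α ^ 2 - 1) * ε ^ 2 + 2 + 4 * α * ε)
                + b ^ 2 * ε ^ 4 * (4 * α ^ 2 + 1) + 4 * (1 + 2 * α * ε)) * y₀
            - 2 * b ^ 2 * (1 + α * ε) ^ 2 * ε ^ 2
                * (3 * b ^ 2 + 6 * α * b ^ 2 * ε + b ^ 2 * ε ^ 2 + 1))
    + 16 * (b ^ 2 * ε ^ 2 - 1) ^ 2 * y₀ ^ 3 * ε ^ 2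
    - 4 * (b ^ 2 * ε ^ 2 - 1)
        * (b ^ 4 * ε ^ 4 * ((4 * α ^ 2 - 1) * ε ^ 2 + 4 + 8 * α * ε)
            + b ^ 2 * ε ^ 2 * ((8 * α ^ 2 + 1) * ε ^ 2 + 4 + 8 * α * ε)
            + 4 * (1 + 2 * α * ε)) * y₀ ^ 2
    + 16 * b ^ 2 * (1 + α * ε) ^ 2
        * (b ^ 4 * ε ^ 4 * ((2 * α ^ 2 - 1) * ε ^ 2 - 1 - 2 * α * ε)
            + 3 * b ^ 2 * ε ^ 2 * (1 + 2 * α * ε) + ε ^ 2) * y₀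
    + 32 * b ^ 6 * ε ^ 4 * (1 + α * ε) ^ 4 * (b ^ 2 + 2 * α * b ^ 2 * ε + 1)) ^ 2
  - 64 * (1 + α * ε) ^ 2 * ε ^ 2
      * (b ^ 4 * ε ^ 2 * (1 + α * ε) ^ 2 + (b ^ 2 * ε ^ 2 - 1) * (b * c * y₁ - y₀))
      * (-(b ^ 2 * c ^ 2 * (b ^ 2 * ε ^ 2 - 1) ^ 2 * y₂)
          + 2 * b * c * (b ^ 2 * ε ^ 2 - 1) * (b ^ 2 * (2 + 4 * α * ε + ε ^ 2) + 2 * y₀) * y₁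
          - 4 * (b ^ 2 * ε ^ 2 - 1) * y₀ ^ 2
          + 2 * (b ^ 4 * ε ^ 4 * (2 * α ^ 2 - 1) + b ^ 2 * (2 + 4 * α * ε) + b ^ 2 * ε ^ 2) * y₀
          + 4 * b ^ 4 * ε ^ 2 * (1 + α * ε) ^ 2 * (b ^ 2 + 2 * α * b ^ 2 * ε + 1)) ^ 2

theorem hnaDefect_scaled (α c ε b y₀ y₁ y₂ : K) (hε : ε ≠ 0) :
    hnaDefect α ε⁻¹ (b * ε) (-y₀) (-(c * ε⁻¹) * y₁) (-(c * ε⁻¹) ^ 2 * y₂) / ε⁻¹ ^ 4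
      = scaledDefect α c ε b y₀ y₁ y₂ := by
  -- The two summands of the defect are rescaled separately, and in the first one only the base of
  -- the square is compared.
  have h1 : ∀ x y u v w : K, x = u * w → y = v * w → x - y = (u - v) * w := by
    rintro x y u v w rfl rfl; ring
  have h2 : ∀ x u v : K, x = u * v ^ 2 → x ^ 2 = u ^ 2 * v ^ 4 := by
    rintro x u v rfl; ring
  rw [div_eq_iff (by simpa using hε), hnaDefect_eq, scaledDefect]
  refine h1 _ _ _ _ _ (h2 _ _ _ ?_) ?_
  · rw [hnaSqTerm]
    field_simp
    ring
  · rw [hnaSqFactor]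
    field_simp
    ring

end Algebra

theorem scaledDefect_zero (α t y₀ y₁ y₂ : ℂ) :
    scaledDefect α (4 * Complex.I) 0 (t / (4 * Complex.I)) y₀ y₁ y₂
      = (16 * jmmsDefect t y₀ y₁ y₂) ^ 2 := by
  have hI := Complex.I_sq
  -- Writing t = 4ib clears the division, and then powers of I suffice.
  obtain ⟨b, rfl⟩ : ∃ b, t = 4 * Complex.I * b := ⟨t / (4 * Complex.I), by field_simp⟩
  rw [mul_div_cancel_left₀ _ (by simp), scaledDefect, jmmsDefect]
  have h4 : Complex.I ^ 4 = 1 := Complex.I_pow_four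
  have h3 : Complex.I ^ 3 = -Complex.I := Complex.I_pow_three
  simp only [mul_pow, hI, h4, h3]
  ring

theorem hnaDefect_scaled_nat (α t y₀ y₁ y₂ : ℂ) {n : ℕ} (hn : n ≠ 0) :
    hnaDefect α (n : ℂ) (t / (4 * Complex.I * n)) (-y₀)
        (-(4 * Complex.I * n) * y₁) (-(4 * Complex.I * n) ^ 2 * y₂) / (n : ℂ) ^ 4
      = scaledDefect α (4 * Complex.I) (n : ℂ)⁻¹ (t / (4 * Complex.I)) y₀ y₁ y₂ := by
  rw [← hnaDefect_scaled _ _ _ _ _ _ _ (by simpa using hn), inv_inv, div_mul_eq_div_div,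
    div_eq_mul_inv (t / (4 * Complex.I))]

/-- After rescaling, the expression is a polynomial in ε = 1/n; differentiability at ε = 0 gives the
linear error. -/
theorem hnaDefect_isBigO (α t y₀ y₁ y₂ : ℂ) :
    (fun n : ℕ =>
        hnaDefect α (n : ℂ) (t / (4 * Complex.I * n)) (-y₀)
            (-(4 * Complex.I * n) * y₁) (-(4 * Complex.I * n) ^ 2 * y₂) / (n : ℂ) ^ 4
          - (16 * jmmsDefect t y₀ y₁ y₂) ^ 2)
      =O[atTop] fun n : ℕ => 1 / (n : ℝ) := by
  have hd : DifferentiableAt ℂ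
      (fun ε => scaledDefect α (4 * Complex.I) ε (t / (4 * Complex.I)) y₀ y₁ y₂) 0 := by
    unfold scaledDefect
    fun_prop
  have h1 := hd.isBigO_sub.comp_tendsto
    (tendsto_inv_atTop_nhds_zero_nat (𝕜 := ℂ))
  rw [scaledDefect_zero] at h1
  refine (h1.congr' ?_ EventuallyEq.rfl).trans ?_
  · filter_upwards [eventually_ne_atTop 0] with n hn
    rw [hnaDefect_scaled_nat _ _ _ _ _ hn]
    rfl
  · refine IsBigO.of_bound 1 (Eventually.of_forall fun n => ?_)
    simp

section GapProbability

variable {α : ℝ} (hα : 0 < α)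

theorem hasDerivAt_gapH {a N : ℝ} (ha : a ∈ Ioo (0 : ℝ) 1) (m : ℕ) (hN : N = m + 1 + α) :
    HasDerivAt (gapH α (m + 1))
      (-4 * N * a * gapZ (gapFunctional hα a) a ((1 - a ^ 2) ^ α) m
        + (2 * N + 1) * gapV (gapFunctional hα a) a ((1 - a ^ 2) ^ α) m
        + (2 * N - 1) * gapU (gapFunctional hα a) a ((1 - a ^ 2) ^ α) m) a := by
  have ha2 : (1 - a ^ 2) ≠ 0 := by nlinarith [ha.1, ha.2]
  have h0 : HasDerivAt (fun x : ℝ => 1 - x ^ 2) (-(2 * a)) a := by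
    simpa using ((hasDerivAt_pow 2 a).const_sub 1)
  have h1 := (((h0.const_mul (2 * N)).mul (hasDerivAt_gapZ hα ha m hN)).const_add
    (N ^ 2 - α ^ 2)).sub ((hasDerivAt_recCoeff hα ha m).const_mul (4 * N ^ 2 - 1))
  refine (h1.congr_deriv ?_).congr_of_eventuallyEq ?_
  · field_simp
    ring
  · filter_upwards [Ioo_mem_nhds ha.1 ha.2] with b hb
    have hb' := Ioo_subset_Ico_self hb
    have hb2 : 0 < 1 - b ^ 2 := by nlinarith [hb.1, hb.2]
    rw [gapH_eq hα hb, (gapFunctional_isPearson hα hb').orthoKernel_eq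
      (gapFunctional_isSymmPos hα hb') hα (Real.rpow_nonneg hb2.le _) hb m hN]
    simp

/-- In aH' - H the variables U, V, β occur exactly in the combination that the constraint expresses
through Z. -/
theorem gapH_first_integral {a N : ℝ} (ha : a ∈ Ioo (0 : ℝ) 1) (m : ℕ) (hN : N = m + 1 + α) :
    a * deriv (gapH α (m + 1)) a - gapH α (m + 1) a
      = (1 - a ^ 2) * gapZ (gapFunctional hα a) a ((1 - a ^ 2) ^ α) m ^ 2
        - 2 * N * a ^ 2 * gapZ (gapFunctional hα a) a ((1 - a ^ 2) ^ α) m := by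
  have ha' := Ioo_subset_Ico_self ha
  have ha2 : 0 < 1 - a ^ 2 := by nlinarith [ha.1, ha.2]
  have hP := gapFunctional_isPearson hα ha'
  have hL := gapFunctional_isSymmPos hα ha'
  have hw := Real.rpow_nonneg ha2.le α
  rw [(hasDerivAt_gapH hα ha m hN).deriv, gapH_eq hα ha, hP.orthoKernel_eq hL hα hw ha m hN]
  linear_combination -hP.gap_constraint hL hα hw ha m hN

/-- The first integral is solved for H' near a and differentiated; U and V enter only through Z'. -/
theorem hasDerivAt_deriv_gapH {a N : ℝ} (ha : a ∈ Ioo (0 : ℝ) 1) (m : ℕ) (hN : N = m + 1 + α) :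
    HasDerivAt (deriv (gapH α (m + 1)))
      ((2 * ((1 - a ^ 2) * gapZ (gapFunctional hα a) a ((1 - a ^ 2) ^ α) m - N * a ^ 2)
          * (((2 * N + 1) * gapV (gapFunctional hα a) a ((1 - a ^ 2) ^ α) m
            - (2 * N - 1) * gapU (gapFunctional hα a) a ((1 - a ^ 2) ^ α) m) / (1 - a ^ 2))
        - 2 * a * gapZ (gapFunctional hα a) a ((1 - a ^ 2) ^ α) m ^ 2
        - 4 * N * a * gapZ (gapFunctional hα a) a ((1 - a ^ 2) ^ α) m) / a) a := by
  have hZ := hasDerivAt_gapZ hα ha m hN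
  have hH1 := (hasDerivAt_gapH hα ha m hN).differentiableAt.hasDerivAt
  have h0 : HasDerivAt (fun x : ℝ => 1 - x ^ 2) (-(2 * a)) a := by
    simpa using ((hasDerivAt_pow 2 a).const_sub 1)
  have h2 := ((hH1.add ((h0.mul (hZ.pow 2)).sub
    (((hasDerivAt_pow 2 a).const_mul (2 * N)).mul hZ))).div (hasDerivAt_id a) ha.1.ne')
  have hI := gapH_first_integral hα ha m hN
  have ha0 := ha.1.ne'
  refine (h2.congr_deriv ?_).congr_of_eventuallyEq ?_
  · simp only [Pi.add_apply, Pi.sub_apply, Pi.mul_apply, Pi.pow_apply, id]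
    generalize ((2 * N + 1) * gapV (gapFunctional hα a) a ((1 - a ^ 2) ^ α) m
      - (2 * N - 1) * gapU (gapFunctional hα a) a ((1 - a ^ 2) ^ α) m) / (1 - a ^ 2) = Z1 at *
    field_simp
    push_cast
    linear_combination hI
  · filter_upwards [Ioo_mem_nhds ha.1 ha.2] with b hb
    have := gapH_first_integral hα hb m hN
    simp only [Pi.div_apply, Pi.add_apply, Pi.sub_apply, Pi.mul_apply, Pi.pow_apply, id]
    rw [eq_div_iff hb.1.ne']
    linear_combination this

include hα in
theorem hnaDefect_gapH {a : ℝ} (ha : a ∈ Ioo (0 : ℝ) 1) {n : ℕ} (hn : 1 ≤ n) :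
    hnaDefect α n a (gapH α n a) (deriv (gapH α n) a) (deriv (deriv (gapH α n)) a) = 0 := by
  obtain ⟨m, rfl⟩ : ∃ m, n = m + 1 := ⟨n - 1, by omega⟩
  obtain ⟨N, hN⟩ : ∃ N : ℝ, N = m + 1 + α := ⟨_, rfl⟩
  have hN' : α + (m + 1 : ℕ) = N := by push_cast; linarith
  have ha' := Ioo_subset_Ico_self ha
  have ha2 : 0 < 1 - a ^ 2 := by nlinarith [ha.1, ha.2]
  have hH : gapH α (m + 1) a = _ := (gapH_eq hα ha (m + 1)).trans
    ((gapFunctional_isPearson hα ha').orthoKernel_eq (gapFunctional_isSymmPos hα ha') hα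
      (Real.rpow_nonneg ha2.le α) ha m hN)
  have hI := gapH_first_integral hα ha m hN
  have hUV := gapU_mul_gapV (gapFunctional hα a) a ((1 - a ^ 2) ^ α) m
  have ha0 := ha.1.ne'
  refine hnaDefect_eq_zero (Z := gapZ (gapFunctional hα a) a ((1 - a ^ 2) ^ α) m) ?_ ?_
  · rw [hN', hI]
  · rw [hN', (hasDerivAt_deriv_gapH hα ha m hN).deriv, (hasDerivAt_gapH hα ha m hN).deriv, hH]
    generalize gapZ (gapFunctional hα a) a ((1 - a ^ 2) ^ α) m = Z at *
    generalize gapU (gapFunctional hα a) a ((1 - a ^ 2) ^ α) m = U at *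
    generalize gapV (gapFunctional hα a) a ((1 - a ^ 2) ^ α) m = V at *
    generalize recCoeff (gapFunctional hα a) (m + 1) = b at *
    have hg := ha2.ne'
    rw [mul_div_cancel₀ _ ha0]
    have e : (2 * ((1 - a ^ 2) * Z - N * a ^ 2) * (((2 * N + 1) * V - (2 * N - 1) * U)
        / (1 - a ^ 2)) - 2 * a * Z ^ 2 - 4 * N * a * Z + 2 * a * Z ^ 2 + 4 * N * a * Z)
          * (1 - a ^ 2)
        = 2 * ((1 - a ^ 2) * Z - N * a ^ 2) * ((2 * N + 1) * V - (2 * N - 1) * U) := by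
      field_simp
      ring
    rw [e]
    -- The squares of (2N+1)V ± (2N-1)U differ by 4(4N²-1)UV, and UV = βZ².
    linear_combination (-16 * ((1 - a ^ 2) * Z - N * a ^ 2) ^ 2 * (4 * N ^ 2 - 1)) * hUV

end GapProbability

end SecondOrderEquation

/-! ### Convergence of determinants of growing size -/

noncomputable section TruncatedDeterminants

/-- The determinant of the upper left corner of `1 - B`. -/
def cornerDet (B : ℕ → ℕ → ℂ) (n : ℕ) : ℂ :=
  (Matrix.of fun i j : Fin n => (if i = j then 1 else 0) - B i j).det

/-- Expanding the product of row sums gives a sum over all self-maps of the index set; the Leibniz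
formula uses only the permutations among them. -/
theorem norm_det_le_prod_sum {n : Type*} [Fintype n] [DecidableEq n] (A : Matrix n n ℂ) :
    ‖A.det‖ ≤ ∏ i, ∑ j, ‖A i j‖ := by
  classical
  rw [← Matrix.det_transpose, Matrix.det_apply]
  refine (norm_sum_le _ _).trans ?_
  have h1 : ∀ σ : Equiv.Perm n, ‖Equiv.Perm.sign σ • ∏ i, A.transpose (σ i) i‖
      = ∏ i, ‖A i (σ i)‖ := by
    intro σ
    rcases Int.units_eq_one_or (Equiv.Perm.sign σ) with h | h <;> simp [h]
  simp only [h1]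
  rw [Finset.prod_univ_sum, Fintype.piFinset_univ]
  refine (Finset.sum_image (s := Finset.univ) (g := fun σ : Equiv.Perm n => (σ : n → n))
    (f := fun p => ∏ i, ‖A i (p i)‖) (DFunLike.coe_injective.injOn)).symm.le.trans ?_
  exact Finset.sum_le_sum_of_subset_of_nonneg (Finset.subset_univ _)
    fun _ _ _ => Finset.prod_nonneg fun _ _ => norm_nonneg _

/-- Expand along the last row: its diagonal 1 reproduces the smaller corner, and each entry of B
meets a minor whose row sums are at most 1 + b i. -/
theorem norm_cornerDet_succ_sub_le {B : ℕ → ℕ → ℂ} {b : ℕ → ℝ} {n : ℕ}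
    (hB : ∀ i, ∑ k ∈ Finset.range (n + 1), ‖B i k‖ ≤ b i) :
    ‖cornerDet B (n + 1) - cornerDet B n‖ ≤ b n * ∏ i ∈ Finset.range n, (1 + b i) := by
  set A : Matrix (Fin (n + 1)) (Fin (n + 1)) ℂ :=
    Matrix.of fun i j => (if i = j then 1 else 0) - B i j with hA
  have hminor : ∀ j : Fin (n + 1),
      ‖(A.submatrix (Fin.last n).succAbove j.succAbove).det‖ ≤ ∏ i ∈ Finset.range n, (1 + b i) := by
    intro j
    refine (norm_det_le_prod_sum _).trans ?_
    rw [Finset.prod_range]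
    refine Finset.prod_le_prod (fun _ _ => Finset.sum_nonneg fun _ _ => norm_nonneg _)
      fun i _ => ?_
    set r := (Fin.last n).succAbove i with hr
    have hri : (r : ℕ) = i := by simp [hr]
    have h1 : ∑ k : Fin n, ‖A r (j.succAbove k)‖ ≤ ∑ k, ‖A r k‖ := by
      rw [Fin.sum_univ_succAbove (fun k => ‖A r k‖) j]
      exact le_add_of_nonneg_left (norm_nonneg _)
    refine h1.trans ?_
    have h2 : ∀ k, ‖A r k‖ ≤ (if r = k then 1 else 0) + ‖B i k‖ := by
      intro k
      rw [hA, Matrix.of_apply, hri]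
      refine (norm_sub_le _ _).trans (add_le_add_left ?_ _)
      split_ifs <;> simp
    refine (Finset.sum_le_sum fun k _ => h2 k).trans ?_
    rw [Finset.sum_add_distrib, Finset.sum_ite_eq, if_pos (Finset.mem_univ _)]
    have := hB i
    rw [Finset.sum_range] at this
    linarith
  have h0 : cornerDet B (n + 1) - cornerDet B n
      = -∑ j : Fin (n + 1), (-1) ^ (n + (j : ℕ)) * B n j
        * (A.submatrix (Fin.last n).succAbove j.succAbove).det := by
    rw [cornerDet, ← hA, Matrix.det_succ_row A (Fin.last n)]
    have e : ∀ j : Fin (n + 1), (-1 : ℂ) ^ (((Fin.last n : Fin (n + 1)) : ℕ) + (j : ℕ))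
        * A (Fin.last n) j * (A.submatrix (Fin.last n).succAbove j.succAbove).det
        = (if Fin.last n = j then (-1 : ℂ) ^ (n + (j : ℕ))
          * (A.submatrix (Fin.last n).succAbove j.succAbove).det else 0)
          - (-1) ^ (n + (j : ℕ)) * B n j
            * (A.submatrix (Fin.last n).succAbove j.succAbove).det := by
      intro j
      rw [hA, Matrix.of_apply, Fin.val_last]
      split_ifs <;> ring
    simp only [e]
    rw [Finset.sum_sub_distrib, Finset.sum_ite_eq, if_pos (Finset.mem_univ _), Fin.val_last,
      ← two_mul, pow_mul]
    have e2 : (A.submatrix (Fin.last n).succAbove (Fin.last n).succAbove).det = cornerDet B n := by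
      rw [cornerDet]
      congr 1
      ext i j
      simp [hA]
    rw [e2]
    simp
  rw [h0, norm_neg]
  refine (norm_sum_le _ _).trans ?_
  have hnn : 0 ≤ ∏ i ∈ Finset.range n, (1 + b i) :=
    (norm_nonneg _).trans (hminor 0)
  calc ∑ j : Fin (n + 1), ‖(-1) ^ (n + (j : ℕ)) * B n j
        * (A.submatrix (Fin.last n).succAbove j.succAbove).det‖
      ≤ ∑ j : Fin (n + 1), ‖B n j‖ * ∏ i ∈ Finset.range n, (1 + b i) := by
        refine Finset.sum_le_sum fun j _ => ?_
        rw [norm_mul, norm_mul, norm_pow, norm_neg, norm_one, one_pow, one_mul]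
        exact mul_le_mul_of_nonneg_left (hminor j) (norm_nonneg _)
    _ ≤ b n * ∏ i ∈ Finset.range n, (1 + b i) := by
        rw [← Finset.sum_mul]
        refine mul_le_mul_of_nonneg_right ?_ hnn
        have := hB n
        rwa [Finset.sum_range] at this

theorem norm_cornerDet_sub_le {B : ℕ → ℕ → ℂ} {b : ℕ → ℝ} (hb : Summable b) {n N : ℕ}
    (hNn : N ≤ n) (hB : ∀ i, ∑ k ∈ Finset.range n, ‖B i k‖ ≤ b i) :
    ‖cornerDet B n - cornerDet B N‖
      ≤ Real.exp (∑' i, b i) * (∑' i, b i - ∑ i ∈ Finset.range N, b i) := by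
  have hb0 : ∀ i, 0 ≤ b i := fun i => (Finset.sum_nonneg fun _ _ => norm_nonneg _).trans (hB i)
  have hstep : ∀ m, N ≤ m → m ≤ n → ‖cornerDet B m - cornerDet B N‖
      ≤ Real.exp (∑' i, b i) * (∑ i ∈ Finset.range m, b i - ∑ i ∈ Finset.range N, b i) := by
    intro m hm
    induction m, hm using Nat.le_induction with
    | base => simp
    | succ m hm ih =>
      intro hmn
      have h1 := ih (by omega)
      have h2 := norm_cornerDet_succ_sub_le (B := B) (b := b) (n := m) fun i =>
        (Finset.sum_le_sum_of_subset_of_nonneg (Finset.range_mono hmn)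
          fun _ _ _ => norm_nonneg _).trans (hB i)
      have h3 : ∏ i ∈ Finset.range m, (1 + b i) ≤ Real.exp (∑' i, b i) := by
        refine (Finset.prod_le_prod (fun i _ => by linarith [hb0 i])
          fun i _ => (add_comm 1 (b i)).le.trans (Real.add_one_le_exp (b i))).trans ?_
        rw [← Real.exp_sum]
        exact Real.exp_le_exp.2 (hb.sum_le_tsum _ fun i _ => hb0 i)
      have h4 := mul_le_mul_of_nonneg_left h3 (hb0 m)
      have h5 : cornerDet B (m + 1) - cornerDet B N = (cornerDet B (m + 1) - cornerDet B m)
        + (cornerDet B m - cornerDet B N) := by ring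
      rw [h5, Finset.sum_range_succ]
      refine (norm_add_le _ _).trans ?_
      linarith
  refine (hstep n hNn le_rfl).trans (mul_le_mul_of_nonneg_left ?_ (Real.exp_pos _).le)
  have := hb.sum_le_tsum (Finset.range n) fun i _ => hb0 i
  linarith

/-- Convergence of determinants of growing size, under a summable bound of the row sums. -/
theorem exists_tendsto_cornerDet {ι : Type*} {l : Filter ι} [l.NeBot] {m : ι → ℕ}
    (hm : Tendsto m l atTop) {B : ι → ℕ → ℕ → ℂ} {b : ℕ → ℝ} (hb : Summable b)
    (hB : ∀ᶠ i in l, ∀ j, ∑ k ∈ Finset.range (m i), ‖B i j k‖ ≤ b j)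
    (hlim : ∀ j k, ∃ y, Tendsto (fun i => B i j k) l (𝓝 y)) :
    ∃ y, Tendsto (fun i => cornerDet (B i) (m i)) l (𝓝 y) := by
  choose y hy using hlim
  have hcorner : ∀ N, Tendsto (fun i => cornerDet (B i) N) l (𝓝 (cornerDet y N)) := by
    intro N
    have h1 : Continuous fun A : Matrix (Fin N) (Fin N) ℂ => A.det := continuous_id.matrix_det
    refine (h1.tendsto _).comp ?_
    refine tendsto_pi_nhds.2 fun i => tendsto_pi_nhds.2 fun j => ?_
    exact tendsto_const_nhds.sub (hy i j)
  -- The limit is not exhibited. All late determinants lie near one fixed corner of the limit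
  -- matrix, which gives a Cauchy filter.
  rw [← cauchy_map_iff_exists_tendsto, Metric.cauchy_iff]
  refine ⟨inferInstance, fun ε hε => ?_⟩
  have htail : Tendsto (fun N => Real.exp (∑' i, b i) * (∑' i, b i - ∑ i ∈ Finset.range N, b i))
      atTop (𝓝 0) := by
    have := (tendsto_const_nhds (x := ∑' i, b i)).sub hb.hasSum.tendsto_sum_nat
    simpa using this.const_mul (Real.exp (∑' i, b i))
  obtain ⟨N, hN⟩ := (htail.eventually (gt_mem_nhds (show 0 < ε / 4 by linarith))).exists
  have hev : ∀ᶠ i in l, dist (cornerDet (B i) (m i)) (cornerDet y N) < ε / 2 := by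
    filter_upwards [hB, hm.eventually_ge_atTop N,
      Metric.tendsto_nhds.1 (hcorner N) (ε / 4) (by linarith)] with i h1 h2 h3
    have h4 := norm_cornerDet_sub_le hb h2 h1
    rw [← dist_eq_norm] at h4
    linarith [dist_triangle (cornerDet (B i) (m i)) (cornerDet (B i) N) (cornerDet y N)]
  refine ⟨_, image_mem_map hev, ?_⟩
  rintro _ ⟨i, hi, rfl⟩ _ ⟨j, hj, rfl⟩
  have hi : dist _ _ < _ := hi
  have hj : dist _ _ < _ := hj
  linarith [dist_triangle_right (cornerDet (B i) (m i)) (cornerDet (B j) (m j)) (cornerDet y N)]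

theorem cornerDet_conj (B : ℕ → ℕ → ℂ) {x : ℕ → ℂ} (hx : ∀ i, x i ≠ 0) (n : ℕ) :
    cornerDet (fun i j => x i * B i j * (x j)⁻¹) n = cornerDet B n := by
  have e : (Matrix.of fun i j : Fin n => (if i = j then 1 else 0) - x i * B i j * (x j)⁻¹)
      = Matrix.diagonal (fun i : Fin n => x i)
        * (Matrix.of fun i j : Fin n => (if i = j then 1 else 0) - B i j)
        * Matrix.diagonal (fun i : Fin n => (x i)⁻¹) := by
    ext i j
    rw [Matrix.mul_diagonal, Matrix.diagonal_mul, Matrix.of_apply, Matrix.of_apply]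
    split_ifs with h
    · subst h
      have := mul_inv_cancel₀ (hx i)
      linear_combination -this
    · ring
  rw [cornerDet, e, Matrix.det_mul, Matrix.det_mul, Matrix.det_diagonal, Matrix.det_diagonal,
    cornerDet, mul_right_comm, ← Finset.prod_mul_distrib]
  simp [hx]

end TruncatedDeterminants

/-! ### Rescaled coefficients of the orthogonal polynomials of the uncut weight -/

noncomputable section KernelAsymptotics

open Polynomial

/-- The second order differential equation of the orthogonal polynomials, for coefficients. -/
theorem IsPearson.coeff_add_two {L : ℝ[X] →ₗ[ℝ] ℝ} (hL : IsSymmPos L) {α a : ℝ}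
    (hP : IsPearson L α a 0) (n k : ℕ) :
    ((k : ℝ) + 2) * (k + 1) * (orthoPoly L n).coeff (k + 2)
      = -((n - k) * (n + k + 2 * α + 1)) * (orthoPoly L n).coeff k := by
  have hP' : ∀ p : ℝ[X], L ((1 - X ^ 2) * derivative p) = (2 + 2 * α) * L (X * p) := fun p => by
    rw [hP p]; ring
  have hcoeff : ∀ (p : ℝ[X]) (c : ℝ) (j : ℕ),
      ((1 - X ^ 2) * derivative (derivative p) - (2 + 2 * α) • (X * derivative p)
        + c • p).coeff j
      = ((j : ℝ) + 2) * (j + 1) * p.coeff (j + 2) + (c - j * (j + 2 * α + 1)) * p.coeff j := by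
    intro p c j
    rw [coeff_add, coeff_sub, coeff_smul, coeff_smul, sub_mul, one_mul, coeff_sub,
      coeff_derivative, coeff_derivative, coeff_X_pow_mul']
    rcases j with _ | _ | j
    · simp; ring
    · simp [coeff_X_mul, coeff_derivative]; ring
    · rw [if_pos (by omega), coeff_X_mul]
      simp only [coeff_derivative, smul_eq_mul, show j + 1 + 1 - 2 = j by omega]
      push_cast
      ring
  set P := orthoPoly L n with hPdef
  -- Q is the residual of the Gegenbauer equation. The eigenvalue n(n+2α+1) cancels its top
  -- coefficient, and self-adjointness of the operator makes it orthogonal to all lower P_i, so Q =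
  -- 0.
  set Q := (1 - X ^ 2) * derivative (derivative P) - (2 + 2 * α) • (X * derivative P)
    + ((n : ℝ) * (n + 2 * α + 1)) • P with hQ
  have hdeg : Q.degree < n := by
    rw [degree_lt_iff_coeff_zero]
    intro j hj
    have h1 : P.coeff (j + 2) = 0 := coeff_eq_zero_of_natDegree_lt (by
      rw [natDegree_orthoPoly]; omega)
    rw [hQ, hcoeff, h1]
    rcases hj.eq_or_lt with rfl | hj
    · ring
    · rw [coeff_eq_zero_of_natDegree_lt (by rwa [natDegree_orthoPoly] : P.natDegree < j)]; ring
  have hQ0 : Q = 0 := by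
    rw [hL.eq_sum_orthoPoly hdeg]
    refine Finset.sum_eq_zero fun i hi => ?_
    have hi := Finset.mem_range.1 hi
    set R := orthoPoly L i with hR
    have h1 := hP' (derivative P * R)
    have h2 := hP' (P * derivative R)
    have h3 : L (P * R) = 0 := hL.map_orthoPoly_mul_orthoPoly n i hi
    have h4 : L (P * ((1 - X ^ 2) * derivative (derivative R)
        - (2 + 2 * α) • (X * derivative R) + (0 : ℝ) • R)) = 0 := by
      refine hL.map_orthoPoly_mul ((degree_lt_iff_coeff_zero _ _).2 fun j hj => ?_)
      rw [hcoeff, coeff_eq_zero_of_natDegree_lt (by rw [natDegree_orthoPoly]; omega :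
        R.natDegree < j + 2), coeff_eq_zero_of_natDegree_lt (by rw [natDegree_orthoPoly]; omega :
        R.natDegree < j)]
      ring
    have h5 : L (Q * R) = 0 := by
      have e : Q * R = (1 - X ^ 2) * derivative (derivative P * R)
          - (1 - X ^ 2) * derivative (P * derivative R)
          + P * ((1 - X ^ 2) * derivative (derivative R)
            - (2 + 2 * α) • (X * derivative R) + (0 : ℝ) • R)
          + (2 + 2 * α) • (X * (P * derivative R)) - (2 + 2 * α) • (X * (derivative P * R))
          + ((n : ℝ) * (n + 2 * α + 1)) • (P * R) := by
        rw [hQ, derivative_mul, derivative_mul]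
        simp only [smul_eq_C_mul, map_zero]
        ring
      rw [e, map_add, map_sub, map_add, map_add, map_sub, h1, h2, h4, map_smul, map_smul,
        map_smul, h3]
      simp
    rw [h5]
    simp
  have := hcoeff P ((n : ℝ) * (n + 2 * α + 1)) k
  rw [← hQ, hQ0, coeff_zero] at this
  linear_combination -this

theorem coeff_orthoPoly_eq_zero (L : ℝ[X] →ₗ[ℝ] ℝ) {n k : ℕ} (h : k % 2 ≠ n % 2) :
    (orthoPoly L n).coeff k = 0 := by
  induction n using Nat.strong_induction_on generalizing k with
  | _ n ih =>
    match n with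
    | 0 =>
      rw [orthoPoly, coeff_one, if_neg]
      rintro rfl
      exact h rfl
    | 1 =>
      rw [orthoPoly, coeff_X, if_neg]
      rintro rfl
      exact h rfl
    | n + 2 =>
      rw [orthoPoly_add_two, coeff_sub, coeff_C_mul, ih n (by omega) (by omega)]
      cases k with
      | zero => simp
      | succ k => rw [coeff_X_mul, ih (n + 1) (by omega) (by omega)]; simp

/-- The coefficients, rescaled by `n`, of the solutions of the differential equation of degree
`d`. -/
def scaledCoeff (α d n : ℝ) : ℕ → ℝ
  | 0 => 1
  | 1 => 1
  | k + 2 => -((d - k) * (d + k + 2 * α + 1) / (n ^ 2 * ((k + 2) * (k + 1)))) * scaledCoeff α d n k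

theorem IsPearson.coeff_eq_scaledCoeff {L : ℝ[X] →ₗ[ℝ] ℝ} (hL : IsSymmPos L) {α a : ℝ}
    (hP : IsPearson L α a 0) (d : ℕ) {n : ℝ} (hn : n ≠ 0) (k : ℕ) :
    n ^ (k % 2) * (orthoPoly L d).coeff k
      = (orthoPoly L d).coeff (k % 2) * n ^ k * scaledCoeff α d n k := by
  induction k using Nat.strong_induction_on with
  | _ k ih =>
    match k with
    | 0 => simp [scaledCoeff]
    | 1 => simp [scaledCoeff]; ring
    | k + 2 =>
      have h1 := ih k (by omega)
      have h2 := hP.coeff_add_two hL d k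
      rw [scaledCoeff, Nat.add_mod_right]
      have hk1 : (k : ℝ) + 1 ≠ 0 := by positivity
      have hk2 : (k : ℝ) + 2 ≠ 0 := by positivity
      field_simp
      rw [pow_add]
      linear_combination n ^ 2 * n ^ (k % 2) * h2 - n ^ 2 * (d - k) * (d + k + 2 * α + 1) * h1

/-- Since k has the parity of d, the recursion meets the zero factor d - k at k = d and stops;
before that, its factor is at most (2α+2)²/((k+2)(k+1)). -/
theorem scaledCoeff_bound {α : ℝ} (hα : 0 < α) {d n : ℕ} (hd : d ≤ n) (hn : 1 ≤ n) {k : ℕ}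
    (hk : k % 2 = d % 2) : |scaledCoeff α d n k| ≤ (2 * α + 2) ^ k / k.factorial := by
  suffices h : ∀ k, k % 2 = d % 2 → (k ≤ d ∨ scaledCoeff α d n k = 0) ∧
      |scaledCoeff α d n k| ≤ (2 * α + 2) ^ k / k.factorial from (h k hk).2
  intro k
  induction k using Nat.strong_induction_on with
  | _ k ih =>
    match k with
    | 0 => intro _; simp [scaledCoeff]
    | 1 => intro h; simp [scaledCoeff]; constructor <;> [omega; linarith]
    | k + 2 =>
      intro hk
      obtain ⟨h1, h2⟩ := ih k (by omega) (by omega)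
      have hM : 1 ≤ 2 * α + 2 := by linarith
      rcases h1 with h1 | h1
      · refine ⟨?_, ?_⟩
        · rcases h1.eq_or_lt with rfl | h1
          · right; simp [scaledCoeff]
          · left; omega
        · have hn' : (1 : ℝ) ≤ n := by exact_mod_cast hn
          have hd' : (d : ℝ) ≤ n := by exact_mod_cast hd
          have hk' : (k : ℝ) ≤ d := by exact_mod_cast h1
          have hk0 : (0 : ℝ) ≤ k := by positivity
          have hA : 0 ≤ ((d : ℝ) - k) * (d + k + 2 * α + 1) :=
            mul_nonneg (by linarith) (by linarith)
          have hB : ((d : ℝ) - k) * (d + k + 2 * α + 1) ≤ n ^ 2 * (2 * α + 2) ^ 2 := by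
            have e1 : ((d : ℝ) - k) * (d + k + 2 * α + 1) ≤ d ^ 2 + (2 * α + 1) * d := by
              nlinarith
            have e2 : (d : ℝ) ^ 2 ≤ n ^ 2 := by nlinarith
            have e3 : (d : ℝ) ≤ n ^ 2 := by nlinarith
            have e4 : (d : ℝ) ^ 2 + (2 * α + 1) * d ≤ n ^ 2 * (2 * α + 2) := by nlinarith
            have e5 : (n : ℝ) ^ 2 * (2 * α + 2) ≤ n ^ 2 * (2 * α + 2) ^ 2 := by
              have : (2 * α + 2) ≤ (2 * α + 2) ^ 2 := by nlinarith
              exact mul_le_mul_of_nonneg_left this (by positivity)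
            linarith
          have hf : ((k + 2).factorial : ℝ) = (k + 2) * (k + 1) * k.factorial := by
            rw [Nat.factorial_succ, Nat.factorial_succ]; push_cast; ring
          rw [scaledCoeff, abs_mul, abs_neg, abs_of_nonneg (by positivity), hf, pow_add]
          calc ((d : ℝ) - k) * (d + k + 2 * α + 1) / (n ^ 2 * ((k + 2) * (k + 1)))
                * |scaledCoeff α d n k|
              ≤ (n ^ 2 * (2 * α + 2) ^ 2) / (n ^ 2 * ((k + 2) * (k + 1)))
                * ((2 * α + 2) ^ k / k.factorial) := by gcongr
            _ = _ := by
                have : (n : ℝ) ≠ 0 := by positivity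
                have := Nat.factorial_ne_zero k
                field_simp
      · have h0 : scaledCoeff α d n (k + 2) = 0 := by rw [scaledCoeff, h1, mul_zero]
        refine ⟨Or.inr h0, ?_⟩
        rw [h0, abs_zero]
        positivity

theorem exists_tendsto_scaledCoeff (α : ℝ) {d : ℕ → ℕ}
    (hd : Tendsto (fun n : ℕ => (d n : ℝ) / n) atTop (𝓝 1)) (k : ℕ) :
    ∃ y, Tendsto (fun n : ℕ => scaledCoeff α (d n) n k) atTop (𝓝 y) := by
  induction k using Nat.strong_induction_on with
  | _ k ih =>
    match k with
    | 0 => exact ⟨1, tendsto_const_nhds⟩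
    | 1 => exact ⟨1, tendsto_const_nhds⟩
    | k + 2 =>
      obtain ⟨y, hy⟩ := ih k (by omega)
      have h1 := hd.sub (tendsto_const_div_atTop_nhds_zero_nat (k : ℝ))
      have h2 := hd.add (tendsto_const_div_atTop_nhds_zero_nat ((k : ℝ) + 2 * α + 1))
      have h3 := (((h1.mul h2).div_const (((k : ℝ) + 2) * (k + 1))).neg).mul hy
      refine ⟨_, h3.congr' ?_⟩
      filter_upwards [eventually_ne_atTop 0] with n hn
      have hn : (n : ℝ) ≠ 0 := by exact_mod_cast hn
      have hk1 : (k : ℝ) + 1 ≠ 0 := by positivity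
      have hk2 : (k : ℝ) + 2 ≠ 0 := by positivity
      rw [scaledCoeff]
      congr 2
      field_simp
      ring

end KernelAsymptotics

/-! ### Limits and uniform bounds for the rescaled kernel coefficients -/

noncomputable section KernelLimits

open Polynomial

/-- The coefficients of the Christoffel–Darboux kernel. -/
def kernelCoeff (L : ℝ[X] →ₗ[ℝ] ℝ) (n l m : ℕ) : ℝ :=
  ∑ k ∈ Finset.range n, (orthoPoly L k).coeff l * (orthoPoly L k).coeff m / orthoNorm L k

/-- The antisymmetric numerator of the Christoffel–Darboux formula, for coefficients. -/
def wronskianCoeff (L : ℝ[X] →ₗ[ℝ] ℝ) (n l m : ℕ) : ℝ :=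
  ((orthoPoly L (n + 1)).coeff l * (orthoPoly L n).coeff m
    - (orthoPoly L n).coeff l * (orthoPoly L (n + 1)).coeff m) / orthoNorm L n

theorem IsSymmPos.kernelCoeff_zero {L : ℝ[X] →ₗ[ℝ] ℝ} (hL : IsSymmPos L) (n l : ℕ) :
    kernelCoeff L (n + 1) l 0 = wronskianCoeff L n (l + 1) 0 := by
  have := hL.christoffelDarboux (lcoeff ℝ (l + 1)) (lcoeff ℝ 0) n
  simp only [lcoeff_apply, coeff_X_mul, coeff_X_mul_zero, mul_zero, sub_zero] at this
  rw [kernelCoeff, wronskianCoeff, ← this]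

/-- Comparing coefficients in the Christoffel–Darboux formula shifts one unit of degree between the
variables. Iteration reduces every kernel coefficient to Wronskian terms. -/
theorem IsSymmPos.kernelCoeff_succ {L : ℝ[X] →ₗ[ℝ] ℝ} (hL : IsSymmPos L) (n l m : ℕ) :
    kernelCoeff L (n + 1) l (m + 1)
      = kernelCoeff L (n + 1) (l + 1) m + wronskianCoeff L n (l + 1) (m + 1) := by
  have := hL.christoffelDarboux (lcoeff ℝ (l + 1)) (lcoeff ℝ (m + 1)) n
  simp only [lcoeff_apply, coeff_X_mul] at this
  rw [kernelCoeff, wronskianCoeff, ← this, kernelCoeff, ← Finset.sum_add_distrib]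
  exact Finset.sum_congr rfl fun k _ => by ring

/-- The rescaled coefficients of the even one of the polynomials of degrees `n` and `n - 1`. -/
def scaledEven (α : ℝ) (n l : ℕ) : ℝ :=
  if l % 2 = 0 then scaledCoeff α (2 * (n / 2) : ℕ) n l else 0

/-- The rescaled coefficients of the odd one of the polynomials of degrees `n` and `n - 1`. -/
def scaledOdd (α : ℝ) (n l : ℕ) : ℝ :=
  if l % 2 = 1 then scaledCoeff α (2 * ((n - 1) / 2) + 1 : ℕ) n l else 0

theorem IsPearson.coeff_even {L : ℝ[X] →ₗ[ℝ] ℝ} (hL : IsSymmPos L) {α a : ℝ}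
    (hP : IsPearson L α a 0) {n : ℕ} (hn : 1 ≤ n) (l : ℕ) :
    (orthoPoly L (2 * (n / 2))).coeff l
      = (orthoPoly L (2 * (n / 2))).coeff 0 * n ^ l * scaledEven α n l := by
  rw [scaledEven]
  split_ifs with h
  · have := hP.coeff_eq_scaledCoeff hL (2 * (n / 2)) (n := n) (by positivity) l
    rwa [h, pow_zero, one_mul] at this
  · rw [coeff_orthoPoly_eq_zero L (by omega), mul_zero]

theorem IsPearson.coeff_odd {L : ℝ[X] →ₗ[ℝ] ℝ} (hL : IsSymmPos L) {α a : ℝ}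
    (hP : IsPearson L α a 0) {n : ℕ} (hn : 1 ≤ n) (l : ℕ) :
    n * (orthoPoly L (2 * ((n - 1) / 2) + 1)).coeff l
      = (orthoPoly L (2 * ((n - 1) / 2) + 1)).coeff 1 * n ^ l * scaledOdd α n l := by
  rw [scaledOdd]
  split_ifs with h
  · have := hP.coeff_eq_scaledCoeff hL (2 * ((n - 1) / 2) + 1) (n := n) (by positivity) l
    rwa [h, pow_one] at this
  · rw [coeff_orthoPoly_eq_zero L (by omega), mul_zero, mul_zero]

/-- Sorting the two polynomials by parity removes the case distinction on n. The common
normalization, read off at (l, m) = (1, 0), is the kernel at the origin, so no asymptotics of the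
separate norms are needed. -/
theorem IsPearson.wronskianCoeff_eq {L : ℝ[X] →ₗ[ℝ] ℝ} (hL : IsSymmPos L) {α a : ℝ}
    (hP : IsPearson L α a 0) (n l m : ℕ) :
    (n + 1 : ℕ) * wronskianCoeff L n l m = kernelCoeff L (n + 1) 0 0 * (n + 1 : ℕ) ^ (l + m)
      * (scaledOdd α (n + 1) l * scaledEven α (n + 1) m
        - scaledEven α (n + 1) l * scaledOdd α (n + 1) m) := by
  have e := hP.coeff_even hL (n := n + 1) (by omega)
  have o := hP.coeff_odd hL (n := n + 1) (by omega)
  obtain ⟨s, hs⟩ : ∃ s : ℝ, ∀ l m, wronskianCoeff L n l m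
      = s * ((orthoPoly L (2 * ((n + 1 - 1) / 2) + 1)).coeff l
          * (orthoPoly L (2 * ((n + 1) / 2))).coeff m
        - (orthoPoly L (2 * ((n + 1) / 2))).coeff l
          * (orthoPoly L (2 * ((n + 1 - 1) / 2) + 1)).coeff m) := by
    rcases Nat.even_or_odd' n with ⟨j, rfl | rfl⟩
    · refine ⟨1 / orthoNorm L (2 * j), fun l m => ?_⟩
      rw [wronskianCoeff, show 2 * ((2 * j + 1 - 1) / 2) + 1 = 2 * j + 1 by omega,
        show 2 * ((2 * j + 1) / 2) = 2 * j by omega]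
      ring
    · refine ⟨-1 / orthoNorm L (2 * j + 1), fun l m => ?_⟩
      rw [wronskianCoeff, show 2 * ((2 * j + 1 + 1 - 1) / 2) + 1 = 2 * j + 1 by omega,
        show 2 * ((2 * j + 1 + 1) / 2) = 2 * j + 1 + 1 by omega]
      ring
  have z1 : (orthoPoly L (2 * ((n + 1) / 2))).coeff 1 = 0 := coeff_orthoPoly_eq_zero L (by omega)
  rw [hL.kernelCoeff_zero, hs, hs, z1, e l, e m]
  simp only [zero_add, zero_mul, sub_zero]
  rw [pow_add]
  linear_combination s * (orthoPoly L (2 * ((n + 1) / 2))).coeff 0 *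
    ((n + 1 : ℕ) ^ m * scaledEven α (n + 1) m * o l
      - (n + 1 : ℕ) ^ l * scaledEven α (n + 1) l * o m)

/-- The kernel coefficients in the bulk scaling. -/
def scaledKernelCoeff (L : ℝ[X] →ₗ[ℝ] ℝ) (n l m : ℕ) : ℝ :=
  kernelCoeff L n l m / n ^ (l + m + 1)

theorem IsPearson.scaledKernelCoeff_zero {L : ℝ[X] →ₗ[ℝ] ℝ} (hL : IsSymmPos L) {α a : ℝ}
    (hP : IsPearson L α a 0) {n : ℕ} (hn : 1 ≤ n) (l : ℕ) :
    scaledKernelCoeff L n l 0 = kernelCoeff L n 0 0 / n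
      * (scaledOdd α n (l + 1) * scaledEven α n 0 - scaledEven α n (l + 1) * scaledOdd α n 0) := by
  obtain ⟨n, rfl⟩ : ∃ m, n = m + 1 := ⟨n - 1, by omega⟩
  have h := hP.wronskianCoeff_eq hL n (l + 1) 0
  rw [← hL.kernelCoeff_zero] at h
  have hn' : ((n + 1 : ℕ) : ℝ) ≠ 0 := by positivity
  rw [scaledKernelCoeff, add_zero, div_eq_iff (by positivity)]
  refine mul_left_cancel₀ hn' ?_
  rw [h]
  field_simp

theorem IsPearson.scaledKernelCoeff_succ {L : ℝ[X] →ₗ[ℝ] ℝ} (hL : IsSymmPos L) {α a : ℝ}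
    (hP : IsPearson L α a 0) {n : ℕ} (hn : 1 ≤ n) (l m : ℕ) :
    scaledKernelCoeff L n l (m + 1) = scaledKernelCoeff L n (l + 1) m + kernelCoeff L n 0 0 / n
      * (scaledOdd α n (l + 1) * scaledEven α n (m + 1)
        - scaledEven α n (l + 1) * scaledOdd α n (m + 1)) := by
  obtain ⟨n, rfl⟩ : ∃ m, n = m + 1 := ⟨n - 1, by omega⟩
  have h := hP.wronskianCoeff_eq hL n (l + 1) (m + 1)
  have hn' : ((n + 1 : ℕ) : ℝ) ≠ 0 := by positivity
  rw [scaledKernelCoeff, hL.kernelCoeff_succ, add_div, scaledKernelCoeff]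
  congr 1
  · congr 2; omega
  · rw [div_eq_iff (by positivity)]
    refine mul_left_cancel₀ hn' ?_
    rw [h]
    field_simp
    ring_nf

theorem abs_scaledEven_le {α : ℝ} (hα : 0 < α) {n : ℕ} (hn : 1 ≤ n) (l : ℕ) :
    |scaledEven α n l| ≤ (2 * α + 2) ^ l / l.factorial := by
  rw [scaledEven]
  split_ifs with h
  · exact scaledCoeff_bound hα (by omega) hn (by omega)
  · rw [abs_zero]; positivity

theorem abs_scaledOdd_le {α : ℝ} (hα : 0 < α) {n : ℕ} (hn : 1 ≤ n) (l : ℕ) :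
    |scaledOdd α n l| ≤ (2 * α + 2) ^ l / l.factorial := by
  rw [scaledOdd]
  split_ifs with h
  · exact scaledCoeff_bound hα (by omega) hn (by omega)
  · rw [abs_zero]; positivity

theorem tendsto_div_nat_of_le {d : ℕ → ℕ} (h : ∀ᶠ n in atTop, d n ≤ n ∧ n ≤ d n + 1) :
    Tendsto (fun n : ℕ => (d n : ℝ) / n) atTop (𝓝 1) := by
  have h1 : Tendsto (fun n : ℕ => 1 - 1 / (n : ℝ)) atTop (𝓝 1) := by
    simpa using (tendsto_const_nhds (x := (1 : ℝ))).sub (tendsto_const_div_atTop_nhds_zero_nat 1)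
  refine tendsto_of_tendsto_of_tendsto_of_le_of_le' h1 tendsto_const_nhds ?_ ?_
  · filter_upwards [h, eventually_gt_atTop 0] with n hn hpos
    have hpos : (0 : ℝ) < n := by exact_mod_cast hpos
    have : (n : ℝ) ≤ d n + 1 := by exact_mod_cast hn.2
    rw [le_div_iff₀ hpos, sub_mul, div_mul_cancel₀ _ hpos.ne']
    linarith
  · filter_upwards [h, eventually_gt_atTop 0] with n hn hpos
    have hpos : (0 : ℝ) < n := by exact_mod_cast hpos
    rw [div_le_one hpos]
    exact_mod_cast hn.1

theorem exists_tendsto_scaledEven (α : ℝ) (l : ℕ) :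
    ∃ y, Tendsto (fun n => scaledEven α n l) atTop (𝓝 y) := by
  unfold scaledEven
  split_ifs with h
  · exact exists_tendsto_scaledCoeff α (d := fun n => 2 * (n / 2))
      (tendsto_div_nat_of_le (Eventually.of_forall fun n => by omega)) l
  · exact ⟨0, tendsto_const_nhds⟩

theorem exists_tendsto_scaledOdd (α : ℝ) (l : ℕ) :
    ∃ y, Tendsto (fun n => scaledOdd α n l) atTop (𝓝 y) := by
  unfold scaledOdd
  split_ifs with h
  · refine exists_tendsto_scaledCoeff α (d := fun n => 2 * ((n - 1) / 2) + 1)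
      (tendsto_div_nat_of_le ?_) l
    filter_upwards [eventually_ge_atTop 1] with n hn
    omega
  · exact ⟨0, tendsto_const_nhds⟩

/-- The constraint with w = 0. The endpoint 1/2 is a dummy, its boundary term being multiplied by 0.
-/
theorem IsPearson.recCoeff_eq {L : ℝ[X] →ₗ[ℝ] ℝ} (hL : IsSymmPos L) {α : ℝ} (hα : 0 < α)
    (hP : IsPearson L α (1 / 2) 0) (m : ℕ) :
    (4 * (m + 1 + α) ^ 2 - 1) * recCoeff L (m + 1) = (m + 1 + α) ^ 2 - α ^ 2 := by
  have := (show IsPearson L α (1 / 2) ((1 - (1 / 2) ^ 2) * 0) by simpa using hP).gap_constraint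
    hL hα le_rfl (by norm_num) m rfl
  simp only [gapZ, gapU, gapV, mul_zero, zero_mul, zero_div] at this
  linear_combination -this

/-- The squared value at the origin of the normalized even polynomials converges. -/
theorem IsPearson.exists_tendsto_even {L : ℝ[X] →ₗ[ℝ] ℝ} (hL : IsSymmPos L) {α : ℝ} (hα : 0 < α)
    (hP : IsPearson L α (1 / 2) 0) : ∃ θ, Tendsto (fun j : ℕ =>
      (orthoPoly L (2 * j)).coeff 0 ^ 2 / orthoNorm L (2 * j)) atTop (𝓝 θ) := by
  set θ : ℕ → ℝ := fun j => (orthoPoly L (2 * j)).coeff 0 ^ 2 / orthoNorm L (2 * j) with hθ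
  have hb := hP.recCoeff_eq hL hα
  have hpos : ∀ m : ℕ, 0 < 4 * ((m : ℝ) + 1 + α) ^ 2 - 1 := fun m => by
    have : (0 : ℝ) ≤ m := by positivity
    nlinarith
  have hb' : ∀ m, recCoeff L (m + 1)
      = 1 / 4 + (1 / 4 - α ^ 2) * (1 / (4 * ((m : ℝ) + 1 + α) ^ 2 - 1)) := by
    intro m
    have h1 := (hpos m).ne'
    rw [eq_comm, ← mul_right_inj' h1, hb]
    field_simp
    ring
  -- The recurrence coefficients tend monotonically to 1/4, in a direction fixed by the sign of 1/4
  -- - α², so this relation makes θ monotone.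
  have hrec : ∀ j, θ (j + 1) * recCoeff L (2 * j + 2) = θ j * recCoeff L (2 * j + 1) := by
    intro j
    have h1 : (orthoPoly L (2 * j + 2)).coeff 0
        = -(recCoeff L (2 * j + 1) * (orthoPoly L (2 * j)).coeff 0) := by
      rw [orthoPoly_add_two, coeff_sub, coeff_C_mul, coeff_X_mul_zero, zero_sub]
    have h2 := hL.orthoNorm_pos (2 * j)
    have h3 := hL.orthoNorm_pos (2 * j + 1)
    have h4 := hL.orthoNorm_pos (2 * j + 2)
    simp only [hθ]
    rw [show 2 * (j + 1) = 2 * j + 2 by ring, h1, recCoeff, recCoeff]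
    field_simp
  have hmono : ∀ m m' : ℕ, m ≤ m' → 1 / (4 * ((m' : ℝ) + 1 + α) ^ 2 - 1)
      ≤ 1 / (4 * ((m : ℝ) + 1 + α) ^ 2 - 1) := by
    intro m m' h
    refine one_div_le_one_div_of_le (hpos m) ?_
    have : (m : ℝ) ≤ m' := by exact_mod_cast h
    have : (0 : ℝ) ≤ m := by positivity
    nlinarith
  have hθ0 : ∀ j, 0 ≤ θ j := fun j => div_nonneg (sq_nonneg _) (hL.orthoNorm_pos _).le
  rcases le_total (1 / 4 - α ^ 2) 0 with hc | hc
  · have hb2 : ∀ m m', m ≤ m' → recCoeff L (m + 1) ≤ recCoeff L (m' + 1) := by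
      intro m m' h
      rw [hb', hb']
      have := mul_le_mul_of_nonpos_left (hmono m m' h) hc
      linarith
    have hanti : Antitone θ := antitone_nat_of_succ_le fun j => by
      have h1 := hrec j
      have h2 := mul_le_mul_of_nonneg_left (hb2 (2 * j) (2 * j + 1) (by omega)) (hθ0 j)
      rw [← h1] at h2
      exact le_of_mul_le_mul_right h2 (hL.recCoeff_pos _)
    exact ⟨_, tendsto_atTop_ciInf hanti ⟨0, by rintro _ ⟨j, rfl⟩; exact hθ0 j⟩⟩
  · have hb2 : ∀ m m', m ≤ m' → recCoeff L (m' + 1) ≤ recCoeff L (m + 1) := by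
      intro m m' h
      rw [hb', hb']
      have := mul_le_mul_of_nonneg_left (hmono m m' h) hc
      linarith
    have hquarter : ∀ m, 1 / 4 ≤ recCoeff L (m + 1) := by
      intro m
      rw [hb']
      have := mul_nonneg hc (one_div_nonneg.2 (hpos m).le)
      linarith
    have hM : Monotone θ := monotone_nat_of_le_succ fun j => by
      have h1 := hrec j
      have h2 := mul_le_mul_of_nonneg_left (hb2 (2 * j) (2 * j + 1) (by omega)) (hθ0 j)
      rw [← h1] at h2
      refine le_of_mul_le_mul_right (?_ : θ j * recCoeff L (2 * j + 2) ≤ _)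
        (hL.recCoeff_pos (2 * j + 1))
      exact h2
    -- Here θ increases, and this product, which does not, together with the lower bound 1/4 on the
    -- coefficients, bounds θ.
    have hbd : ∀ j, θ (j + 1) * recCoeff L (2 * j + 2) ≤ θ 0 * recCoeff L 1 := by
      intro j
      induction j with
      | zero => exact (hrec 0).le
      | succ j ih =>
        rw [hrec (j + 1)]
        refine le_trans ?_ ih
        exact mul_le_mul_of_nonneg_left (hb2 (2 * j + 1) (2 * (j + 1)) (by omega)) (hθ0 _)
    refine ⟨_, tendsto_atTop_ciSup hM ⟨4 * (θ 0 * recCoeff L 1), ?_⟩⟩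
    rintro _ ⟨j, rfl⟩
    refine (hM (Nat.le_succ j)).trans ?_
    have h1 := hbd j
    have h2 := mul_le_mul_of_nonneg_left (hquarter (2 * j + 1)) (hθ0 (j + 1))
    linarith

/-- The summands P_k(0)²/h_k vanish for odd k, so neighbouring ones are paired: the pairs converge,
and Cesàro means give the limit. -/
theorem IsPearson.exists_tendsto_kernelCoeff {L : ℝ[X] →ₗ[ℝ] ℝ} (hL : IsSymmPos L) {α : ℝ}
    (hα : 0 < α) (hP : IsPearson L α (1 / 2) 0) :
    ∃ y, Tendsto (fun n : ℕ => kernelCoeff L n 0 0 / n) atTop (𝓝 y) := by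
  obtain ⟨θ, hθ⟩ := hP.exists_tendsto_even hL hα
  set u : ℕ → ℝ := fun k => (orthoPoly L k).coeff 0 * (orthoPoly L k).coeff 0 / orthoNorm L k
    with hu
  have hv : ∀ k, u k + u (k + 1) = (orthoPoly L (2 * ((k + 1) / 2))).coeff 0 ^ 2
      / orthoNorm L (2 * ((k + 1) / 2)) := by
    intro k
    simp only [hu]
    rcases Nat.even_or_odd' k with ⟨j, rfl | rfl⟩
    · rw [coeff_orthoPoly_eq_zero L (by omega : 0 % 2 ≠ (2 * j + 1) % 2),
        show 2 * ((2 * j + 1) / 2) = 2 * j by omega]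
      ring
    · rw [coeff_orthoPoly_eq_zero L (by omega : 0 % 2 ≠ (2 * j + 1) % 2),
        show 2 * ((2 * j + 1 + 1) / 2) = 2 * j + 1 + 1 by omega]
      ring
  have hvlim : Tendsto (fun k => u k + u (k + 1)) atTop (𝓝 θ) := by
    simp only [hv]
    exact hθ.comp (tendsto_atTop_mono (fun k => by omega : ∀ k, k / 2 ≤ (k + 1) / 2)
      (Nat.tendsto_div_const_atTop (by norm_num)))
  have hu0 : ∀ k, 0 ≤ u k := fun k =>
    div_nonneg (mul_self_nonneg _) (hL.orthoNorm_pos _).le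
  have hun : Tendsto (fun n : ℕ => (n : ℝ)⁻¹ * u n) atTop (𝓝 0) := by
    have h1 := (tendsto_inv_atTop_nhds_zero_nat (𝕜 := ℝ)).mul hvlim
    rw [zero_mul] at h1
    refine tendsto_of_tendsto_of_tendsto_of_le_of_le tendsto_const_nhds h1
      (fun n => mul_nonneg (by positivity) (hu0 n))
      fun n => mul_le_mul_of_nonneg_left (by linarith [hu0 (n + 1)]) (by positivity)
  have hc := (hvlim.cesaro.add ((tendsto_inv_atTop_nhds_zero_nat (𝕜 := ℝ)).mul_const (u 0))).sub
    hun
  refine ⟨_, (hc.div_const 2).congr fun n => ?_⟩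
  have h3 : ∑ k ∈ Finset.range n, (u k + u (k + 1)) = 2 * kernelCoeff L n 0 0 - u 0 + u n := by
    have h4 := Finset.sum_range_succ' u n
    rw [Finset.sum_range_succ] at h4
    rw [Finset.sum_add_distrib, kernelCoeff]
    linarith
  rw [h3]
  ring

theorem IsPearson.exists_tendsto_scaledKernelCoeff {L : ℝ[X] →ₗ[ℝ] ℝ} (hL : IsSymmPos L) {α : ℝ}
    (hα : 0 < α) (hP : IsPearson L α (1 / 2) 0) (l m : ℕ) :
    ∃ y, Tendsto (fun n => scaledKernelCoeff L n l m) atTop (𝓝 y) := by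
  obtain ⟨c, hc⟩ := hP.exists_tendsto_kernelCoeff hL hα
  choose e he using exists_tendsto_scaledEven α
  choose o ho using exists_tendsto_scaledOdd α
  induction m generalizing l with
  | zero =>
    refine ⟨_, (hc.mul (((ho (l + 1)).mul (he 0)).sub ((he (l + 1)).mul (ho 0)))).congr' ?_⟩
    filter_upwards [eventually_ge_atTop 1] with n hn
    rw [hP.scaledKernelCoeff_zero hL hn]
  | succ m ih =>
    obtain ⟨y, hy⟩ := ih (l + 1)
    refine ⟨_, (hy.add (hc.mul (((ho (l + 1)).mul (he (m + 1))).sub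
      ((he (l + 1)).mul (ho (m + 1)))))).congr' ?_⟩
    filter_upwards [eventually_ge_atTop 1] with n hn
    rw [hP.scaledKernelCoeff_succ hL hn]

theorem pow_div_factorial_mul_le {M : ℝ} (hM : 0 ≤ M) (l m : ℕ) :
    M ^ l / l.factorial * (M ^ m / m.factorial) ≤ (2 * M) ^ (l + m) / (l + m).factorial := by
  have h1 : ((l + m).choose m : ℝ) ≤ 2 ^ (l + m) := by exact_mod_cast Nat.choose_le_two_pow _ _
  have h2 : ((l + m).choose m : ℝ) * l.factorial * m.factorial = (l + m).factorial := by
    exact_mod_cast Nat.add_choose_mul_factorial_mul_factorial l m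
  have hl : (0 : ℝ) < l.factorial := by exact_mod_cast Nat.factorial_pos _
  have hm : (0 : ℝ) < m.factorial := by exact_mod_cast Nat.factorial_pos _
  rw [div_mul_div_comm, ← pow_add, mul_pow, div_le_div_iff₀ (by positivity) (by positivity), ← h2]
  have h3 : 0 ≤ M ^ (l + m) * (l.factorial * m.factorial) := by positivity
  nlinarith [mul_le_mul_of_nonneg_left h1 h3]

theorem IsPearson.exists_scaledKernelCoeff_bound {L : ℝ[X] →ₗ[ℝ] ℝ} (hL : IsSymmPos L) {α : ℝ}
    (hα : 0 < α) (hP : IsPearson L α (1 / 2) 0) :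
    ∃ c M : ℝ, 0 ≤ c ∧ 0 ≤ M ∧ ∀ n l m, 1 ≤ n →
      |scaledKernelCoeff L n l m| ≤ c * (M ^ l / l.factorial) * (M ^ m / m.factorial) := by
  obtain ⟨y, hy⟩ := hP.exists_tendsto_kernelCoeff hL hα
  obtain ⟨c, hc⟩ := (Metric.isBounded_range_of_tendsto _ hy).exists_norm_le
  have hc' : ∀ n : ℕ, |kernelCoeff L n 0 0 / n| ≤ c := fun n => hc _ ⟨n, rfl⟩
  have hc0 : 0 ≤ c := (abs_nonneg _).trans (hc' 0)
  set M := 2 * α + 2 with hM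
  have hM0 : 0 ≤ M := by positivity
  have hterm : ∀ n, 1 ≤ n → ∀ l m, |kernelCoeff L n 0 0 / n * (scaledOdd α n l * scaledEven α n m
      - scaledEven α n l * scaledOdd α n m)| ≤ 2 * c * ((2 * M) ^ (l + m) / (l + m).factorial) := by
    intro n hn l m
    have h1 : |scaledOdd α n l * scaledEven α n m| ≤ (2 * M) ^ (l + m) / (l + m).factorial := by
      rw [abs_mul]
      exact (mul_le_mul (abs_scaledOdd_le hα hn l) (abs_scaledEven_le hα hn m) (abs_nonneg _)
        (by positivity)).trans (pow_div_factorial_mul_le hM0 l m)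
    have h2 : |scaledEven α n l * scaledOdd α n m| ≤ (2 * M) ^ (l + m) / (l + m).factorial := by
      rw [abs_mul]
      exact (mul_le_mul (abs_scaledEven_le hα hn l) (abs_scaledOdd_le hα hn m) (abs_nonneg _)
        (by positivity)).trans (pow_div_factorial_mul_le hM0 l m)
    have h3 := (abs_sub (scaledOdd α n l * scaledEven α n m)
      (scaledEven α n l * scaledOdd α n m)).trans (add_le_add h1 h2)
    rw [abs_mul]
    refine (mul_le_mul (hc' n) h3 (abs_nonneg _) hc0).trans (le_of_eq (by ring))
  -- Lowering m to 0 produces m + 1 Wronskian terms, all of total degree l + m + 1.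
  have hind : ∀ n, 1 ≤ n → ∀ m l, |scaledKernelCoeff L n l m|
      ≤ (m + 1) * (2 * c * ((2 * M) ^ (l + m + 1) / (l + m + 1).factorial)) := by
    intro n hn m
    induction m with
    | zero =>
      intro l
      rw [hP.scaledKernelCoeff_zero hL hn]
      simpa using hterm n hn (l + 1) 0
    | succ m ih =>
      intro l
      rw [hP.scaledKernelCoeff_succ hL hn]
      refine (abs_add_le _ _).trans ((add_le_add (ih (l + 1)) (hterm n hn (l + 1) (m + 1))).trans
        (le_of_eq ?_))
      rw [show l + 1 + m + 1 = l + (m + 1) + 1 by ring, show l + 1 + (m + 1) = l + (m + 1) + 1 by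
        ring]
      push_cast
      ring
  refine ⟨2 * c * (4 * M), 4 * M, by positivity, by positivity, fun n l m hn => ?_⟩
  refine (hind n hn m l).trans ?_
  have h1 : ((m : ℝ) + 1) ≤ 2 ^ (l + m + 1) := by
    have h2 : m + 1 ≤ 2 ^ (l + m + 1) :=
      (Nat.lt_two_pow_self (n := m)).trans_le (Nat.pow_le_pow_right (by norm_num) (by omega))
    exact_mod_cast h2
  have h2 : (l.factorial : ℝ) * m.factorial ≤ (l + m + 1).factorial := by
    have h3 : l.factorial * m.factorial ≤ (l + m + 1).factorial :=
      (Nat.le_of_dvd (Nat.factorial_pos _) (Nat.factorial_mul_factorial_dvd_factorial_add l m)).trans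
        (Nat.factorial_le (by omega))
    exact_mod_cast h3
  have hl : (0 : ℝ) < l.factorial := by exact_mod_cast Nat.factorial_pos _
  have hm : (0 : ℝ) < m.factorial := by exact_mod_cast Nat.factorial_pos _
  calc ((m : ℝ) + 1) * (2 * c * ((2 * M) ^ (l + m + 1) / (l + m + 1).factorial))
      ≤ 2 ^ (l + m + 1) * (2 * c * ((2 * M) ^ (l + m + 1) / (l.factorial * m.factorial))) := by
        gcongr
    _ = 2 * c * (4 * M) * ((4 * M) ^ l / l.factorial) * ((4 * M) ^ m / m.factorial) := by
        rw [show (4 : ℝ) * M = 2 * (2 * M) by ring, mul_pow 2 (2 * M) l, mul_pow 2 (2 * M) m]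
        field_simp
        ring

end KernelLimits

/-! ### Holomorphic continuation of the gap moments -/

noncomputable section AnalyticMoments

open Metric

theorem one_sub_sq_mem_slitPlane {z : ℂ} (hz : ‖z‖ < 1) : 1 - z ^ 2 ∈ Complex.slitPlane := by
  left
  have h1 : (z ^ 2).re ≤ ‖z‖ ^ 2 := by
    rw [← norm_pow]; exact Complex.re_le_norm _
  have h2 : ‖z‖ ^ 2 < 1 := by nlinarith [norm_nonneg z]
  rw [Complex.sub_re, Complex.one_re]
  linarith

/-- The integrals of `x ^ k (1 - x ^ 2) ^ α` over `(-a, a)` extend to holomorphic functions of `a`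
on the unit disc, with control at the origin. -/
theorem exists_analytic_moments {α : ℝ} (hα : 0 < α) (k : ℕ) :
    ∃ e : ℂ → ℂ, DifferentiableOn ℂ e (ball 0 1) ∧
      (∀ a ∈ Ico (0 : ℝ) 1, e a = ((∫ x in (-a)..a, x ^ k * (1 - x ^ 2) ^ α : ℝ) : ℂ)) ∧
      (∀ z ∈ ball (0 : ℂ) 1, ‖e z‖ ≤ 2 * 2 ^ α * ‖z‖ ^ (k + 1)) ∧
      ∀ ε > 0, ∀ᶠ z in 𝓝 (0 : ℂ),
        ‖e z - (z ^ (k + 1) - (-z) ^ (k + 1)) / (k + 1)‖ ≤ ε * ‖z‖ ^ (k + 1) := by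
  set f : ℂ → ℂ := fun w => w ^ k * (1 - w ^ 2) ^ (α : ℂ) with hf
  have hfd : DifferentiableOn ℂ f (ball 0 1) := by
    intro z hz
    have hz : ‖z‖ < 1 := by simpa using hz
    have h1 : DifferentiableAt ℂ (fun w : ℂ => 1 - w ^ 2) z := by fun_prop
    exact ((differentiableAt_id.pow k).mul
      (h1.cpow_const (one_sub_sq_mem_slitPlane hz))).differentiableWithinAt
  -- The moment is g(z) - g(-z) for a primitive g on the disc; `hmv` below turns bounds for the
  -- integrand into bounds for such differences.
  obtain ⟨g, hg⟩ := hfd.isExactOn_ball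
  have hneg : ∀ {z : ℂ}, z ∈ ball (0 : ℂ) 1 → -z ∈ ball (0 : ℂ) 1 := by simp
  have hmv : ∀ (G : ℂ → ℂ) (G' : ℂ → ℂ) (C : ℝ) (z : ℂ), z ∈ ball (0 : ℂ) 1 →
      (∀ w ∈ ball (0 : ℂ) 1, HasDerivAt G (G' w) w) → (∀ w, ‖w‖ ≤ ‖z‖ → ‖G' w‖ ≤ C) →
      ‖G z - G (-z)‖ ≤ C * (2 * ‖z‖) := by
    intro G G' C z hz hG hC
    have hz' : ‖z‖ < 1 := by simpa using hz
    have := (convex_closedBall (0 : ℂ) ‖z‖).norm_image_sub_le_of_norm_hasDerivWithin_le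
      (f := G) (f' := G') (C := C) (x := -z) (y := z)
      (fun w hw => (hG w (by simp at hw ⊢; linarith)).hasDerivWithinAt)
      (fun w hw => hC w (by simpa using hw)) (by simp) (by simp)
    rwa [sub_neg_eq_add, ← two_mul, norm_mul, Complex.norm_two] at this
  refine ⟨fun z => g z - g (-z), ?_, ?_, ?_, ?_⟩
  · intro z hz
    exact ((hg z hz).differentiableAt.sub
      ((hg _ (hneg hz)).differentiableAt.comp z differentiableAt_id.neg)).differentiableWithinAt
  · intro a ha
    have h1 : ∀ x ∈ uIcc (-a) a, HasDerivAt (fun y : ℝ => g y)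
        (((x ^ k * (1 - x ^ 2) ^ α : ℝ) : ℂ)) x := by
      intro x hx
      rw [uIcc_of_le (by linarith [ha.1])] at hx
      have hx1 : |x| < 1 := abs_lt.2 ⟨by linarith [hx.1, ha.2], by linarith [hx.2, ha.2]⟩
      have h2 := (hg (x : ℂ) (by simpa using hx1)).comp_ofReal
      refine h2.congr_deriv ?_
      have h3 : 0 ≤ 1 - x ^ 2 := by nlinarith [abs_lt.1 hx1]
      rw [hf]
      push_cast [Complex.ofReal_cpow h3]
      rfl
    have hc : Continuous fun x : ℝ => x ^ k * (1 - x ^ 2) ^ α :=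
      (continuous_id.pow k).mul ((continuous_const.sub (continuous_id.pow 2)).rpow_const
        fun _ => Or.inr hα.le)
    have h4 := intervalIntegral.integral_eq_sub_of_hasDerivAt h1
      ((Complex.continuous_ofReal.comp hc).intervalIntegrable _ _)
    rw [intervalIntegral.integral_ofReal] at h4
    rw [h4]
    simp
  · intro z hz
    have hz' : ‖z‖ < 1 := by simpa using hz
    have := hmv g f (‖z‖ ^ k * 2 ^ α) z hz hg fun w hw => by
      rw [hf]
      simp only [norm_mul, norm_pow, Complex.norm_cpow_real]
      have h1 : ‖1 - w ^ 2‖ ≤ 2 := by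
        refine (norm_sub_le _ _).trans ?_
        rw [norm_one, norm_pow]
        nlinarith [norm_nonneg w]
      gcongr
    refine this.trans (le_of_eq ?_)
    ring
  · intro ε hε
    have hcont : Tendsto (fun w : ℂ => (1 - w ^ 2) ^ (α : ℂ) - 1) (𝓝 0) (𝓝 0) := by
      have h1 : ContinuousAt (fun w : ℂ => (1 - w ^ 2) ^ (α : ℂ) - 1) 0 := by
        have h2 : ContinuousAt (fun w : ℂ => 1 - w ^ 2) 0 := by fun_prop
        exact (h2.cpow continuousAt_const (by simp)).sub continuousAt_const
      simpa [ContinuousAt] using h1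
    obtain ⟨δ, hδ, hδ'⟩ := Metric.eventually_nhds_iff.1
      (Metric.tendsto_nhds.1 hcont (ε / 2) (by linarith))
    filter_upwards [ball_mem_nhds (0 : ℂ) hδ, ball_mem_nhds (0 : ℂ) one_pos] with z hz hz1
    have hk : ((k : ℂ) + 1) ≠ 0 := by exact_mod_cast Nat.succ_ne_zero k
    have h1 : ∀ w ∈ ball (0 : ℂ) 1, HasDerivAt (fun w => g w - w ^ (k + 1) / (k + 1))
        (w ^ k * ((1 - w ^ 2) ^ (α : ℂ) - 1)) w := by
      intro w hw
      refine ((hg w hw).sub ((hasDerivAt_pow (k + 1) w).div_const _)).congr_deriv ?_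
      rw [hf]
      push_cast
      field_simp
    have := hmv _ _ (‖z‖ ^ k * (ε / 2)) z hz1 h1 fun w hw => by
      have h2 : ‖(1 - w ^ 2) ^ (α : ℂ) - 1‖ ≤ ε / 2 := by
        have h3 := hδ' (y := w) (by simp at hz ⊢; linarith)
        rw [dist_zero_right] at h3
        exact h3.le
      rw [norm_mul, norm_pow]
      gcongr
    refine le_trans (le_of_eq ?_) (this.trans (le_of_eq ?_))
    · congr 1
      ring
    · ring

end AnalyticMoments

/-! ### The gap probability as a holomorphic determinant -/

noncomputable section ScaledGapProbability

open Metric Polynomial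

/-- With T the coefficient matrix and D the inverse norms, the kernel matrix is TᵀDT, while T
diagonalizes the moment matrix to D⁻¹. -/
theorem IsSymmPos.sum_kernelCoeff_mul {L : ℝ[X] →ₗ[ℝ] ℝ} (hL : IsSymmPos L) (n : ℕ) :
    (Matrix.of fun i j : Fin n => kernelCoeff L n i j) * momentMatrix L n = 1 := by
  set T := orthoCoeffMatrix L n with hT
  set D := Matrix.diagonal fun i : Fin n => (orthoNorm L i)⁻¹ with hD
  have h1 : (Matrix.of fun i j : Fin n => kernelCoeff L n i j) = T.transpose * D * T := by
    ext i j
    rw [Matrix.mul_apply, Matrix.of_apply, kernelCoeff, Finset.sum_range]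
    refine Finset.sum_congr rfl fun k _ => ?_
    rw [hD, Matrix.mul_diagonal, hT, Matrix.transpose_apply, orthoCoeffMatrix, Matrix.of_apply,
      Matrix.of_apply]
    ring
  have h2 := hL.orthoCoeffMatrix_mul n
  have h3 : D * (Matrix.diagonal fun i : Fin n => orthoNorm L i) = 1 := by
    rw [hD, Matrix.diagonal_mul_diagonal]
    simp [fun i : Fin n => (hL.orthoNorm_pos i).ne']
  have hu : IsUnit T.transpose := by
    rw [Matrix.isUnit_iff_isUnit_det, Matrix.det_transpose, det_orthoCoeffMatrix]
    exact isUnit_one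
  refine hu.mul_right_cancel ?_
  rw [h1, one_mul]
  calc T.transpose * D * T * momentMatrix L n * T.transpose
      = T.transpose * (D * (T * momentMatrix L n * T.transpose)) := by
        simp only [Matrix.mul_assoc]
    _ = T.transpose := by rw [h2, h3, Matrix.mul_one]

variable {α : ℝ} (hα : 0 < α)

/-- The holomorphic continuation of the integrals of `x ^ k (1 - x ^ 2) ^ α` over `(-a, a)`. -/
def analyticMoment (k : ℕ) : ℂ → ℂ := (exists_analytic_moments hα k).choose

theorem analyticMoment_spec (k : ℕ) :
    DifferentiableOn ℂ (analyticMoment hα k) (ball 0 1) ∧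
      (∀ a ∈ Ico (0 : ℝ) 1, analyticMoment hα k a =
        ((∫ x in (-a)..a, x ^ k * (1 - x ^ 2) ^ α : ℝ) : ℂ)) ∧
      (∀ z ∈ ball (0 : ℂ) 1, ‖analyticMoment hα k z‖ ≤ 2 * 2 ^ α * ‖z‖ ^ (k + 1)) ∧
      ∀ ε > 0, ∀ᶠ z in 𝓝 (0 : ℂ),
        ‖analyticMoment hα k z - (z ^ (k + 1) - (-z) ^ (k + 1)) / (k + 1)‖ ≤ ε * ‖z‖ ^ (k + 1) :=
  (exists_analytic_moments hα k).choose_spec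

/-- The entries of the matrix whose determinant is the scaled gap probability. -/
def scaledEntry (n : ℕ) (z : ℂ) (l k : ℕ) : ℂ :=
  ∑ m ∈ Finset.range n, (scaledKernelCoeff (gapFunctional hα 0) n l m : ℂ)
    * ((n : ℂ) ^ (m + k + 1) * analyticMoment hα (m + k) (z / n))

/-- The holomorphic continuation of `s ↦ P(s / n, n)`. -/
def scaledGapProb (n : ℕ) (z : ℂ) : ℂ := cornerDet (scaledEntry hα n z) n

theorem gapProb_eq_det {a : ℝ} (ha : a ∈ Ico (0 : ℝ) 1) (n : ℕ) :
    gapProb α n a = (1 - (Matrix.of fun i j : Fin n => kernelCoeff (gapFunctional hα 0) n i j)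
      * Matrix.of fun i j : Fin n =>
        ∫ x in (-a)..a, x ^ ((i : ℕ) + j) * (1 - x ^ 2) ^ α).det := by
  have h0 : (0 : ℝ) ∈ Ico (0 : ℝ) 1 := by norm_num
  have h1 := (gapFunctional_isSymmPos hα h0).sum_kernelCoeff_mul n
  have h2 : momentMatrix (gapFunctional hα a) n = momentMatrix (gapFunctional hα 0) n
      - Matrix.of fun i j : Fin n => ∫ x in (-a)..a, x ^ ((i : ℕ) + j) * (1 - x ^ 2) ^ α := by
    ext i j
    simp [momentMatrix, gapFunctional_apply]
  have h3 := congrArg Matrix.det h1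
  rw [Matrix.det_mul, Matrix.det_one, ← hankelDet_eq_det_momentMatrix hα h0] at h3
  rw [← h1, ← Matrix.mul_sub, ← h2, Matrix.det_mul, ← hankelDet_eq_det_momentMatrix hα ha, gapProb,
    eq_div_of_mul_eq (hankelDet_pos hα h0 n).ne' h3]
  ring

/-- The powers of n in the rescaled entries amount to conjugation by the diagonal matrix with
entries n^i, which leaves the determinant unchanged. -/
theorem scaledGapProb_ofReal {n : ℕ} {s : ℝ} (hs : 0 ≤ s) (hn : s < n) :
    scaledGapProb hα n s = (gapProb α n (s / n) : ℂ) := by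
  have hn0 : (0 : ℝ) < n := hs.trans_lt hn
  have hnC : (n : ℂ) ≠ 0 := by exact_mod_cast hn0.ne'
  have ha : s / n ∈ Ico (0 : ℝ) 1 := ⟨by positivity, by rwa [div_lt_one hn0]⟩
  have hmap : ∀ M : Matrix (Fin n) (Fin n) ℝ, ((M.det : ℝ) : ℂ)
      = (M.map Complex.ofReal).det := fun M =>
    RingHom.map_det Complex.ofRealHom M
  rw [gapProb_eq_det hα ha, hmap, scaledGapProb,
    ← cornerDet_conj _ (x := fun i => (n : ℂ) ^ i) (fun i => pow_ne_zero _ hnC), cornerDet]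
  congr 1
  ext i j
  have he : ∀ k, analyticMoment hα k ((s : ℂ) / n) = _ := fun k => by
    have := (analyticMoment_spec hα k).2.1 (s / n) ha
    push_cast at this
    exact this
  rw [Matrix.of_apply, Matrix.map_apply, Matrix.sub_apply, Matrix.mul_apply, Matrix.one_apply,
    scaledEntry, Finset.sum_range, Finset.mul_sum, Finset.sum_mul]
  simp only [he, Matrix.of_apply]
  push_cast
  congr 1
  · split_ifs <;> simp
  · refine Finset.sum_congr rfl fun m _ => ?_
    rw [scaledKernelCoeff]
    push_cast
    simp only [pow_add]
    field_simp

theorem differentiableOn_scaledGapProb (n : ℕ) :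
    DifferentiableOn ℂ (scaledGapProb hα n) (ball 0 n) := by
  have h1 : ∀ k, DifferentiableOn ℂ (fun z : ℂ => analyticMoment hα k (z / n)) (ball 0 n) := by
    intro k
    refine (analyticMoment_spec hα k).1.comp (differentiableOn_id.div_const _) ?_
    intro z hz
    have hz : ‖z‖ < n := by simpa using hz
    have hn : (0 : ℝ) < n := (norm_nonneg _).trans_lt hz
    simpa [div_lt_one hn] using hz
  have h2 : ∀ l k, DifferentiableOn ℂ (fun z => scaledEntry hα n z l k) (ball 0 n) := by
    intro l k
    unfold scaledEntry
    exact DifferentiableOn.fun_sum fun m _ => ((h1 _).const_mul _).const_mul _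
  unfold scaledGapProb cornerDet
  simp only [Matrix.det_apply, Matrix.of_apply]
  exact DifferentiableOn.fun_sum fun σ _ => DifferentiableOn.const_smul
    (DifferentiableOn.fun_finsetProd fun i _ => (h2 _ _).const_sub _) _

theorem gapFunctional_zero_isPearson : IsPearson (gapFunctional hα 0) α (1 / 2) 0 := by
  intro p
  rw [gapFunctional_isPearson hα (by norm_num) p]
  simp

/-- Near the origin the weight is 1 to leading order. The limit is taken jointly in n and the point,
so that it later yields local uniformity. -/
theorem tendsto_scaledMoment (z : ℂ) (j : ℕ) :
    ∃ y, Tendsto (fun p : ℕ × ℂ => (p.1 : ℂ) ^ (j + 1) * analyticMoment hα j (p.2 / p.1))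
      (atTop ×ˢ 𝓝 z) (𝓝 y) := by
  have hfst : Tendsto (fun p : ℕ × ℂ => p.1) (atTop ×ˢ 𝓝 z) atTop := tendsto_fst
  have hsnd : Tendsto (fun p : ℕ × ℂ => p.2) (atTop ×ˢ 𝓝 z) (𝓝 z) := tendsto_snd
  have hdiv : Tendsto (fun p : ℕ × ℂ => p.2 / p.1) (atTop ×ˢ 𝓝 z) (𝓝 0) := by
    have := hsnd.mul ((tendsto_inv_atTop_nhds_zero_nat (𝕜 := ℂ)).comp hfst)
    simpa [div_eq_mul_inv] using this
  have hmain : Tendsto (fun p : ℕ × ℂ => (p.2 ^ (j + 1) - (-p.2) ^ (j + 1)) / (j + 1))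
      (atTop ×ˢ 𝓝 z) (𝓝 ((z ^ (j + 1) - (-z) ^ (j + 1)) / (j + 1))) :=
    ((hsnd.pow _).sub (hsnd.neg.pow _)).div_const _
  refine ⟨(z ^ (j + 1) - (-z) ^ (j + 1)) / (j + 1), ?_⟩
  · have hdiff : Tendsto (fun p : ℕ × ℂ => (p.1 : ℂ) ^ (j + 1) * analyticMoment hα j (p.2 / p.1)
        - (p.2 ^ (j + 1) - (-p.2) ^ (j + 1)) / (j + 1)) (atTop ×ˢ 𝓝 z) (𝓝 0) := by
      rw [Metric.tendsto_nhds]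
      intro ε hε
      have hR : ∀ᶠ p : ℕ × ℂ in atTop ×ˢ 𝓝 z, ‖p.2‖ < ‖z‖ + 1 :=
        hsnd.norm.eventually (gt_mem_nhds (by linarith))
      have hR0 : 0 < (‖z‖ + 1) ^ (j + 1) := by positivity
      have h1 := hdiv.eventually ((analyticMoment_spec hα j).2.2.2
        (ε / (2 * (‖z‖ + 1) ^ (j + 1))) (by positivity))
      filter_upwards [h1, hR, hfst.eventually_gt_atTop 0] with p hp hpR hp0
      have hn : (0 : ℝ) < p.1 := by exact_mod_cast hp0
      have hnC : (p.1 : ℂ) ≠ 0 := by exact_mod_cast hn.ne'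
      have e : (p.1 : ℂ) ^ (j + 1) * analyticMoment hα j (p.2 / p.1)
          - (p.2 ^ (j + 1) - (-p.2) ^ (j + 1)) / (j + 1)
          = (p.1 : ℂ) ^ (j + 1) * (analyticMoment hα j (p.2 / p.1)
            - ((p.2 / p.1) ^ (j + 1) - (-(p.2 / p.1)) ^ (j + 1)) / (j + 1)) := by
        rw [← neg_div, div_pow, div_pow]
        field_simp
      rw [dist_zero_right, e, norm_mul, norm_pow, Complex.norm_natCast]
      have h2 : (p.1 : ℝ) ^ (j + 1) * (ε / (2 * (‖z‖ + 1) ^ (j + 1)) * ‖p.2 / p.1‖ ^ (j + 1))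
          = ε / 2 * (‖p.2‖ ^ (j + 1) / (‖z‖ + 1) ^ (j + 1)) := by
        rw [norm_div, Complex.norm_natCast, div_pow]
        field_simp
      have h3 : ‖p.2‖ ^ (j + 1) / (‖z‖ + 1) ^ (j + 1) ≤ 1 := by
        rw [div_le_one hR0]
        gcongr
      calc _ ≤ (p.1 : ℝ) ^ (j + 1) * (ε / (2 * (‖z‖ + 1) ^ (j + 1)) * ‖p.2 / p.1‖ ^ (j + 1)) := by
            gcongr
        _ ≤ ε / 2 * 1 := by rw [h2]; gcongr
        _ < ε := by linarith
    have := hdiff.add hmain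
    simpa using this

end ScaledGapProbability

/-! ### The entire limit of the gap probabilities and its zeros -/

noncomputable section ScaledGapProbabilityLimit

open Metric Polynomial

theorem scaledKernelCoeff_eq_zero (L : ℝ[X] →ₗ[ℝ] ℝ) {n m : ℕ} (l : ℕ) (h : n ≤ m) :
    scaledKernelCoeff L n l m = 0 := by
  rw [scaledKernelCoeff, kernelCoeff, Finset.sum_eq_zero, zero_div]
  intro k hk
  have : (orthoPoly L k).coeff m = 0 := by
    refine Polynomial.coeff_eq_zero_of_natDegree_lt ?_
    rw [natDegree_orthoPoly]
    exact (Finset.mem_range.1 hk).trans_le h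
  rw [this]
  simp

variable {α : ℝ} (hα : 0 < α)

theorem exists_norm_scaledEntry_summand_le : ∃ c M : ℝ, 0 ≤ c ∧ 0 ≤ M ∧
    ∀ (n : ℕ) (z : ℂ) (R : ℝ), ‖z‖ ≤ R → R < n → ∀ l m k,
      ‖(scaledKernelCoeff (gapFunctional hα 0) n l m : ℂ)
        * ((n : ℂ) ^ (m + k + 1) * analyticMoment hα (m + k) (z / n))‖
      ≤ c * (M ^ l / l.factorial) * ((M * R) ^ m / m.factorial) * R ^ (k + 1) := by
  obtain ⟨c, M, hc, hM, hb⟩ := (gapFunctional_zero_isPearson hα).exists_scaledKernelCoeff_bound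
    (gapFunctional_isSymmPos hα (by norm_num)) hα
  refine ⟨c * (2 * 2 ^ α), M, by positivity, hM, fun n z R hz hn l m k => ?_⟩
  have hR : 0 ≤ R := (norm_nonneg z).trans hz
  have hn0 : (0 : ℝ) < n := hR.trans_lt hn
  have h1 : ‖(n : ℂ) ^ (m + k + 1) * analyticMoment hα (m + k) (z / n)‖
      ≤ 2 * 2 ^ α * R ^ (m + k + 1) := by
    have hz1 : z / n ∈ ball (0 : ℂ) 1 := by
      rw [mem_ball_zero_iff, norm_div, Complex.norm_natCast, div_lt_one hn0]
      exact hz.trans_lt hn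
    have h2 := (analyticMoment_spec hα (m + k)).2.2.1 _ hz1
    rw [norm_mul, norm_pow, Complex.norm_natCast]
    calc _ ≤ (n : ℝ) ^ (m + k + 1) * (2 * 2 ^ α * ‖z / n‖ ^ (m + k + 1)) := by gcongr
      _ = 2 * 2 ^ α * ‖z‖ ^ (m + k + 1) := by
        rw [norm_div, Complex.norm_natCast, div_pow]
        field_simp
      _ ≤ _ := by gcongr
  have h3 : ‖(scaledKernelCoeff (gapFunctional hα 0) n l m : ℂ)‖
      ≤ c * (M ^ l / l.factorial) * (M ^ m / m.factorial) := by
    rw [Complex.norm_real]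
    exact hb n l m (by exact_mod_cast hn0)
  rw [norm_mul]
  calc _ ≤ c * (M ^ l / l.factorial) * (M ^ m / m.factorial) * (2 * 2 ^ α * R ^ (m + k + 1)) := by
        gcongr
    _ = _ := by
      rw [mul_pow, add_assoc, pow_add]
      ring

theorem eventually_norm_lt (z : ℂ) : ∀ᶠ p : ℕ × ℂ in atTop ×ˢ 𝓝 z,
    ‖p.2‖ ≤ ‖z‖ + 1 ∧ ‖z‖ + 1 < p.1 := by
  have h1 : Tendsto (fun p : ℕ × ℂ => ‖p.2‖) (atTop ×ˢ 𝓝 z) (𝓝 ‖z‖) := tendsto_snd.norm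
  have h2 : Tendsto (fun p : ℕ × ℂ => (p.1 : ℝ)) (atTop ×ˢ 𝓝 z) atTop :=
    tendsto_natCast_atTop_atTop.comp tendsto_fst
  exact (h1.eventually (ge_mem_nhds (by linarith))).and (h2.eventually_gt_atTop _)

/-- Kernel coefficients vanish for m ≥ n, so the finite sum is a full series and dominated
convergence applies. -/
theorem exists_tendsto_scaledEntry (z : ℂ) (l k : ℕ) :
    ∃ y, Tendsto (fun p : ℕ × ℂ => scaledEntry hα p.1 p.2 l k) (atTop ×ˢ 𝓝 z) (𝓝 y) := by
  obtain ⟨c, M, hc, hM, hb⟩ := exists_norm_scaledEntry_summand_le hα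
  choose u hu using (gapFunctional_zero_isPearson hα).exists_tendsto_scaledKernelCoeff
    (gapFunctional_isSymmPos hα (by norm_num)) hα
  choose v hv using tendsto_scaledMoment hα z
  have h1 : ∀ p : ℕ × ℂ, scaledEntry hα p.1 p.2 l k
      = ∑' m, (scaledKernelCoeff (gapFunctional hα 0) p.1 l m : ℂ)
        * ((p.1 : ℂ) ^ (m + k + 1) * analyticMoment hα (m + k) (p.2 / p.1)) := by
    intro p
    rw [scaledEntry, tsum_eq_sum]
    intro m hm
    rw [scaledKernelCoeff_eq_zero _ _ (by simpa using hm)]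
    simp
  simp only [h1]
  refine ⟨_, tendsto_tsum_of_dominated_convergence
    (bound := fun m => c * (M ^ l / l.factorial) * ((M * (‖z‖ + 1)) ^ m / m.factorial)
      * (‖z‖ + 1) ^ (k + 1))
    (((Real.summable_pow_div_factorial _).mul_left _).mul_right _)
    (g := fun m => (u l m : ℂ) * v (m + k)) (fun m => ?_) ?_⟩
  · have h2 : Tendsto (fun p : ℕ × ℂ => scaledKernelCoeff (gapFunctional hα 0) p.1 l m)
        (atTop ×ˢ 𝓝 z) (𝓝 (u l m)) := (hu l m).comp tendsto_fst
    exact ((Complex.continuous_ofReal.tendsto _).comp h2).mul (hv (m + k))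
  · filter_upwards [eventually_norm_lt z] with p hp m
    exact hb p.1 p.2 _ hp.1 hp.2 l m k

theorem exists_tendsto_scaledGapProb (z : ℂ) :
    ∃ y, Tendsto (fun p : ℕ × ℂ => scaledGapProb hα p.1 p.2) (atTop ×ˢ 𝓝 z) (𝓝 y) := by
  obtain ⟨c, M, hc, hM, hb⟩ := exists_norm_scaledEntry_summand_le hα
  set R := ‖z‖ + 1 with hR
  have hR0 : 0 < R := by positivity
  -- The entries may grow like R^k along a row. Conjugation by (2R)^i turns this into 2^(-k), while
  -- the factorial in l still keeps the row bounds summable.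
  set x : ℕ → ℂ := fun i => ((2 * R : ℝ) : ℂ) ^ i with hx
  have hx0 : ∀ i, x i ≠ 0 := fun i => pow_ne_zero _ (by exact_mod_cast (by positivity))
  have hxn : ∀ i, ‖x i‖ = (2 * R) ^ i := fun i => by
    rw [hx]
    simp only [norm_pow, Complex.norm_real, Real.norm_eq_abs]
    rw [abs_of_pos (by positivity)]
  have hconj : ∀ p : ℕ × ℂ, scaledGapProb hα p.1 p.2
      = cornerDet (fun i j => x i * scaledEntry hα p.1 p.2 i j * (x j)⁻¹) p.1 :=
    fun p => (cornerDet_conj _ hx0 _).symm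
  simp only [hconj]
  refine exists_tendsto_cornerDet
    (b := fun l => c * R * Real.exp (M * R) * 2 * ((2 * R * M) ^ l / l.factorial)) tendsto_fst
    ((Real.summable_pow_div_factorial _).mul_left _) ?_ fun l k => ?_
  · filter_upwards [eventually_norm_lt z] with p hp l
    have h1 : ∀ k, ‖scaledEntry hα p.1 p.2 l k‖
        ≤ c * (M ^ l / l.factorial) * Real.exp (M * R) * R ^ (k + 1) := by
      intro k
      refine (norm_sum_le_of_le _ fun m _ => hb p.1 p.2 R hp.1 hp.2 l m k).trans ?_
      rw [← Finset.sum_mul, ← Finset.mul_sum]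
      have := Real.sum_le_exp_of_nonneg (by positivity : 0 ≤ M * R) p.1
      gcongr
    have h2 : ∀ k, ‖x l * scaledEntry hα p.1 p.2 l k * (x k)⁻¹‖
        ≤ c * R * Real.exp (M * R) * ((2 * R * M) ^ l / l.factorial) * (1 / 2) ^ k := by
      intro k
      rw [norm_mul, norm_mul, norm_inv, hxn, hxn]
      calc _ ≤ (2 * R) ^ l * (c * (M ^ l / l.factorial) * Real.exp (M * R) * R ^ (k + 1))
            * ((2 * R) ^ k)⁻¹ := by gcongr; exact h1 k
        _ = _ := by
          rw [mul_pow, mul_pow, mul_pow, mul_pow, one_div, inv_pow, pow_succ]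
          field_simp
    refine (Finset.sum_le_sum fun k _ => h2 k).trans ?_
    rw [← Finset.mul_sum]
    have h3 : ∑ k ∈ Finset.range p.1, (1 / 2 : ℝ) ^ k ≤ 2 :=
      sum_geometric_two_le p.1
    calc _ ≤ c * R * Real.exp (M * R) * ((2 * R * M) ^ l / l.factorial) * 2 := by gcongr
      _ = _ := by ring
  · obtain ⟨y, hy⟩ := exists_tendsto_scaledEntry hα z l k
    exact ⟨_, (hy.const_mul _).mul_const _⟩

/-- The limit of the scaled gap probabilities, an entire function. -/
def limitGapProb (z : ℂ) : ℂ := (exists_tendsto_scaledGapProb hα z).choose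

theorem tendsto_scaledGapProb (z : ℂ) :
    Tendsto (fun p : ℕ × ℂ => scaledGapProb hα p.1 p.2) (atTop ×ˢ 𝓝 z) (𝓝 (limitGapProb hα z)) :=
  (exists_tendsto_scaledGapProb hα z).choose_spec

theorem tendsto_scaledGapProb_nat (z : ℂ) :
    Tendsto (fun n => scaledGapProb hα n z) atTop (𝓝 (limitGapProb hα z)) := by
  have h : Tendsto (fun n : ℕ => (n, z)) atTop (atTop ×ˢ 𝓝 z) :=
    tendsto_id.prodMk tendsto_const_nhds
  have := (tendsto_scaledGapProb hα z).comp h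
  simpa only [Function.comp_def] using this

/-- Joint convergence in index and point forces the limit to be continuous, and the two facts
together give local uniformity. -/
theorem tendstoLocallyUniformlyOn_scaledGapProb (U : Set ℂ) :
    TendstoLocallyUniformlyOn (scaledGapProb hα) (limitGapProb hα) atTop U := by
  refine (tendstoLocallyUniformly_iff_forall_tendsto.2 fun z => ?_).tendstoLocallyUniformlyOn
  have hlim : Tendsto (limitGapProb hα) (𝓝 z) (𝓝 (limitGapProb hα z)) := by
    refine (closed_nhds_basis (limitGapProb hα z)).ge_iff.2 fun s hs => ?_
    have h1 : ∀ᶠ p : ℕ × ℂ in atTop ×ˢ 𝓝 z, scaledGapProb hα p.1 p.2 ∈ s :=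
      tendsto_scaledGapProb hα z hs.1
    change ∀ᶠ w in 𝓝 z, limitGapProb hα w ∈ s
    filter_upwards [(eventually_swap_iff.1 h1).curry] with w hw
    exact hs.2.mem_of_tendsto (tendsto_scaledGapProb_nat hα w) hw
  have h2 := (hlim.comp (tendsto_snd : Tendsto (fun p : ℕ × ℂ => p.2) (atTop ×ˢ 𝓝 z) _)).prodMk_nhds
    (tendsto_scaledGapProb hα z)
  rw [nhds_prod_eq] at h2
  exact h2.mono_right (nhds_prod_eq.symm.trans_le (nhds_le_uniformity _))

theorem differentiable_limitGapProb : Differentiable ℂ (limitGapProb hα) := by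
  intro z
  have h1 : ball (0 : ℂ) (‖z‖ + 1) ∈ 𝓝 z := isOpen_ball.mem_nhds (by simp)
  refine DifferentiableOn.differentiableAt
    ((tendstoLocallyUniformlyOn_scaledGapProb hα _).differentiableOn ?_ isOpen_ball) h1
  filter_upwards [tendsto_natCast_atTop_atTop.eventually_ge_atTop (‖z‖ + 1)] with n hn
  exact (differentiableOn_scaledGapProb hα n).mono (ball_subset_ball hn)

theorem scaledGapProb_zero {n : ℕ} (hn : 1 ≤ n) : scaledGapProb hα n 0 = 1 := by
  have h := scaledGapProb_ofReal hα (n := n) le_rfl (by exact_mod_cast hn)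
  rw [zero_div, gapProb, div_self (hankelDet_pos hα (by norm_num) n).ne'] at h
  simpa using h

theorem limitGapProb_zero : limitGapProb hα 0 = 1 :=
  tendsto_nhds_unique (tendsto_scaledGapProb_nat hα 0) (tendsto_const_nhds.congr' (by
    filter_upwards [eventually_ge_atTop 1] with n hn
    exact (scaledGapProb_zero hα hn).symm))

theorem antitoneOn_gapProb {α : ℝ} (hα : 0 < α) (n : ℕ) : AntitoneOn (gapProb α n) (Ioo 0 1) := by
  have h1 : AntitoneOn (fun b => Real.log (gapProb α n b)) (Ioo 0 1) := by
    refine antitoneOn_of_deriv_nonpos (convex_Ioo 0 1)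
      (fun a ha => (hasDerivAt_log_gapProb hα ha n).continuousAt.continuousWithinAt) ?_ ?_
    · rw [interior_Ioo]
      exact fun a ha => (hasDerivAt_log_gapProb hα ha n).differentiableAt.differentiableWithinAt
    · rw [interior_Ioo]
      intro a ha
      rw [(hasDerivAt_log_gapProb hα ha n).deriv, neg_nonpos]
      have hL := gapFunctional_isSymmPos hα (Ioo_subset_Ico_self ha)
      have ha2 : 0 ≤ 1 - a ^ 2 := by nlinarith [ha.1, ha.2]
      refine mul_nonneg (by positivity) (Finset.sum_nonneg fun k _ => ?_)
      exact div_nonneg (mul_self_nonneg _) (hL.orthoNorm_pos k).le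
  intro a ha b hb hab
  exact (Real.log_le_log_iff (gapProb_pos hα (Ioo_subset_Ico_self hb) n)
    (gapProb_pos hα (Ioo_subset_Ico_self ha) n)).1 (h1 ha hb hab)

/-- The finite-n probabilities are positive and decreasing, so a zero at s would force zeros on all
of (s, ∞); the identity theorem would then contradict the value 1 at the origin. -/
theorem limitGapProb_ne_zero {s : ℝ} (hs : 0 < s) : limitGapProb hα s ≠ 0 := by
  intro h0
  have hr : ∀ u : ℝ, 0 < u → Tendsto (fun n : ℕ => gapProb α n (u / n)) atTop
      (𝓝 (limitGapProb hα u).re) := by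
    intro u hu
    refine ((Complex.continuous_re.tendsto _).comp (tendsto_scaledGapProb_nat hα u)).congr' ?_
    filter_upwards [tendsto_natCast_atTop_atTop.eventually_gt_atTop u] with n hn
    rw [Function.comp_apply, scaledGapProb_ofReal hα hu.le hn, Complex.ofReal_re]
  have hz : ∀ u : ℝ, s < u → limitGapProb hα u = 0 := by
    intro u hu
    have hu0 := hs.trans hu
    have h1 : Tendsto (fun n : ℕ => gapProb α n (u / n)) atTop (𝓝 0) := by
      have h2 := hr s hs
      rw [h0, Complex.zero_re] at h2
      refine tendsto_of_tendsto_of_tendsto_of_le_of_le' tendsto_const_nhds h2 ?_ ?_ <;>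
      filter_upwards [tendsto_natCast_atTop_atTop.eventually_gt_atTop u] with n hn <;>
      have hn0 : (0 : ℝ) < n := hu0.trans hn
      · exact (gapProb_pos hα ⟨by positivity, by rwa [div_lt_one hn0]⟩ n).le
      · refine antitoneOn_gapProb hα n ⟨by positivity, ?_⟩ ⟨by positivity, ?_⟩ (by gcongr)
        · rw [div_lt_one hn0]; exact hu.trans hn
        · rwa [div_lt_one hn0]
    refine tendsto_nhds_unique (tendsto_scaledGapProb_nat hα u)
      (((Complex.continuous_ofReal.tendsto _).comp h1).congr' ?_)
    filter_upwards [tendsto_natCast_atTop_atTop.eventually_gt_atTop u] with n hn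
    rw [Function.comp_apply, scaledGapProb_ofReal hα hu0.le hn]
  have hE : limitGapProb hα = 0 := by
    have hA : AnalyticOnNhd ℂ (limitGapProb hα) univ := fun z _ =>
      (differentiable_limitGapProb hα).analyticAt z
    refine hA.eq_of_frequently_eq (z₀ := ((s + 1 : ℝ) : ℂ)) (fun z _ => analyticAt_const) ?_
    have h1 : Tendsto (fun k : ℕ => ((s + 1 + 1 / ((k : ℝ) + 1) : ℝ) : ℂ)) atTop
        (𝓝[≠] ((s + 1 : ℝ) : ℂ)) := by
      refine tendsto_nhdsWithin_iff.2 ⟨?_, Eventually.of_forall fun k => ?_⟩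
      · refine (Complex.continuous_ofReal.tendsto _).comp ?_
        simpa using (tendsto_one_div_add_atTop_nhds_zero_nat (𝕜 := ℝ)).const_add (s + 1)
      · have : (0 : ℝ) < 1 / ((k : ℝ) + 1) := by positivity
        simp only [mem_compl_iff, mem_singleton_iff, Complex.ofReal_inj]
        linarith
    refine h1.frequently (Frequently.of_forall fun k => ?_)
    have : (0 : ℝ) < 1 / ((k : ℝ) + 1) := by positivity
    rw [hz _ (by linarith)]
    rfl
  have := limitGapProb_zero hα
  rw [hE] at this
  exact zero_ne_one this

end ScaledGapProbabilityLimit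

/-! ### Convergence of σ_n and its derivatives near the half-line -/

noncomputable section SigmaLimit

open Metric

theorem iteratedDeriv_comp_const_mul_field {𝕜 : Type*} [NontriviallyNormedField 𝕜] (k : ℕ)
    (f : 𝕜 → 𝕜) (c : 𝕜) :
    iteratedDeriv k (fun x => f (c * x)) = fun x => c ^ k * iteratedDeriv k f (c * x) := by
  induction k with
  | zero => simp
  | succ k ih =>
    funext x
    rw [iteratedDeriv_succ, ih, deriv_const_mul_field, deriv_comp_mul_left, ← iteratedDeriv_succ,
      smul_eq_mul, pow_succ, mul_assoc]

theorem TendstoLocallyUniformlyOn.iteratedDeriv {ι : Type*} {φ : Filter ι} {F : ι → ℂ → ℂ}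
    {f : ℂ → ℂ} {U : Set ℂ} (hf : TendstoLocallyUniformlyOn F f φ U)
    (hF : ∀ᶠ n in φ, DifferentiableOn ℂ (F n) U) (hU : IsOpen U) (k : ℕ) :
    TendstoLocallyUniformlyOn (fun n => iteratedDeriv k (F n)) (iteratedDeriv k f) φ U ∧
      ∀ᶠ n in φ, DifferentiableOn ℂ (iteratedDeriv k (F n)) U := by
  induction k with
  | zero => simpa using ⟨hf, hF⟩
  | succ k ih =>
    simp only [iteratedDeriv_succ]
    exact ⟨ih.1.deriv ih.2 hU, ih.2.mono fun n hn => hn.deriv hU⟩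

theorem iteratedDeriv_ofReal_of_eqOn {f : ℝ → ℝ} {g : ℂ → ℂ} {V : Set ℂ} (hV : IsOpen V)
    (hg : DifferentiableOn ℂ g V) (h : ∀ s : ℝ, (s : ℂ) ∈ V → ((f s : ℝ) : ℂ) = g s) (k : ℕ) :
    DifferentiableOn ℂ (iteratedDeriv k g) V ∧
      ∀ s : ℝ, (s : ℂ) ∈ V → ((iteratedDeriv k f s : ℝ) : ℂ) = iteratedDeriv k g s := by
  induction k with
  | zero => simpa using ⟨hg, h⟩
  | succ k ih =>
    simp only [iteratedDeriv_succ]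
    refine ⟨ih.1.deriv hV, fun s hs => ?_⟩
    have h1 : HasDerivAt (fun y : ℝ => iteratedDeriv k g y) (deriv (iteratedDeriv k g) s) s :=
      (ih.1.differentiableAt (hV.mem_nhds hs)).hasDerivAt.comp_ofReal
    have h2 : ∀ᶠ y : ℝ in 𝓝 s, (y : ℂ) ∈ V :=
      Complex.continuous_ofReal.continuousAt.eventually (hV.mem_nhds hs)
    have h3 : HasDerivAt (fun y : ℝ => (iteratedDeriv k g y).re)
        (deriv (iteratedDeriv k g) s).re s :=
      Complex.reCLM.hasFDerivAt.comp_hasDerivAt s h1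
    have h4 : HasDerivAt (fun y : ℝ => (iteratedDeriv k g y).im)
        (deriv (iteratedDeriv k g) s).im s :=
      Complex.imCLM.hasFDerivAt.comp_hasDerivAt s h1
    have h5 : deriv (iteratedDeriv k f) s = (deriv (iteratedDeriv k g) s).re := by
      refine (h3.congr_of_eventuallyEq ?_).deriv
      filter_upwards [h2] with y hy
      rw [← ih.2 y hy, Complex.ofReal_re]
    have h6 : (deriv (iteratedDeriv k g) s).im = 0 := by
      refine h4.unique ((hasDerivAt_const s (0 : ℝ)).congr_of_eventuallyEq ?_)
      filter_upwards [h2] with y hy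
      rw [← ih.2 y hy, Complex.ofReal_im]
    rw [h5]
    exact Complex.ext (by simp) (by simp [h6])

variable {α : ℝ} (hα : 0 < α)

/-- Smoothness is inherited from the holomorphic continuation, restricted to the real axis. -/
theorem contDiffOn_gapProb {α : ℝ} (hα : 0 < α) {n : ℕ} (hn : 1 ≤ n) :
    ContDiffOn ℝ ∞ (gapProb α n) (Ioo 0 1) := by
  have hn0 : (0 : ℝ) < n := by exact_mod_cast hn
  have h1 : ContDiffOn ℝ ∞ (scaledGapProb hα n) (ball 0 n) :=
    ((differentiableOn_scaledGapProb hα n).contDiffOn isOpen_ball).restrict_scalars ℝ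
  have h2 : ContDiff ℝ ∞ fun a : ℝ => ((n * a : ℝ) : ℂ) :=
    Complex.ofRealCLM.contDiff.comp (contDiff_const.mul contDiff_id)
  have h3 : ContDiffOn ℝ ∞ (fun a : ℝ => (scaledGapProb hα n ((n * a : ℝ) : ℂ)).re) (Ioo 0 1) := by
    refine Complex.reCLM.contDiff.comp_contDiffOn (h1.comp h2.contDiffOn fun a ha => ?_)
    rw [mem_ball_zero_iff, Complex.norm_real, Real.norm_eq_abs,
      abs_of_pos (mul_pos hn0 ha.1)]
    nlinarith [ha.2]
  refine h3.congr fun a ha => ?_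
  rw [scaledGapProb_ofReal hα (mul_pos hn0 ha.1).le (by nlinarith [ha.2]), Complex.ofReal_re,
    mul_div_cancel_left₀ _ hn0.ne']

/-- The holomorphic continuation of `s ↦ σ_n(4 i s)`. -/
def complexSigma (n : ℕ) (z : ℂ) : ℂ :=
  (1 - (z / n) ^ 2) * (z * (deriv (scaledGapProb hα n) z / scaledGapProb hα n z))

/-- The limit of `s ↦ σ_n(4 i s)`. -/
def limitSigma (z : ℂ) : ℂ := z * (deriv (limitGapProb hα) z / limitGapProb hα z)

theorem scaledSigma_ofReal {n : ℕ} {s : ℝ} (hs : 0 < s) (hn : s < n) :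
    ((scaledSigma α n s : ℝ) : ℂ) = complexSigma hα n s := by
  have hn0 : (0 : ℝ) < n := hs.trans hn
  have ha : s / n ∈ Ioo (0 : ℝ) 1 := ⟨by positivity, by rwa [div_lt_one hn0]⟩
  have hpos := gapProb_pos hα (Ioo_subset_Ico_self ha) n
  set ℓ := deriv (fun b => Real.log (gapProb α n b)) (s / n) with hℓ
  have h1 : HasDerivAt (fun b => Real.log (gapProb α n b)) ℓ (s / n) :=
    (hasDerivAt_log_gapProb hα ha n).differentiableAt.hasDerivAt
  have h2 : HasDerivAt (gapProb α n) (gapProb α n (s / n) * ℓ) (s / n) := by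
    have := h1.exp
    rw [Real.exp_log hpos] at this
    refine this.congr_of_eventuallyEq ?_
    filter_upwards [Ioo_mem_nhds ha.1 ha.2] with b hb
    rw [Real.exp_log (gapProb_pos hα (Ioo_subset_Ico_self hb) n)]
  have h3 : HasDerivAt (fun u : ℝ => ((gapProb α n (u / n) : ℝ) : ℂ))
      ((gapProb α n (s / n) * ℓ * (1 / n) : ℝ) : ℂ) s :=
    (HasDerivAt.comp (h₂ := gapProb α n) s h2 ((hasDerivAt_id s).div_const (n : ℝ))).ofReal_comp
  have hball : ball (0 : ℂ) n ∈ 𝓝 (s : ℂ) := isOpen_ball.mem_nhds (by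
    rw [mem_ball_zero_iff, Complex.norm_real, Real.norm_eq_abs, abs_of_pos hs]
    exact hn)
  have h4 : HasDerivAt (fun u : ℝ => scaledGapProb hα n u) (deriv (scaledGapProb hα n) s) s :=
    ((differentiableOn_scaledGapProb hα n).differentiableAt hball).hasDerivAt.comp_ofReal
  have h5 : deriv (scaledGapProb hα n) s = ((gapProb α n (s / n) * ℓ * (1 / n) : ℝ) : ℂ) := by
    refine h4.unique (h3.congr_of_eventuallyEq ?_)
    filter_upwards [Ioo_mem_nhds hs hn] with u hu
    exact scaledGapProb_ofReal hα hu.1.le hu.2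
  rw [complexSigma, h5, scaledGapProb_ofReal hα hs.le hn, scaledSigma, gapH, ← hℓ]
  have hp : ((gapProb α n (s / n) : ℝ) : ℂ) ≠ 0 := by exact_mod_cast hpos.ne'
  push_cast
  rw [mul_assoc (Complex.ofReal _), mul_div_cancel_left₀ _ hp]
  ring

theorem exists_ball_tendsto_complexSigma {s : ℝ} (hs : 0 < s) : ∃ r > 0,
    (∀ z ∈ ball (s : ℂ) r, limitGapProb hα z ≠ 0) ∧
    TendstoLocallyUniformlyOn (complexSigma hα) (limitSigma hα) atTop (ball (s : ℂ) r) ∧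
    (∀ᶠ n in atTop, DifferentiableOn ℂ (complexSigma hα n) (ball (s : ℂ) r)) ∧
    ∀ᶠ n in atTop, ∀ u : ℝ, (u : ℂ) ∈ ball (s : ℂ) r →
      ((scaledSigma α n u : ℝ) : ℂ) = complexSigma hα n u := by
  have hFc := (differentiable_limitGapProb hα).continuous
  obtain ⟨r', hr', hne'⟩ := Metric.eventually_nhds_iff_ball.1
    (hFc.continuousAt.eventually_ne (limitGapProb_ne_zero hα hs))
  -- The bound r ≤ s keeps real points of the ball positive; r ≤ r'/2 keeps the closed ball inside
  -- the zero-free region, where compactness gives a positive lower bound for the limit.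
  set r := min s (r' / 2) with hr
  have hr0 : 0 < r := lt_min hs (by linarith)
  have hsub : closedBall (s : ℂ) r ⊆ ball (s : ℂ) r' :=
    closedBall_subset_ball ((min_le_right _ _).trans_lt (by linarith))
  have hne : ∀ z ∈ ball (s : ℂ) r, limitGapProb hα z ≠ 0 := fun z hz =>
    hne' z (hsub (ball_subset_closedBall hz))
  have hlarge : ∀ᶠ n : ℕ in atTop, ball (s : ℂ) r ⊆ ball (0 : ℂ) n := by
    filter_upwards [tendsto_natCast_atTop_atTop.eventually_ge_atTop (s + r)] with n hn z hz
    rw [mem_ball_zero_iff]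
    have h1 : ‖z - s‖ < r := by simpa [dist_eq_norm] using hz
    have h2 : ‖z‖ ≤ ‖z - s‖ + ‖(s : ℂ)‖ := by simpa using norm_add_le (z - s) (s : ℂ)
    rw [Complex.norm_real, Real.norm_eq_abs, abs_of_pos hs] at h2
    linarith
  have hdiff : ∀ᶠ n : ℕ in atTop, DifferentiableOn ℂ (scaledGapProb hα n) (ball (s : ℂ) r) :=
    hlarge.mono fun n hn => (differentiableOn_scaledGapProb hα n).mono hn
  have hF := tendstoLocallyUniformlyOn_scaledGapProb hα (ball (s : ℂ) r)
  have hF' := hF.deriv hdiff isOpen_ball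
  have hdF : Differentiable ℂ (deriv (limitGapProb hα)) :=
    fun z => (((differentiable_limitGapProb hα).analyticAt z).deriv).differentiableAt
  have hlog := hF'.div₀ hF hdF.continuous.continuousOn hFc.continuousOn hne
  have hid : TendstoLocallyUniformlyOn (fun (_ : ℕ) (z : ℂ) => z) (fun z => z) atTop
      (ball (s : ℂ) r) := fun v hv x _ =>
    ⟨univ, univ_mem, Eventually.of_forall fun _ y _ => refl_mem_uniformity hv⟩
  have hone : TendstoLocallyUniformlyOn (fun (n : ℕ) (z : ℂ) => 1 - (z / n) ^ 2) (fun _ => 1) atTop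
      (ball (s : ℂ) r) := by
    rw [tendstoLocallyUniformlyOn_iff_forall_tendsto]
    intro x _
    rw [← Uniform.tendsto_nhds_right]
    have h1 : Tendsto (fun p : ℕ × ℂ => p.2) (atTop ×ˢ 𝓝[ball (s : ℂ) r] x) (𝓝 x) :=
      tendsto_snd.mono_right nhdsWithin_le_nhds
    have h2 : Tendsto (fun p : ℕ × ℂ => ((p.1 : ℂ))⁻¹) (atTop ×ˢ 𝓝[ball (s : ℂ) r] x) (𝓝 0) :=
      tendsto_inv_atTop_nhds_zero_nat.comp tendsto_fst
    simpa [div_eq_mul_inv] using ((h1.mul h2).pow 2).const_sub 1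
  have hlogc : ContinuousOn (deriv (limitGapProb hα) / limitGapProb hα) (ball (s : ℂ) r) :=
    hdF.continuous.continuousOn.div hFc.continuousOn hne
  have hmul := hone.mul₀ (hid.mul₀ hlog continuousOn_id hlogc) continuousOn_const
    (continuousOn_id.mul hlogc)
  refine ⟨r, hr0, hne, ?_, ?_, ?_⟩
  · refine (hmul.congr fun n z _ => ?_).congr_right fun z _ => ?_
    · rfl
    · simp [limitSigma]
  · have hunif : TendstoUniformlyOn (scaledGapProb hα) (limitGapProb hα) atTop
        (closedBall (s : ℂ) r) :=
      (tendstoLocallyUniformlyOn_iff_tendstoUniformlyOn_of_compact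
        (isCompact_closedBall _ _)).1 (tendstoLocallyUniformlyOn_scaledGapProb hα _)
    obtain ⟨z₀, hz₀, hmin⟩ := (isCompact_closedBall (s : ℂ) r).exists_isMinOn
      ⟨_, mem_closedBall_self hr0.le⟩ hFc.norm.continuousOn
    have hpos : 0 < ‖limitGapProb hα z₀‖ := norm_pos_iff.2 (hne' _ (hsub hz₀))
    filter_upwards [hlarge, hdiff, Metric.tendstoUniformlyOn_iff.1 hunif _ hpos] with n hn hd hu
    have hnz : ∀ z ∈ ball (s : ℂ) r, scaledGapProb hα n z ≠ 0 := by
      intro z hz h0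
      have h1 := hu z (ball_subset_closedBall hz)
      rw [h0, dist_zero_right] at h1
      exact (hmin (ball_subset_closedBall hz)).not_gt h1
    exact ((differentiableOn_const _).sub ((differentiableOn_id.div_const _).pow 2)).mul
      (differentiableOn_id.mul ((hd.deriv isOpen_ball).div hd hnz))
  · filter_upwards [hlarge] with n hn u hu
    have h1 := hn hu
    rw [mem_ball, dist_eq_norm, ← Complex.ofReal_sub, Complex.norm_real, Real.norm_eq_abs] at hu
    have h2 : 0 < u := by
      have := (abs_lt.1 hu).1
      have := min_le_left s (r' / 2)
      linarith
    rw [mem_ball_zero_iff, Complex.norm_real, Real.norm_eq_abs, abs_of_pos h2] at h1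
    exact scaledSigma_ofReal hα h2 h1

end SigmaLimit

/-! ### Passage to the limit in the differential equation -/

noncomputable section SigmaLimitEquation

open Metric

variable {α : ℝ} (hα : 0 < α)

/-- The limit `σ` of the functions `σ_n`. -/
def limitSigmaPV (t : ℂ) : ℂ := limitSigma hα ((4 * Complex.I)⁻¹ * t)

theorem iteratedDeriv_limitSigmaPV (k : ℕ) (s : ℂ) :
    (4 * Complex.I) ^ k * iteratedDeriv k (limitSigmaPV hα) (4 * Complex.I * s)
      = iteratedDeriv k (limitSigma hα) s := by
  have h : (4 * Complex.I) ≠ 0 := by simp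
  have h1 : limitSigmaPV hα = fun t => limitSigma hα ((4 * Complex.I)⁻¹ * t) := rfl
  rw [h1, iteratedDeriv_comp_const_mul_field]
  simp only
  rw [← mul_assoc, ← mul_pow, mul_inv_cancel₀ h, one_pow, one_mul, inv_mul_cancel_left₀ h]

theorem tendstoLocallyUniformlyOn_scaledSigma (k : ℕ) : TendstoLocallyUniformlyOn
    (fun (n : ℕ) (s : ℝ) => ((iteratedDeriv k (scaledSigma α n) s : ℝ) : ℂ))
    (fun s : ℝ => iteratedDeriv k (limitSigma hα) s) atTop (Ioi 0) := by
  intro u hu s hs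
  obtain ⟨r, hr, -, hlim, hdiff, heq⟩ := exists_ball_tendsto_complexSigma hα hs
  obtain ⟨t, ht, hev⟩ := (hlim.iteratedDeriv hdiff isOpen_ball k).1 u hu s (mem_ball_self hr)
  rw [isOpen_ball.nhdsWithin_eq (mem_ball_self hr)] at ht
  refine ⟨Complex.ofReal ⁻¹' (t ∩ ball (s : ℂ) r), mem_nhdsWithin_of_mem_nhds
    (Complex.continuous_ofReal.continuousAt.preimage_mem_nhds
      (inter_mem ht (ball_mem_nhds _ hr))), ?_⟩
  filter_upwards [hev, hdiff, heq] with n h1 h2 h3 y hy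
  rw [(iteratedDeriv_ofReal_of_eqOn isOpen_ball h2 h3 k).2 y hy.2]
  exact h1 y hy.1

theorem analyticAt_limitSigma {s : ℝ} (hs : 0 < s) : AnalyticAt ℂ (limitSigma hα) s := by
  have h1 := (differentiable_limitGapProb hα).analyticAt (s : ℂ)
  exact analyticAt_id.mul (h1.deriv.div h1 (limitGapProb_ne_zero hα hs))

theorem analyticAt_limitSigmaPV {s : ℝ} (hs : 0 < s) :
    AnalyticAt ℂ (limitSigmaPV hα) (4 * Complex.I * s) := by
  have h : (4 * Complex.I)⁻¹ * (4 * Complex.I * s) = s := inv_mul_cancel_left₀ (by simp) _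
  exact AnalyticAt.comp (g := limitSigma hα) (by rw [h]; exact analyticAt_limitSigma hα hs)
    (analyticAt_const.mul analyticAt_id)

/-- The equation of H_n in the scaled variable: each derivative in s costs 1/n, and each derivative
in t = 4is another 1/(4i). -/
theorem scaledDefect_scaledSigma {α : ℝ} (hα : 0 < α) {s : ℝ} (hs : 0 < s) {n : ℕ} (hn : s < n) :
    scaledDefect (α : ℂ) (4 * Complex.I) (n : ℂ)⁻¹ (4 * Complex.I * s / (4 * Complex.I))
      (iteratedDeriv 0 (scaledSigma α n) s : ℝ)
      ((iteratedDeriv 1 (scaledSigma α n) s : ℝ) / (4 * Complex.I))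
      ((iteratedDeriv 2 (scaledSigma α n) s : ℝ) / (4 * Complex.I) ^ 2) = 0 := by
  have hn0 : (0 : ℝ) < n := hs.trans hn
  have hnC : (n : ℂ) ≠ 0 := by exact_mod_cast hn0.ne'
  have hI : (4 * Complex.I) ≠ 0 := by simp
  have hn1 : 1 ≤ n := by exact_mod_cast hn0
  have ha : s / n ∈ Ioo (0 : ℝ) 1 := ⟨by positivity, by rwa [div_lt_one hn0]⟩
  have hk : ∀ k, iteratedDeriv k (scaledSigma α n) s
      = -((n : ℝ)⁻¹ ^ k * iteratedDeriv k (gapH α n) (s / n)) := by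
    intro k
    have h1 : scaledSigma α n = -fun s => gapH α n ((n : ℝ)⁻¹ * s) := by
      funext s
      simp [scaledSigma, div_eq_inv_mul]
    rw [h1, iteratedDeriv_neg, iteratedDeriv_comp_const_mul_field, div_eq_inv_mul]
  have h0 := hnaDefect_gapH hα ha hn1
  rw [← iteratedDeriv_one, ← iteratedDeriv_succ (n := 1)] at h0
  have h2 := congrArg (Complex.ofReal) h0
  rw [← hnaDefect_scaled_nat _ _ _ _ _ (by omega), div_eq_zero_iff]
  left
  rw [← Complex.ofReal_zero, ← h2, hk, hk, hk]
  have e0 : 4 * Complex.I * (s : ℂ) / (4 * Complex.I * n) = ((s / n : ℝ) : ℂ) := by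
    push_cast
    rw [mul_div_mul_left _ _ hI]
  have e1 : ∀ x : ℝ, -(4 * Complex.I * n) * (((-((n : ℝ)⁻¹ ^ 1 * x) : ℝ) : ℂ) / (4 * Complex.I))
      = x := by
    intro x
    push_cast
    field_simp
  have e2 : ∀ x : ℝ, -(4 * Complex.I * n) ^ 2
      * (((-((n : ℝ)⁻¹ ^ 2 * x) : ℝ) : ℂ) / (4 * Complex.I) ^ 2) = x := by
    intro x
    push_cast
    field_simp
  have e3 : -(((-((n : ℝ)⁻¹ ^ 0 * iteratedDeriv 0 (gapH α n) (s / n)) : ℝ)) : ℂ)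
      = ((gapH α n (s / n) : ℝ) : ℂ) := by
    simp
  rw [e0, e1, e2, e3]
  simp only [hnaDefect]
  push_cast
  rfl

theorem continuous_scaledDefect (α c b : ℂ) : Continuous fun p : ℂ × ℂ × ℂ × ℂ =>
    scaledDefect α c p.1 b p.2.1 p.2.2.1 p.2.2.2 := by
  unfold scaledDefect
  fun_prop

/-- The defect is continuous jointly in ε and the jet, so its vanishing at ε = 1/n persists at ε =
0, where it is the square of 16 times the σ-form. -/
theorem jmmsDefect_limitSigmaPV {s : ℝ} (hs : 0 < s) :
    jmmsDefect (4 * Complex.I * s) (limitSigmaPV hα (4 * Complex.I * s))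
      (deriv (limitSigmaPV hα) (4 * Complex.I * s))
      (deriv (deriv (limitSigmaPV hα)) (4 * Complex.I * s)) = 0 := by
  have hI : (4 * Complex.I) ≠ 0 := by simp
  have hk : ∀ k, Tendsto (fun n : ℕ =>
      ((iteratedDeriv k (scaledSigma α n) s : ℝ) : ℂ) / (4 * Complex.I) ^ k) atTop
      (𝓝 (iteratedDeriv k (limitSigmaPV hα) (4 * Complex.I * s))) := by
    intro k
    have h1 := ((tendstoLocallyUniformlyOn_scaledSigma hα k).tendsto_at hs).div_const
      ((4 * Complex.I) ^ k)
    rwa [← iteratedDeriv_limitSigmaPV, mul_div_cancel_left₀ _ (pow_ne_zero _ hI)] at h1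
  have hlim := ((continuous_scaledDefect α (4 * Complex.I)
    (4 * Complex.I * s / (4 * Complex.I))).tendsto _).comp
    ((tendsto_inv_atTop_nhds_zero_nat (𝕜 := ℂ)).prodMk_nhds
      ((hk 0).prodMk_nhds ((hk 1).prodMk_nhds (hk 2))))
  have hzero : ∀ᶠ n : ℕ in atTop, scaledDefect (α : ℂ) (4 * Complex.I) (n : ℂ)⁻¹
      (4 * Complex.I * s / (4 * Complex.I))
      ((iteratedDeriv 0 (scaledSigma α n) s : ℝ) / (4 * Complex.I) ^ 0)
      ((iteratedDeriv 1 (scaledSigma α n) s : ℝ) / (4 * Complex.I) ^ 1)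
      ((iteratedDeriv 2 (scaledSigma α n) s : ℝ) / (4 * Complex.I) ^ 2) = 0 := by
    filter_upwards [tendsto_natCast_atTop_atTop.eventually_gt_atTop s] with n hn
    rw [pow_zero, div_one, pow_one]
    exact scaledDefect_scaledSigma hα hs hn
  have h0 := tendsto_nhds_unique (hlim.congr' hzero) tendsto_const_nhds
  simp only at h0
  rw [scaledDefect_zero] at h0
  have h1 : (16 : ℂ) * _ = 0 := pow_eq_zero_iff two_ne_zero |>.1 h0
  rw [iteratedDeriv_zero, iteratedDeriv_succ (n := 1), iteratedDeriv_one] at h1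
  exact (mul_eq_zero.1 h1).resolve_left (by norm_num)

theorem sigmaPV_zero_iff (t y₀ y₁ y₂ : ℂ) :
    SigmaPV (fun _ => 0) t y₀ y₁ y₂ ↔ jmmsDefect t y₀ y₁ y₂ = 0 := by
  rw [SigmaPV, jmmsDefect, sub_eq_zero]
  have : (y₀ - t * y₁ + 2 * y₁ ^ 2 + (∑ _i : Fin 4, (0 : ℂ)) * y₁) ^ 2
      - 4 * ∏ _i : Fin 4, (0 + y₁)
      = -4 * t * y₁ ^ 3 + (4 * y₀ + t ^ 2) * y₁ ^ 2 - 2 * t * y₀ * y₁ + y₀ ^ 2 := by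
    simp
    ring
  rw [this]

end SigmaLimitEquation

theorem theorem5p2 (α : ℝ) (hα : 0 < α) :
    -- `P(·, n)` is positive and smooth on `(0, 1)`, and `H_n` solves its second order equation
    (∀ n : ℕ, 1 ≤ n →
      (∀ a ∈ Ioo (0 : ℝ) 1, 0 < gapProb α n a) ∧
      ContDiffOn ℝ ∞ (gapProb α n) (Ioo 0 1) ∧
      ∀ a ∈ Ioo (0 : ℝ) 1,
        hnaDefect α n a (gapH α n a) (deriv (gapH α n) a) (deriv (deriv (gapH α n)) a) = 0) ∧
    -- with `t = 4 i n a`, `σ(t) = -H(a)`, the equation becomes, up to `O(1/n)`, the square of the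
    -- σ-form
    (∀ t y₀ y₁ y₂ : ℂ,
      (fun n : ℕ =>
          hnaDefect (α : ℂ) (n : ℂ) (t / (4 * Complex.I * n)) (-y₀)
              (-(4 * Complex.I * n) * y₁) (-(4 * Complex.I * n) ^ 2 * y₂) / (n : ℂ) ^ 4
            - (16 * jmmsDefect t y₀ y₁ y₂) ^ 2)
        =O[atTop] fun n : ℕ => 1 / (n : ℝ)) ∧
    -- the limit of `σ_n` exists, together with its first two derivatives, and solves the σ-form
    ∃ σ : ℂ → ℂ,
      AnalyticOnNhd ℂ σ {t | ∃ s : ℝ, 0 < s ∧ t = 4 * Complex.I * s} ∧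
      (∀ k ≤ 2, TendstoLocallyUniformlyOn
        (fun (n : ℕ) (s : ℝ) => ((iteratedDeriv k (scaledSigma α n) s : ℝ) : ℂ))
        (fun s : ℝ => (4 * Complex.I) ^ k * iteratedDeriv k σ (4 * Complex.I * s))
        atTop (Ioi 0)) ∧
      ∀ s : ℝ, 0 < s → ∀ t : ℂ, t = 4 * Complex.I * s →
        SigmaPV (fun _ => 0) t (σ t) (deriv σ t) (deriv (deriv σ) t) ∧
        (t * deriv (deriv σ) t) ^ 2 =
          -4 * t * deriv σ t ^ 3 + (4 * σ t + t ^ 2) * deriv σ t ^ 2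
            - 2 * t * σ t * deriv σ t + σ t ^ 2 := by
  refine ⟨fun n hn => ⟨fun a ha => gapProb_pos hα (Ioo_subset_Ico_self ha) n,
    contDiffOn_gapProb hα hn, fun a ha => hnaDefect_gapH hα ha hn⟩,
    hnaDefect_isBigO (α : ℂ), limitSigmaPV hα, ?_, fun k _ => ?_, ?_⟩
  · rintro _ ⟨s, hs, rfl⟩
    exact analyticAt_limitSigmaPV hα hs
  · simpa only [iteratedDeriv_limitSigmaPV] using tendstoLocallyUniformlyOn_scaledSigma hα k
  · rintro s hs _ rfl
    have h := jmmsDefect_limitSigmaPV hα hs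
    exact ⟨(sigmaPV_zero_iff _ _ _ _).2 h, sub_eq_zero.1 h⟩
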